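/- **Setting.** Let $V:\mathbb R\to\mathbb R$ be such that all moments of $e^{-NV(x)}\,dx$ are finite for every $N\ge 1$. For $\beta\in\{1,2,4\}$ put $w_\beta^{(N)}=e^{-NV}$ if $\beta=1,2$ and $w_4^{(N)}=e^{-2NV}$, and let $\mathbb P_{N,\beta}$ be the law of the ordered eigenvalues $\tilde\lambda_1\le\dots\le\tilde\lambda_N$ of the corresponding orthogonal ($\beta=1$), unitary ($\beta=2$) or symplectic ($\beta=4$) invariant random matrix $H$, i.e. the probability measure on $\{\tilde\lambda_1\le\dots\le\tilde\lambda_N\}$ with density $$R_{N,N}^{(\beta)}(\tilde\lambda)=\frac1{Z_{N,\beta}}\prod_{j<k}|\tilde\lambda_k-\tilde\lambda_j|^\beta\prod_{j=1}^N w_\beta^{(N)}(\tilde\lambda_j),$$ which is also regarded as a function on $\mathbb R^N$; $\mathbb E_{N,\beta}$ and $\mathbb V_{N,\beta}$ are the expectation and the variance. Assume that there is a limiting spectral density $\psi=\psi_\beta\ge 0$, integrable, with $\frac1N\mathbb E_{N,\beta}\big(\#\{j:\tilde\lambda_j\le s\}\big)\to\int_{-\infty}^s\psi(t)\,dt$ as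 $N\to\infty$ for all $s\in\mathbb R$. Let $a$ be a point in the interior of the support of $\psi$ at which $\psi$ is continuous, with $\psi(a)>0$. Let $I_N=[a-\delta_N,a+\delta_N]$ with $\delta_N>0$, $\delta_N\to0$ and $N\delta_N\to\infty$. Put $\lambda_i=(\tilde\lambda_i-a)N\psi(a)$, $A_N=N\psi(a)(I_N-a)$, let $|A_N|$ be the length of $A_N$, and write $\tilde t=a+t/(N\psi(a))$ for $t\in\mathbb R$. For $k\le N$ the rescaled correlation functions are $$B_{N,k}^{(\beta)}(t_1,\dots,t_k)=(N\psi(a))^{-k}\,\frac1{(N-k)!}\int_{\mathbb R^{N-k}}R_{N,N}^{(\beta)}(\tilde t_1,\dots,\tilde t_k,u_1,\dots,u_{N-k})\,du .$$ **Limiting kernels.** Let $K_2(x,y)=\frac{\sin(\pi(x-y))}{\pi(x-y)}$ (equal to $1$ for $x=y$), and for $\beta=1,4$ let $K_\beta=\begin{pmatrix}S_\beta&D_\beta\\ I_\beta&S_\beta\end{pmatrix}$ with $S_1(x,y)=K_2(x,y)$, $D_1(x,y)=\partial_xK_2(x,y)$, $I_1(x,y)=\int_0^{x-y}K_2(t,0)\,dt-\frac12\operatorname{sgn}(x-y)$,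 and $S_4(x,y)=K_2(2x,2y)$, $D_4(x,y)=\partial_x\big(K_2(2x,2y)\big)$, $I_4(x,y)=\int_0^{x-y}K_2(2t,0)\,dt$. **Assumption (for $\beta$).** Let $(\kappa_N)$ be a real sequence with $\kappa_N\to0$. There are kernels $\hat K_{N,\beta}$, $N\ge1$, on $\mathbb R^2$, real-valued for $\beta=2$ and $\mathbb R^{2\times2}$-valued for $\beta=1,4$, which express the correlation functions: for all $k\le N$ and $t\in\mathbb R^k$, $$B_{N,k}^{(2)}(t)=\det\big(\hat K_{N,2}(\tilde t_i,\tilde t_j)\big)_{i,j\le k},\qquad B_{N,k}^{(\beta)}(t)=\operatorname{Pf}\big((\hat K_{N,\beta}(\tilde t_i,\tilde t_j))_{i,j\le k}\,J\big)\quad(\beta=1,4),$$ where $J=\operatorname{diag}(\sigma,\dots,\sigma)$, $\sigma=\begin{pmatrix}0&1\\-1&0\end{pmatrix}$, and the matrix under the Pfaffian is skew-symmetric; and they satisfy (entrywise for $\beta=1,4$) $$\hat K_{N,\beta}(\tilde x,\tilde y)=K_\beta(x,y)+\mathcal O(\kappa_N)$$ with an implicit constant that is uniform in $N\ge1$ and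 $x,y\in A_N$. **Counting measure.** For $k\ge2$ let $$\gamma_N(k,H)=\frac1{|A_N|}\sum_{\substack{i_1<\dots<i_k\\ \lambda_{i_1},\lambda_{i_k}\in A_N}}\delta_{\lambda_{i_k}-\lambda_{i_1}},$$ and let $\int_0^\alpha d\gamma_N(k,H)$ be its mass on $[0,\alpha]$. **Theorem.** Let $V$, $\psi_\beta$, $a$, $(\delta_N)$ and $(\kappa_N)$ be given. There are constants $C,c_1,c_2>0$ such that for every $\beta\in\{1,2,4\}$ for which the above setting and assumption hold, all integers $2\le k\le N$ and all $\alpha>0$, $$\mathbb V_{N,\beta}\Big(\int_0^\alpha d\gamma_N(k,H)\Big)\le\overline\alpha^{\,2k}\,C^k\Big(k^k\,\frac{c_1}{|A_N|}+c_2\,|\kappa_N|\Big),\qquad\overline\alpha=\max(1,\alpha).$$ -/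

import Mathlib

open MeasureTheory ProbabilityTheory Filter Topology
open scoped Kronecker Nat

noncomputable section

namespace SpacingEnsemble

/-- The three symmetry classes: orthogonal (`β = 1`), unitary (`β = 2`), symplectic (`β = 4`). -/
inductive DysonIndex
  | one
  | two
  | four

/-- The numerical value of `β`. -/
def DysonIndex.val : DysonIndex → ℕ
  | .one => 1
  | .two => 2
  | .four => 4

/-! ### The ensemble -/

/-- The weight `w_β^{(N)}`: `e^{-N V}` for `β = 1, 2` and `e^{-2 N V}` for `β = 4`. -/
def weight (β : DysonIndex) (V : ℝ → ℝ) (N : ℕ) (x : ℝ) : ℝ :=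
  match β with
  | .one => Real.exp (-(N * V x))
  | .two => Real.exp (-(N * V x))
  | .four => Real.exp (-(2 * N * V x))

/-- The Weyl chamber `{l_1 ≤ ... ≤ l_N}`. -/
def weylChamber (N : ℕ) : Set (Fin N → ℝ) :=
  {l | Monotone l}

/-- The unnormalised eigenvalue density
`∏_{j<k} |l_k - l_j|^β ∏_j w_β^{(N)}(l_j)`, as a function on `ℝ^N`. -/
def eigenWeight (β : DysonIndex) (V : ℝ → ℝ) (N : ℕ) (l : Fin N → ℝ) : ℝ :=
  (∏ j : Fin N, ∏ k ∈ Finset.Ioi j, |l k - l j| ^ β.val) * ∏ j : Fin N, weight β V N (l j)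

/-- The normalisation constant `Z_{N,β}` of the density on the Weyl chamber. -/
def partitionFunction (β : DysonIndex) (V : ℝ → ℝ) (N : ℕ) : ℝ :=
  ∫ l in weylChamber N, eigenWeight β V N l

/-- `R_{N,N}^{(β)}`: the joint density of the ordered eigenvalues, considered as a (symmetric)
function on all of `ℝ^N`. -/
def jointDensity (β : DysonIndex) (V : ℝ → ℝ) (N : ℕ) (l : Fin N → ℝ) : ℝ :=
  (partitionFunction β V N)⁻¹ * eigenWeight β V N l

/-- `ℙ_{N,β}`: the law of the ordered eigenvalues, a measure carried by the Weyl chamber. -/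
def eigenLaw (β : DysonIndex) (V : ℝ → ℝ) (N : ℕ) : Measure (Fin N → ℝ) :=
  (volume.restrict (weylChamber N)).withDensity fun l => ENNReal.ofReal (jointDensity β V N l)

/-- `V` grows so fast that all moments of `e^{-N V(x)} dx` are finite, for every `N ≥ 1`. -/
def FiniteMoments (V : ℝ → ℝ) : Prop :=
  ∀ N : ℕ, 1 ≤ N → ∀ m : ℕ, Integrable fun x : ℝ => x ^ m * Real.exp (-(N * V x))

/-- `ψ` is the limiting spectral density of the ensemble: a nonnegative integrable function with
`(1/N) 𝔼_{N,β} #{j : l_j ≤ s} → ∫_{-∞}^s ψ(t) dt`. -/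
structure IsSpectralDensity (β : DysonIndex) (V : ℝ → ℝ) (ψ : ℝ → ℝ) : Prop where
  nonneg : ∀ t, 0 ≤ ψ t
  integrable : Integrable ψ
  tendsto : ∀ s : ℝ,
    Tendsto
      (fun N : ℕ => (1 / (N : ℝ)) * ∫ l, (Nat.card {j : Fin N // l j ≤ s} : ℝ) ∂(eigenLaw β V N))
      atTop (𝓝 (∫ t in Set.Iic s, ψ t))

/-! ### Localisation and rescaling -/

/-- `I_N = [a - δ_N, a + δ_N]`. -/
def bulkInterval (a : ℝ) (δ : ℕ → ℝ) (N : ℕ) : Set ℝ :=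
  Set.Icc (a - δ N) (a + δ N)

/-- `A_N = {N ψ(a) (t - a) : t ∈ I_N}`. -/
def rescaledInterval (ψ : ℝ → ℝ) (a : ℝ) (δ : ℕ → ℝ) (N : ℕ) : Set ℝ :=
  (fun t => N * ψ a * (t - a)) '' bulkInterval a δ N

/-- The length `|A_N|`. -/
def rescaledLength (ψ : ℝ → ℝ) (a : ℝ) (δ : ℕ → ℝ) (N : ℕ) : ℝ :=
  volume.real (rescaledInterval ψ a δ N)

/-- The rescaled eigenvalue `(x - a) N ψ(a)`. -/
def rescale (ψ : ℝ → ℝ) (a : ℝ) (N : ℕ) (x : ℝ) : ℝ :=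
  (x - a) * N * ψ a

/-- The inverse rescaling `t ↦ a + t / (N ψ(a))`, written with a tilde in the usual notation. -/
def unscale (ψ : ℝ → ℝ) (a : ℝ) (N : ℕ) (t : ℝ) : ℝ :=
  a + t / (N * ψ a)

/-- The standing setting for the symmetry class `β`: a potential, its limiting spectral density,
a bulk point `a` and shrinking intervals `I_N` around `a` that contain more and more
eigenvalues. -/
structure BulkSetting (β : DysonIndex) (V : ℝ → ℝ) (ψ : ℝ → ℝ) (a : ℝ) (δ : ℕ → ℝ) : Prop where
  moments : FiniteMoments V
  density : IsSpectralDensity β V ψ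
  continuousAt : ContinuousAt ψ a
  mem_support : a ∈ interior (tsupport ψ)
  pos : 0 < ψ a
  radius_pos : ∀ N : ℕ, 1 ≤ N → 0 < δ N
  radius_tendsto : Tendsto δ atTop (𝓝 0)
  mul_radius_tendsto : Tendsto (fun N : ℕ => N * δ N) atTop atTop

/-! ### Correlation functions -/

/-- The vector `(t_1, ..., t_k, u_1, ..., u_{N-k})` of `ℝ^N`. -/
def joinVec {N k : ℕ} (t : Fin k → ℝ) (u : Fin (N - k) → ℝ) (i : Fin N) : ℝ :=
  if h : (i : ℕ) < k then t ⟨i, h⟩ else u ⟨i - k, by omega⟩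

/-- The `k`-point correlation function `R_{N,k}^{(β)}`, for `k ≤ N`. -/
def corr (β : DysonIndex) (V : ℝ → ℝ) (N k : ℕ) (t : Fin k → ℝ) : ℝ :=
  (1 / ((N - k)! : ℝ)) * ∫ u : Fin (N - k) → ℝ, jointDensity β V N (joinVec t u)

/-- The rescaled correlation function `B_{N,k}^{(β)}`, for `k ≤ N`. -/
def rescaledCorr (β : DysonIndex) (V : ℝ → ℝ) (ψ : ℝ → ℝ) (a : ℝ) (N k : ℕ)
    (t : Fin k → ℝ) : ℝ :=
  ((N * ψ a) ^ k)⁻¹ * corr β V N k fun i => unscale ψ a N (t i)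

/-! ### Pfaffians and kernels -/

/-- The Pfaffian of a skew-symmetric `2k × 2k` matrix, with the rows and columns indexed by
`Fin k × Fin 2` in lexicographic order (that is `(i, 0), (i, 1)` are in places `2i - 1, 2i`):
`Pf A = 1/(2^k k!) ∑_σ sgn(σ) ∏_i A_{σ(2i-1), σ(2i)}`. -/
def pfaffian {k : ℕ} (A : Matrix (Fin k × Fin 2) (Fin k × Fin 2) ℝ) : ℝ :=
  (1 / ((2 : ℝ) ^ k * (k ! : ℝ))) *
    ∑ σ : Equiv.Perm (Fin k × Fin 2),
      ((Equiv.Perm.sign σ : ℤ) : ℝ) * ∏ i : Fin k, A (σ (i, 0)) (σ (i, 1))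

/-- `J = diag(σ, ..., σ)` with `σ = (0 1; -1 0)`. -/
def symplecticJ (k : ℕ) : Matrix (Fin k × Fin 2) (Fin k × Fin 2) ℝ :=
  (1 : Matrix (Fin k) (Fin k) ℝ) ⊗ₖ !![0, 1; -1, 0]

/-- The `2k × 2k` matrix with the `2 × 2` blocks `K(t_i, t_j)`. -/
def blockMatrix (K : ℝ → ℝ → Matrix (Fin 2) (Fin 2) ℝ) {k : ℕ} (t : Fin k → ℝ) :
    Matrix (Fin k × Fin 2) (Fin k × Fin 2) ℝ :=
  Matrix.of fun p q => K (t p.1) (t q.1) p.2 q.2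

/-- `K` is a scalar kernel for the ensemble:
`B_{N,k}(t) = det (K(t̃_i, t̃_j))` for all `k ≤ N` and `t ∈ ℝ^k`. -/
def IsDetKernel (β : DysonIndex) (V : ℝ → ℝ) (ψ : ℝ → ℝ) (a : ℝ) (N : ℕ)
    (K : ℝ → ℝ → ℝ) : Prop :=
  ∀ k : ℕ, k ≤ N → ∀ t : Fin k → ℝ,
    rescaledCorr β V ψ a N k t =
      (Matrix.of fun i j : Fin k => K (unscale ψ a N (t i)) (unscale ψ a N (t j))).det

/-- `K` is a `2 × 2` matrix kernel for the ensemble: for all `k ≤ N` and `t ∈ ℝ^k` the matrix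
`(K(t̃_i, t̃_j)) J` is skew-symmetric and its Pfaffian is `B_{N,k}(t)`. -/
def IsPfaffKernel (β : DysonIndex) (V : ℝ → ℝ) (ψ : ℝ → ℝ) (a : ℝ) (N : ℕ)
    (K : ℝ → ℝ → Matrix (Fin 2) (Fin 2) ℝ) : Prop :=
  ∀ k : ℕ, k ≤ N → ∀ t : Fin k → ℝ,
    (blockMatrix K (fun i => unscale ψ a N (t i)) * symplecticJ k).transpose =
        -(blockMatrix K (fun i => unscale ψ a N (t i)) * symplecticJ k) ∧
      rescaledCorr β V ψ a N k t =
        pfaffian (blockMatrix K (fun i => unscale ψ a N (t i)) * symplecticJ k)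

/-- The sine kernel `sin(π(x-y)) / (π(x-y))`, equal to `1` on the diagonal. -/
def sineKernel (x y : ℝ) : ℝ :=
  Real.sinc (Real.pi * (x - y))

/-- The limiting kernel `K_1 = (S_1 D_1; I_1 S_1)`. -/
def limitKernelOne (x y : ℝ) : Matrix (Fin 2) (Fin 2) ℝ :=
  !![sineKernel x y, deriv (fun u => sineKernel u y) x;
     (∫ t in (0 : ℝ)..(x - y), sineKernel t 0) - 1 / 2 * Real.sign (x - y), sineKernel x y]

/-- The limiting kernel `K_4 = (S_4 D_4; I_4 S_4)`. -/
def limitKernelFour (x y : ℝ) : Matrix (Fin 2) (Fin 2) ℝ :=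
  !![sineKernel (2 * x) (2 * y), deriv (fun u => sineKernel (2 * u) (2 * y)) x;
     ∫ t in (0 : ℝ)..(x - y), sineKernel (2 * t) 0, sineKernel (2 * x) (2 * y)]

/-- A sequence of matrix kernels `K_N` converges to `L`, entrywise and uniformly on
`A_N × A_N`, with the rate `O(κ_N)`. -/
def MatrixKernelConverges (ψ : ℝ → ℝ) (a : ℝ) (δ κ : ℕ → ℝ)
    (K : ℕ → ℝ → ℝ → Matrix (Fin 2) (Fin 2) ℝ) (L : ℝ → ℝ → Matrix (Fin 2) (Fin 2) ℝ) : Prop :=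
  ∃ c : ℝ, ∀ N : ℕ, 1 ≤ N →
    ∀ x ∈ rescaledInterval ψ a δ N, ∀ y ∈ rescaledInterval ψ a δ N, ∀ i j : Fin 2,
      |K N (unscale ψ a N x) (unscale ψ a N y) i j - L x y i j| ≤ c * |κ N|

/-- The scalar version of `MatrixKernelConverges`. -/
def ScalarKernelConverges (ψ : ℝ → ℝ) (a : ℝ) (δ κ : ℕ → ℝ)
    (K : ℕ → ℝ → ℝ → ℝ) (L : ℝ → ℝ → ℝ) : Prop :=
  ∃ c : ℝ, ∀ N : ℕ, 1 ≤ N →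
    ∀ x ∈ rescaledInterval ψ a δ N, ∀ y ∈ rescaledInterval ψ a δ N,
      |K N (unscale ψ a N x) (unscale ψ a N y) - L x y| ≤ c * |κ N|

/-- The kernels of the ensemble (any kernels that express its rescaled correlation functions, as a
determinant for `β = 2` and as a Pfaffian for `β = 1, 4`) converge to the limiting kernel `K_β`
uniformly on the growing sets `A_N`, with the rate `O(κ_N)`. -/
def KernelUniversality (β : DysonIndex) (V : ℝ → ℝ) (ψ : ℝ → ℝ) (a : ℝ) (δ κ : ℕ → ℝ) : Prop :=
  match β with
  | .one => ∃ K : ℕ → ℝ → ℝ → Matrix (Fin 2) (Fin 2) ℝ,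
      (∀ N : ℕ, 1 ≤ N → IsPfaffKernel .one V ψ a N (K N)) ∧
        MatrixKernelConverges ψ a δ κ K limitKernelOne
  | .two => ∃ K : ℕ → ℝ → ℝ → ℝ,
      (∀ N : ℕ, 1 ≤ N → IsDetKernel .two V ψ a N (K N)) ∧
        ScalarKernelConverges ψ a δ κ K sineKernel
  | .four => ∃ K : ℕ → ℝ → ℝ → Matrix (Fin 2) (Fin 2) ℝ,
      (∀ N : ℕ, 1 ≤ N → IsPfaffKernel .four V ψ a N (K N)) ∧
        MatrixKernelConverges ψ a δ κ K limitKernelFour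

/-! ### The counting measure -/

open Classical in
/-- The measure `γ_N(k, H)` for a matrix `H` with the ordered eigenvalues `l`:
`(1/|A_N|) ∑ δ_{x_{i_k} - x_{i_1}}`, the sum being over all `i_1 < ... < i_k` such that the
rescaled eigenvalues `x_{i_1}`, `x_{i_k}` lie in `A_N`. -/
def gammaMeasure (ψ : ℝ → ℝ) (a : ℝ) (δ : ℕ → ℝ) (N k : ℕ) (hk : 2 ≤ k) (l : Fin N → ℝ) :
    Measure ℝ :=
  ENNReal.ofReal (1 / rescaledLength ψ a δ N) •
    ∑ i : Fin k → Fin N with StrictMono i ∧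
        rescale ψ a N (l (i ⟨0, by omega⟩)) ∈ rescaledInterval ψ a δ N ∧
        rescale ψ a N (l (i ⟨k - 1, by omega⟩)) ∈ rescaledInterval ψ a δ N,
      Measure.dirac
        (rescale ψ a N (l (i ⟨k - 1, by omega⟩)) - rescale ψ a N (l (i ⟨0, by omega⟩)))

/-- The random variable `∫_0^α dγ_N(k, H)`. -/
def gammaCount (ψ : ℝ → ℝ) (a : ℝ) (δ : ℕ → ℝ) (N k : ℕ) (hk : 2 ≤ k) (α : ℝ)
    (l : Fin N → ℝ) : ℝ :=
  (gammaMeasure ψ a δ N k hk l).real (Set.Icc 0 α)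

end SpacingEnsemble

end

open SpacingEnsemble

namespace SpacingEnsemble

/-! ### The Dirichlet integral -/

/-! On the Weyl chamber, `gammaCount` is 1/|A_N| times the number X of k-element label sets whose
rescaled points form a cluster: all in A_N, with mutual distances at most α (`gammaCount_eq`). X is
symmetric in the labels, so its moments are integrals against the correlation functions
(`integral_sum_embedding_rescale`). It suffices to bound Var X by max(1,α)^(2k) C^k (|A_N| + |A_N|²
|κ_N|), up to constants (`variance_clusterCount_le`).

X² counts pairs of clusters. Two clusters with a common label merge into one of m < 2k points and
width 2α. The expected number of such clusters is O(|A_N|): B_m is at most C^m m!, and counting sets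
instead of tuples divides by m! (`integral_overlap_le`). For disjoint pairs one integrates
B_{2k}(x,y) - B_k(x) B_k(y) over two clusters; the quotient (2k)!/(k!)² is at most 4^k. Replacing B
by its limit ρ costs O(κ_N) pointwise on a domain of volume O(|A_N|²). The point is that the
integral of ρ_{2k}(x,y) - ρ_k(x) ρ_k(y) is only O(|A_N|) (`abs_integral_truncated_le`). For this, x
and the shape of y are fixed and the integral over the translations τ of y is bounded uniformly
(`abs_integral_shift_le`).

While the clusters can interlace, τ runs through an interval of length 2α and the trivial bound is
enough. Once they are separated, the determinant or Pfaffian is expanded in the entries that link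
them. These come from functions that are bounded, O(1/|r|) and have bounded primitives
(`IsOscillating`). A term with one linking factor is controlled by the primitive, a term with two or
more by the integrability of 1/(1+τ²), and the term with none is ρ_k(x) ρ_k(y).

One entry needs more care: for β = 4 the entry I_4 tends to ±1/4 instead of decaying (for β = 1 the
sign term in I_1 removes the limit). The constants left between separated clusters form an
alternating matrix of rank two. It does not change the Pfaffian: two factors of it cancel by
antisymmetry, and a single one is excluded by parity (`polarPfaffian_block_add_wedge`). The decay of
what remains of the I-entries is the Dirichlet integral with remainder O(1/T)
(`abs_integral_sinc_sub_le`). -/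

lemma hasDerivAt_laplace_sin (s t : ℝ) :
    HasDerivAt (fun t => -(Real.exp (-(s * t)) * (Real.cos t + s * Real.sin t)) / (1 + s ^ 2))
      (Real.sin t * Real.exp (-(s * t))) t := by
  have h1 : HasDerivAt (fun t : ℝ => -(s * t)) (-s) t := by
    simpa using! ((hasDerivAt_id t).const_mul s).neg
  have h2 := ((h1.exp.mul ((Real.hasDerivAt_cos t).add
    ((Real.hasDerivAt_sin t).const_mul s))).neg).div_const (1 + s ^ 2)
  have hs : (1 + s ^ 2) ≠ 0 := by positivity
  refine h2.congr_deriv ?_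
  simp only [Pi.add_apply]
  field_simp
  ring

lemma integral_sin_mul_exp_neg (s T : ℝ) :
    ∫ t in (0 : ℝ)..T, Real.sin t * Real.exp (-(s * t)) =
      (1 + s ^ 2)⁻¹ - Real.exp (-(s * T)) * (Real.cos T + s * Real.sin T) / (1 + s ^ 2) := by
  rw [intervalIntegral.integral_eq_sub_of_hasDerivAt (fun t _ => hasDerivAt_laplace_sin s t)
    ((by fun_prop : Continuous fun t => Real.sin t * Real.exp (-(s * t))).intervalIntegrable _ _)]
  simp
  ring

lemma integral_exp_neg_mul_Ioi_zero {t : ℝ} (ht : 0 < t) :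
    ∫ s in Set.Ioi (0 : ℝ), Real.exp (-(s * t)) = t⁻¹ := by
  have := integral_exp_mul_Ioi (a := -t) (by linarith) 0
  simp only [mul_zero, Real.exp_zero] at this
  rw [show (fun s : ℝ => Real.exp (-(s * t))) = fun s => Real.exp (-t * s) by
    funext s; congr 1; ring, this]
  field_simp

lemma integrableOn_exp_neg_mul_Ioi {t : ℝ} (ht : 0 < t) :
    IntegrableOn (fun s : ℝ => Real.exp (-(s * t))) (Set.Ioi 0) := by
  have := integrableOn_exp_mul_Ioi (a := -t) (by linarith) 0
  refine this.congr_fun (fun s _ => ?_) measurableSet_Ioi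
  simp only
  congr 1; ring

lemma integrable_laplace_sin (T : ℝ) :
    Integrable (Function.uncurry fun t s : ℝ => Real.sin t * Real.exp (-(s * t)))
      ((volume.restrict (Set.Ioc 0 T)).prod (volume.restrict (Set.Ioi 0))) := by
  have hm : AEStronglyMeasurable
      (Function.uncurry fun t s : ℝ => Real.sin t * Real.exp (-(s * t)))
      ((volume.restrict (Set.Ioc 0 T)).prod (volume.restrict (Set.Ioi 0))) := by
    refine Continuous.aestronglyMeasurable ?_
    simp only [Function.uncurry_def]
    fun_prop
  rw [integrable_prod_iff hm]
  constructor
  · filter_upwards [ae_restrict_mem measurableSet_Ioc] with t ht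
    exact (integrableOn_exp_neg_mul_Ioi ht.1).const_mul (Real.sin t)
  · have hfin : Integrable (fun _ : ℝ => (1 : ℝ)) (volume.restrict (Set.Ioc 0 T)) :=
      integrable_const _
    refine hfin.mono' hm.norm.integral_prod_right' ?_
    filter_upwards [ae_restrict_mem measurableSet_Ioc] with t ht
    simp only [Function.uncurry_apply_pair, norm_mul, Real.norm_eq_abs, Real.abs_exp]
    rw [integral_const_mul, integral_exp_neg_mul_Ioi_zero ht.1, abs_of_nonneg (by
      have := ht.1; positivity), ← div_eq_mul_inv, div_le_one ht.1]
    simpa [abs_of_pos ht.1] using Real.abs_sin_le_abs (x := t)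

/-- Write 1/t as the integral of exp(-st) over s > 0 and exchange the integrals. The first term on
the right produces π/2, the second is the remainder. -/
lemma sinc_integral_eq (T : ℝ) (hT : 0 ≤ T) :
    ∫ t in (0 : ℝ)..T, Real.sinc t =
      ∫ s in Set.Ioi (0 : ℝ), ((1 + s ^ 2)⁻¹ -
        Real.exp (-(s * T)) * (Real.cos T + s * Real.sin T) / (1 + s ^ 2)) := by
  have h := integral_integral_swap (integrable_laplace_sin T)
  have h1 : ∫ t in (0 : ℝ)..T, Real.sinc t =
      ∫ t in Set.Ioc 0 T, ∫ s in Set.Ioi (0 : ℝ), Real.sin t * Real.exp (-(s * t)) := by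
    rw [intervalIntegral.integral_of_le hT]
    refine setIntegral_congr_fun measurableSet_Ioc fun t ht => ?_
    rw [integral_const_mul, integral_exp_neg_mul_Ioi_zero ht.1, Real.sinc_of_ne_zero ht.1.ne',
      div_eq_mul_inv]
  rw [h1, h]
  refine setIntegral_congr_fun measurableSet_Ioi fun s _ => ?_
  rw [← intervalIntegral.integral_of_le hT, integral_sin_mul_exp_neg]

/-- The Dirichlet integral with a quantitative remainder. -/
lemma abs_integral_sinc_sub_le {T : ℝ} (hT : 0 < T) :
    |(∫ t in (0 : ℝ)..T, Real.sinc t) - Real.pi / 2| ≤ 2 / T := by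
  have hbound : ∀ s ∈ Set.Ioi (0 : ℝ),
      ‖Real.exp (-(s * T)) * (Real.cos T + s * Real.sin T) / (1 + s ^ 2)‖ ≤
        2 * Real.exp (-(s * T)) := by
    intro s hs
    have hs : 0 < s := hs
    rw [norm_div, norm_mul, Real.norm_eq_abs, Real.norm_eq_abs, Real.norm_eq_abs, Real.abs_exp,
      abs_of_pos (by positivity : 0 < 1 + s ^ 2), div_le_iff₀ (by positivity)]
    have h1 : |Real.cos T + s * Real.sin T| ≤ 2 * (1 + s ^ 2) := by
      calc |Real.cos T + s * Real.sin T| ≤ |Real.cos T| + |s * Real.sin T| := abs_add_le _ _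
        _ ≤ 1 + s * 1 := by
          rw [abs_mul, abs_of_pos hs]
          gcongr
          · exact Real.abs_cos_le_one _
          · exact Real.abs_sin_le_one _
        _ ≤ 2 * (1 + s ^ 2) := by nlinarith [sq_nonneg (s - 1)]
    calc _ ≤ Real.exp (-(s * T)) * (2 * (1 + s ^ 2)) := by gcongr
      _ = _ := by ring
  have hint := (integrableOn_exp_neg_mul_Ioi hT).const_mul 2
  have hint2 : IntegrableOn (fun s : ℝ =>
      Real.exp (-(s * T)) * (Real.cos T + s * Real.sin T) / (1 + s ^ 2)) (Set.Ioi 0) := by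
    refine Integrable.mono' hint ?_ ((ae_restrict_iff' measurableSet_Ioi).2 (.of_forall hbound))
    refine (Continuous.div (by fun_prop) (by fun_prop) fun s => ?_).aestronglyMeasurable
    positivity
  rw [sinc_integral_eq T hT.le, integral_sub integrable_inv_one_add_sq.integrableOn hint2,
    integral_Ioi_inv_one_add_sq, Real.arctan_zero, sub_zero, sub_sub_cancel_left, abs_neg]
  calc _ ≤ ∫ s in Set.Ioi (0 : ℝ), 2 * Real.exp (-(s * T)) :=
        norm_integral_le_of_norm_le hint ((ae_restrict_iff' measurableSet_Ioi).2 (.of_forall hbound))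
    _ = 2 / T := by
        rw [integral_const_mul, integral_exp_neg_mul_Ioi_zero hT, div_eq_mul_inv]

/-! ### The three scalar functions that build the limiting kernels -/

/-- `sin(πr)/(πr)`. -/
noncomputable def sineFun (r : ℝ) : ℝ := Real.sinc (Real.pi * r)

/-- The primitive of the sine kernel, with its limit at `±∞` subtracted. -/
noncomputable def sineTail (r : ℝ) : ℝ := (∫ t in (0 : ℝ)..r, sineFun t) - 1 / 2 * Real.sign r

lemma continuous_sineFun : Continuous sineFun :=
  Real.continuous_sinc.comp (by fun_prop)

lemma sineFun_neg (r : ℝ) : sineFun (-r) = sineFun r := by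
  simp [sineFun, Real.sinc_neg]

lemma abs_sineFun_le_one (r : ℝ) : |sineFun r| ≤ 1 := Real.abs_sinc_le_one _

lemma pi_mul_mul_sineFun (r : ℝ) : Real.pi * r * sineFun r = Real.sin (Real.pi * r) := by
  rcases eq_or_ne r 0 with rfl | hr
  · simp
  · rw [sineFun, Real.sinc_of_ne_zero (by simp [hr, Real.pi_ne_zero])]
    field_simp [Real.pi_ne_zero]

lemma abs_mul_sineFun_le_one (r : ℝ) : |r * sineFun r| ≤ 1 := by
  have h := congrArg abs (pi_mul_mul_sineFun r)
  rw [mul_assoc, abs_mul, abs_of_pos Real.pi_pos] at h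
  have h1 := Real.abs_sin_le_one (Real.pi * r)
  have h2 := Real.pi_gt_three
  have h3 := abs_nonneg (r * sineFun r)
  nlinarith

lemma hasDerivAt_sineFun {r : ℝ} (hr : r ≠ 0) :
    HasDerivAt sineFun ((Real.cos (Real.pi * r) - sineFun r) / r) r := by
  have hπ := Real.pi_ne_zero
  have h1 : HasDerivAt (fun r : ℝ => Real.pi * r) Real.pi r := by
    simpa using (hasDerivAt_id r).const_mul Real.pi
  have h2 := h1.sin.div h1 (mul_ne_zero hπ hr)
  have h3 : HasDerivAt sineFun _ r := h2.congr_of_eventuallyEq (by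
    filter_upwards [isOpen_ne.mem_nhds hr] with x hx
    simp [sineFun, Real.sinc_of_ne_zero (mul_ne_zero hπ hx)])
  refine h3.congr_deriv ?_
  rw [← pi_mul_mul_sineFun]
  field_simp

lemma deriv_sineFun_zero : deriv sineFun 0 = 0 := by
  have h := deriv_comp_neg sineFun 0
  simp only [sineFun_neg, neg_zero] at h
  have : (fun x => sineFun x) = sineFun := rfl
  rw [this] at h
  linarith

/-- By the mean value theorem for sin, sinc x = cos c for some c between 0 and x. This makes the
quotient formula for the derivative of `sineFun` bounded near 0. -/
lemma abs_cos_sub_sinc_le (x : ℝ) : |Real.cos x - Real.sinc x| ≤ |x| := by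
  wlog hx : 0 < x generalizing x
  · rcases eq_or_lt_of_le (not_lt.1 hx) with h | h
    · simp [h]
    · simpa [Real.sinc_neg] using this (-x) (by linarith)
  obtain ⟨c, hc, h⟩ := exists_deriv_eq_slope Real.sin hx Real.continuous_sin.continuousOn
    Real.differentiable_sin.differentiableOn
  rw [Real.sinc_of_ne_zero hx.ne']
  simp only [Real.deriv_sin, Real.sin_zero, sub_zero] at h
  rw [← h, abs_of_pos hx]
  have h1 := Real.abs_cos_sub_cos_le x c
  refine h1.trans ?_
  rw [abs_of_pos (by linarith [hc.2])]
  linarith [hc.1]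

lemma abs_deriv_sineFun_le (r : ℝ) : |deriv sineFun r| ≤ 4 := by
  rcases eq_or_ne r 0 with rfl | hr
  · simp [deriv_sineFun_zero]
  · rw [(hasDerivAt_sineFun hr).deriv, abs_div, div_le_iff₀ (abs_pos.2 hr)]
    refine (abs_cos_sub_sinc_le (Real.pi * r)).trans ?_
    rw [abs_mul, abs_of_pos Real.pi_pos]
    have := Real.pi_le_four
    gcongr

lemma abs_mul_deriv_sineFun_le (r : ℝ) : |r * deriv sineFun r| ≤ 2 := by
  rcases eq_or_ne r 0 with rfl | hr
  · simp
  · rw [(hasDerivAt_sineFun hr).deriv, mul_div_cancel₀ _ hr]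
    have h1 := Real.abs_cos_le_one (Real.pi * r)
    have h2 := abs_sineFun_le_one r
    exact (abs_sub _ _).trans (by linarith)

lemma intervalIntegrable_deriv_sineFun (p q : ℝ) :
    IntervalIntegrable (deriv sineFun) volume p q := by
  refine (intervalIntegrable_const (c := (4 : ℝ))).mono_fun
    (measurable_deriv _).aestronglyMeasurable (.of_forall fun r => ?_)
  simpa using abs_deriv_sineFun_le r

lemma abs_integral_deriv_sineFun_le (p q : ℝ) : |∫ r in p..q, deriv sineFun r| ≤ 2 := by
  rw [integral_eq_of_hasDerivAt_off_countable sineFun (deriv sineFun) (Set.countable_singleton 0)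
    continuous_sineFun.continuousOn (fun x hx => ?_) (intervalIntegrable_deriv_sineFun p q)]
  · have h1 := abs_sineFun_le_one p
    have h2 := abs_sineFun_le_one q
    exact (abs_sub _ _).trans (by linarith)
  · exact (hasDerivAt_sineFun (by simpa using hx.2)).differentiableAt.hasDerivAt

lemma integral_sineFun_eq (r : ℝ) :
    ∫ t in (0 : ℝ)..r, sineFun t = Real.pi⁻¹ * ∫ t in (0 : ℝ)..(Real.pi * r), Real.sinc t := by
  unfold sineFun
  rw [intervalIntegral.integral_comp_mul_left Real.sinc Real.pi_ne_zero]
  simp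

lemma integral_sineFun_neg (r : ℝ) :
    ∫ t in (0 : ℝ)..(-r), sineFun t = -∫ t in (0 : ℝ)..r, sineFun t := by
  have h := intervalIntegral.integral_comp_neg sineFun (a := 0) (b := r)
  simp only [sineFun_neg, neg_zero] at h
  rw [h, intervalIntegral.integral_symm]

lemma sineTail_neg (r : ℝ) : sineTail (-r) = -sineTail r := by
  unfold sineTail
  rw [integral_sineFun_neg, Real.sign_neg]
  ring

/-- For r > 0 the tail is 1/π times the error of the Dirichlet integral at T = πr, hence at most
2/(π² r). -/
lemma abs_mul_sineTail_le_one (r : ℝ) : |r * sineTail r| ≤ 1 := by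
  wlog hr : 0 < r generalizing r
  · rcases eq_or_lt_of_le (not_lt.1 hr) with h | h
    · simp [h]
    · simpa [sineTail_neg] using this (-r) (by linarith)
  have hπ := Real.pi_pos
  have h := abs_integral_sinc_sub_le (mul_pos hπ hr)
  have he : r * sineTail r =
      r * Real.pi⁻¹ * ((∫ t in (0 : ℝ)..(Real.pi * r), Real.sinc t) - Real.pi / 2) := by
    rw [sineTail, integral_sineFun_eq, Real.sign_of_pos hr]
    field_simp
  rw [he, abs_mul, abs_of_pos (by positivity)]
  calc _ ≤ r * Real.pi⁻¹ * (2 / (Real.pi * r)) := by gcongr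
    _ = 2 / Real.pi ^ 2 := by field_simp
    _ ≤ 1 := by
      rw [div_le_one (by positivity)]
      nlinarith [Real.pi_gt_three]

lemma abs_sign_le_one (r : ℝ) : |Real.sign r| ≤ 1 := by
  rcases Real.sign_apply_eq r with h | h | h <;> simp [h]

lemma abs_sineTail_le (r : ℝ) : |sineTail r| ≤ 2 := by
  rcases le_total 1 |r| with h | h
  · have h1 := abs_mul_sineTail_le_one r
    rw [abs_mul] at h1
    nlinarith [abs_nonneg (sineTail r)]
  · have h1 : |∫ t in (0 : ℝ)..r, sineFun t| ≤ 1 := by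
      have := intervalIntegral.norm_integral_le_of_norm_le_const (a := 0) (b := r) (C := 1)
        (f := sineFun) fun x _ => abs_sineFun_le_one x
      simp only [Real.norm_eq_abs, sub_zero, one_mul] at this
      linarith
    have h2 := abs_sign_le_one r
    calc |sineTail r| ≤ _ + |1 / 2 * Real.sign r| := abs_sub _ _
      _ ≤ 1 + 1 / 2 * 1 := by
        rw [abs_mul, abs_of_pos (by norm_num : (0 : ℝ) < 1 / 2)]
        gcongr
      _ ≤ 2 := by norm_num

lemma hasDerivAt_integral_sineFun (r : ℝ) :
    HasDerivAt (fun r => ∫ t in (0 : ℝ)..r, sineFun t) (sineFun r) r :=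
  intervalIntegral.integral_hasDerivAt_right (continuous_sineFun.intervalIntegrable _ _)
    (continuous_sineFun.stronglyMeasurableAtFilter _ _) continuous_sineFun.continuousAt

lemma continuous_integral_sineFun : Continuous fun r => ∫ t in (0 : ℝ)..r, sineFun t :=
  continuous_iff_continuousAt.2 fun r => (hasDerivAt_integral_sineFun r).continuousAt

lemma measurable_realSign : Measurable Real.sign := by
  unfold Real.sign
  exact Measurable.ite measurableSet_Iio measurable_const
    (Measurable.ite measurableSet_Ioi measurable_const measurable_const)

lemma measurable_sineTail : Measurable sineTail :=
  continuous_integral_sineFun.measurable.sub (measurable_realSign.const_mul _)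

lemma abs_integral_sineFun_zero_le (p : ℝ) : |∫ r in (0 : ℝ)..p, sineFun r| ≤ 3 := by
  have h : ∫ r in (0 : ℝ)..p, sineFun r = sineTail p + 1 / 2 * Real.sign p := by
    simp [sineTail]
  have h1 := abs_sineTail_le p
  have h2 := abs_sign_le_one p
  rw [h]
  refine (abs_add_le _ _).trans ?_
  rw [abs_mul, abs_of_pos (by norm_num : (0 : ℝ) < 1 / 2)]
  linarith

lemma abs_integral_sineFun_le (p q : ℝ) : |∫ r in p..q, sineFun r| ≤ 6 := by
  rw [← intervalIntegral.integral_interval_sub_left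
    (continuous_sineFun.intervalIntegrable 0 q) (continuous_sineFun.intervalIntegrable 0 p)]
  refine (abs_sub _ _).trans ?_
  linarith [abs_integral_sineFun_zero_le p, abs_integral_sineFun_zero_le q]

lemma intervalIntegrable_sineTail (p q : ℝ) : IntervalIntegrable sineTail volume p q := by
  refine (intervalIntegrable_const (c := (2 : ℝ))).mono_fun
    measurable_sineTail.aestronglyMeasurable (.of_forall fun r => ?_)
  simpa using abs_sineTail_le r

lemma mul_sineTail_eq (r : ℝ) :
    r * sineTail r = r * (∫ t in (0 : ℝ)..r, sineFun t) - 1 / 2 * |r| := by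
  have : r * Real.sign r = |r| := by
    rcases lt_trichotomy r 0 with h | h | h
    · simp [Real.sign_of_neg h, abs_of_neg h]
    · simp [h]
    · simp [Real.sign_of_pos h, abs_of_pos h]
  rw [sineTail, ← this]; ring

lemma hasDerivAt_sineTail {r : ℝ} (hr : r ≠ 0) : HasDerivAt sineTail (sineFun r) r := by
  have h : HasDerivAt (fun r => 1 / 2 * Real.sign r) 0 r := by
    rcases lt_or_gt_of_ne hr with h | h
    · refine (hasDerivAt_const r (-1 / 2 : ℝ)).congr_of_eventuallyEq ?_
      filter_upwards [isOpen_Iio.mem_nhds h] with x hx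
      rw [Real.sign_of_neg hx]; norm_num
    · refine (hasDerivAt_const r (1 / 2 : ℝ)).congr_of_eventuallyEq ?_
      filter_upwards [isOpen_Ioi.mem_nhds h] with x hx
      rw [Real.sign_of_pos hx]; norm_num
  have h' := (hasDerivAt_integral_sineFun r).sub h
  rw [sub_zero] at h'
  exact h'

/-- Integration by parts gives the primitive F(r) = r · `sineTail` r + cos(πr)/π², since r ·
`sineFun` r = sin(πr)/π. It is bounded by the 1/r decay, and continuous at 0 because the jump of the
sign is multiplied by r. -/
lemma abs_integral_sineTail_le (p q : ℝ) : |∫ r in p..q, sineTail r| ≤ 4 := by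
  have hπ := Real.pi_pos
  let F : ℝ → ℝ := fun r => r * sineTail r + Real.cos (Real.pi * r) / Real.pi ^ 2
  have hF : ∀ r, |F r| ≤ 2 := fun r => by
    have h1 := abs_mul_sineTail_le_one r
    have h2 : |Real.cos (Real.pi * r) / Real.pi ^ 2| ≤ 1 := by
      rw [abs_div, abs_of_pos (by positivity : 0 < Real.pi ^ 2), div_le_one (by positivity)]
      nlinarith [Real.pi_gt_three, Real.abs_cos_le_one (Real.pi * r)]
    exact (abs_add_le _ _).trans (by linarith)
  have hc : Continuous F := by
    have : F = fun r => (r * (∫ t in (0 : ℝ)..r, sineFun t) - 1 / 2 * |r|) +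
        Real.cos (Real.pi * r) / Real.pi ^ 2 := by
      funext r; simp only [F, mul_sineTail_eq]
    rw [this]
    have := continuous_integral_sineFun
    fun_prop
  have hd : ∀ r : ℝ, r ≠ 0 → HasDerivAt F (sineTail r) r := fun r hr => by
    have h1 : HasDerivAt (fun r : ℝ => Real.pi * r) Real.pi r := by
      simpa using (hasDerivAt_id r).const_mul Real.pi
    refine (((hasDerivAt_id r).mul (hasDerivAt_sineTail hr)).add
      (h1.cos.div_const (Real.pi ^ 2))).congr_deriv ?_
    rw [← pi_mul_mul_sineFun]
    simp only [id]
    field_simp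
    ring
  rw [integral_eq_of_hasDerivAt_off_countable F sineTail (Set.countable_singleton 0)
    hc.continuousOn (fun x hx => hd x (by simpa using hx.2)) (intervalIntegrable_sineTail p q)]
  exact (abs_sub _ _).trans (by linarith [hF p, hF q])

/-! ### Oscillating functions. -/

/-- A bounded function that decays like `1/|r|` and has a bounded primitive. -/
structure IsOscillating (C : ℝ) (f : ℝ → ℝ) : Prop where
  measurable : Measurable f
  bound : ∀ r, |f r| ≤ C
  decay : ∀ r, |r * f r| ≤ C
  integral_bound : ∀ p q, |∫ r in p..q, f r| ≤ C

lemma isOscillating_sineFun : IsOscillating 6 sineFun where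
  measurable := continuous_sineFun.measurable
  bound r := (abs_sineFun_le_one r).trans (by norm_num)
  decay r := (abs_mul_sineFun_le_one r).trans (by norm_num)
  integral_bound := abs_integral_sineFun_le

lemma isOscillating_deriv_sineFun : IsOscillating 6 (deriv sineFun) where
  measurable := measurable_deriv _
  bound r := (abs_deriv_sineFun_le r).trans (by norm_num)
  decay r := (abs_mul_deriv_sineFun_le r).trans (by norm_num)
  integral_bound p q := (abs_integral_deriv_sineFun_le p q).trans (by norm_num)

lemma isOscillating_sineTail : IsOscillating 6 sineTail where
  measurable := measurable_sineTail
  bound r := (abs_sineTail_le r).trans (by norm_num)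
  decay r := (abs_mul_sineTail_le_one r).trans (by norm_num)
  integral_bound p q := (abs_integral_sineTail_le p q).trans (by norm_num)

lemma IsOscillating.mono {C C' : ℝ} {f : ℝ → ℝ} (h : IsOscillating C f) (hC : C ≤ C') :
    IsOscillating C' f where
  measurable := h.measurable
  bound r := (h.bound r).trans hC
  decay r := (h.decay r).trans hC
  integral_bound p q := (h.integral_bound p q).trans hC

lemma IsOscillating.nonneg {C : ℝ} {f : ℝ → ℝ} (h : IsOscillating C f) : 0 ≤ C :=
  (abs_nonneg _).trans (h.bound 0)

lemma IsOscillating.const_mul {C : ℝ} {f : ℝ → ℝ} (h : IsOscillating C f) (c : ℝ) :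
    IsOscillating (|c| * C) (fun r => c * f r) where
  measurable := h.measurable.const_mul c
  bound r := by rw [abs_mul]; gcongr; exact h.bound r
  decay r := by rw [mul_left_comm, abs_mul]; gcongr; exact h.decay r
  integral_bound p q := by
    rw [intervalIntegral.integral_const_mul, abs_mul]; gcongr; exact h.integral_bound p q

lemma IsOscillating.comp_two_mul {C : ℝ} {f : ℝ → ℝ} (h : IsOscillating C f) :
    IsOscillating C (fun r => f (2 * r)) where
  measurable := h.measurable.comp (measurable_const_mul 2)
  bound r := h.bound _
  decay r := by
    have := h.decay (2 * r)
    rw [mul_assoc, abs_mul, abs_two] at this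
    linarith [abs_nonneg (r * f (2 * r))]
  integral_bound p q := by
    rw [intervalIntegral.integral_comp_mul_left f two_ne_zero, smul_eq_mul, abs_mul]
    have := h.integral_bound (2 * p) (2 * q)
    have h2 : |(2 : ℝ)⁻¹| ≤ 1 := by rw [abs_of_pos] <;> norm_num
    exact (mul_le_mul h2 this (abs_nonneg _) zero_le_one).trans (by rw [one_mul])

/-! ### Polarised Pfaffians -/

section Pfaffian

variable {ι κ₁ κ₂ : Type*} [Fintype ι] [DecidableEq ι] [Fintype κ₁] [DecidableEq κ₁]
  [Fintype κ₂] [DecidableEq κ₂]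

/-- `∑_σ sgn(σ) ∏_i A_i(σ(i,0), σ(i,1))`. -/
noncomputable def polarPfaffian (A : ι → ι × Fin 2 → ι × Fin 2 → ℝ) : ℝ :=
  ∑ σ : Equiv.Perm (ι × Fin 2),
    ((Equiv.Perm.sign σ : ℤ) : ℝ) * ∏ i, A i (σ (i, 0)) (σ (i, 1))

/-- The contributions of σ and `σ * swap a b` have opposite signs and cancel. -/
lemma sum_sign_mul_eq_zero {α : Type*} [Fintype α] [DecidableEq α] {a b : α} (hab : a ≠ b)
    (F : Equiv.Perm α → ℝ) (hF : ∀ σ, F (σ * Equiv.swap a b) = F σ) :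
    ∑ σ : Equiv.Perm α, ((Equiv.Perm.sign σ : ℤ) : ℝ) * F σ = 0 := by
  have h := Equiv.sum_comp (Equiv.mulRight (Equiv.swap a b))
    (fun σ => ((Equiv.Perm.sign σ : ℤ) : ℝ) * F σ)
  simp only [Equiv.coe_mulRight, hF, Equiv.Perm.sign_mul, Equiv.Perm.sign_swap hab] at h
  simp only [mul_neg, mul_one, Units.val_neg, Int.cast_neg, neg_mul, Finset.sum_neg_distrib] at h
  linarith

lemma sum_sign_mul_pair_eq_zero {α : Type*} [Fintype α] [DecidableEq α] {a b : α} (hab : a ≠ b)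
    (f : α → ℝ) (G : Equiv.Perm α → ℝ) (hG : ∀ σ, G (σ * Equiv.swap a b) = G σ) :
    ∑ σ : Equiv.Perm α, ((Equiv.Perm.sign σ : ℤ) : ℝ) * (f (σ a) * f (σ b) * G σ) = 0 := by
  refine sum_sign_mul_eq_zero hab _ fun σ => ?_
  simp only [hG, Equiv.Perm.mul_apply, Equiv.swap_apply_left, Equiv.swap_apply_right]
  ring

/-- Permuting whole pairs applies π to both copies of ι, so the induced permutation has sign (sgn
π)² = 1. -/
lemma polarPfaffian_comp_perm (A : ι → ι × Fin 2 → ι × Fin 2 → ℝ) (π : Equiv.Perm ι) :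
    polarPfaffian (fun i => A (π i)) = polarPfaffian A := by
  unfold polarPfaffian
  let ρ : Equiv.Perm (ι × Fin 2) := Equiv.prodCongrLeft fun _ => π
  have hρ : Equiv.Perm.sign ρ = 1 := by
    rw [Equiv.Perm.sign_prodCongrLeft]
    simp
  rw [← Equiv.sum_comp (Equiv.mulRight ρ)]
  refine Finset.sum_congr rfl fun σ _ => ?_
  simp only [Equiv.coe_mulRight, Equiv.Perm.sign_mul, hρ, mul_one, Equiv.Perm.mul_apply]
  congr 1
  exact Equiv.prod_comp π fun i => A i (σ (i, 0)) (σ (i, 1))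

lemma polarPfaffian_reindex {κ : Type*} [Fintype κ] [DecidableEq κ] (e : ι ≃ κ)
    (A : κ → κ × Fin 2 → κ × Fin 2 → ℝ) :
    polarPfaffian A =
      polarPfaffian fun i (p q : ι × Fin 2) => A (e i) (e p.1, p.2) (e q.1, q.2) := by
  unfold polarPfaffian
  let E : ι × Fin 2 ≃ κ × Fin 2 := e.prodCongr (Equiv.refl _)
  rw [← Equiv.sum_comp E.permCongr]
  refine Finset.sum_congr rfl fun σ _ => ?_
  rw [Equiv.Perm.sign_permCongr, ← Equiv.prod_comp e]
  simp only [E, Equiv.permCongr_apply, Equiv.prodCongr_symm, Equiv.refl_symm, Equiv.prodCongr_apply, Equiv.coe_refl, Prod.map_apply, Equiv.symm_apply_apply, id_eq]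
  rfl

/-- The sum over all permutations with the factors in `S` taken from `E`, the others from `N`. -/
noncomputable def mixedPfaffian (E N : ι × Fin 2 → ι × Fin 2 → ℝ) (S : Finset ι) : ℝ :=
  ∑ σ : Equiv.Perm (ι × Fin 2), ((Equiv.Perm.sign σ : ℤ) : ℝ) *
    ((∏ i ∈ S, E (σ (i, 0)) (σ (i, 1))) * ∏ i ∈ Finset.univ \ S, N (σ (i, 0)) (σ (i, 1)))

lemma polarPfaffian_add (E N : ι × Fin 2 → ι × Fin 2 → ℝ) :
    polarPfaffian (fun _ : ι => E + N) =
      ∑ S ∈ (Finset.univ : Finset ι).powerset, mixedPfaffian E N S := by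
  unfold polarPfaffian mixedPfaffian
  rw [Finset.sum_comm]
  refine Finset.sum_congr rfl fun σ _ => ?_
  simp only [Pi.add_apply]
  rw [Finset.prod_add, Finset.mul_sum]

lemma mixedPfaffian_eq_polar (E N : ι × Fin 2 → ι × Fin 2 → ℝ) (S : Finset ι) :
    mixedPfaffian E N S = polarPfaffian (fun i => if i ∈ S then E else N) := by
  unfold polarPfaffian mixedPfaffian
  refine Finset.sum_congr rfl fun σ _ => ?_
  congr 1
  rw [← Finset.prod_sdiff (Finset.subset_univ S), mul_comm]
  congr 1
  · exact Finset.prod_congr rfl fun i hi => by simp [(Finset.mem_sdiff.1 hi).2]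
  · exact Finset.prod_congr rfl fun i hi => by simp [hi]

/-- Two factors of a decomposable alternating matrix `c (u ∧ v)` cancel. -/
lemma mixedPfaffian_wedge_eq_zero (u v : ι × Fin 2 → ℝ) (c : ℝ)
    (N : ι × Fin 2 → ι × Fin 2 → ℝ) (S : Finset ι) {i j : ι} (hi : i ∈ S) (hj : j ∈ S)
    (hij : i ≠ j) :
    mixedPfaffian (fun p q => c * (u p * v q - v p * u q)) N S = 0 := by
  unfold mixedPfaffian
  set E : ι × Fin 2 → ι × Fin 2 → ℝ := fun p q => c * (u p * v q - v p * u q) with hE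
  let G : Equiv.Perm (ι × Fin 2) → ℝ := fun σ =>
    (∏ l ∈ (S.erase i).erase j, E (σ (l, 0)) (σ (l, 1))) *
      ∏ l ∈ Finset.univ \ S, N (σ (l, 0)) (σ (l, 1))
  have hG : ∀ (x y : Fin 2) (σ : Equiv.Perm (ι × Fin 2)),
      G (σ * Equiv.swap (i, x) (j, y)) = G σ := by
    intro x y σ
    have hs : ∀ l, l ≠ i → l ≠ j → ∀ z : Fin 2,
        (σ * Equiv.swap (i, x) (j, y)) (l, z) = σ (l, z) := by
      intro l h1 h2 z
      rw [Equiv.Perm.mul_apply, Equiv.swap_apply_of_ne_of_ne (by simp [h1]) (by simp [h2])]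
    simp only [G]
    congr 1
    · refine Finset.prod_congr rfl fun l hl => ?_
      simp only [Finset.mem_erase] at hl
      rw [hs l hl.2.1 hl.1, hs l hl.2.1 hl.1]
    · refine Finset.prod_congr rfl fun l hl => ?_
      have h1 : l ≠ i := by rintro rfl; exact (Finset.mem_sdiff.1 hl).2 hi
      have h2 : l ≠ j := by rintro rfl; exact (Finset.mem_sdiff.1 hl).2 hj
      rw [hs l h1 h2, hs l h1 h2]
  have hji : j ∈ S.erase i := Finset.mem_erase.2 ⟨hij.symm, hj⟩
  -- In each of the four terms u sits at one element of pair i and one of pair j. Exchanging these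
  -- two elements leaves the term unchanged, as `G` does not involve i and j, but reverses the sign
  -- of σ.
  have hsplit : ∀ σ : Equiv.Perm (ι × Fin 2),
      (∏ l ∈ S, E (σ (l, 0)) (σ (l, 1))) * ∏ l ∈ Finset.univ \ S, N (σ (l, 0)) (σ (l, 1)) =
        u (σ (i, 0)) * u (σ (j, 0)) * (c ^ 2 * v (σ (i, 1)) * v (σ (j, 1)) * G σ)
        - u (σ (i, 0)) * u (σ (j, 1)) * (c ^ 2 * v (σ (i, 1)) * v (σ (j, 0)) * G σ)
        - u (σ (i, 1)) * u (σ (j, 0)) * (c ^ 2 * v (σ (i, 0)) * v (σ (j, 1)) * G σ)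
        + u (σ (i, 1)) * u (σ (j, 1)) * (c ^ 2 * v (σ (i, 0)) * v (σ (j, 0)) * G σ) := by
    intro σ
    rw [← Finset.mul_prod_erase S _ hi, ← Finset.mul_prod_erase (S.erase i) _ hji]
    simp only [G, hE]
    ring
  have hz : ∀ x y x' y' : Fin 2, x ≠ x' → y ≠ y' →
      ∑ σ : Equiv.Perm (ι × Fin 2), ((Equiv.Perm.sign σ : ℤ) : ℝ) *
        (u (σ (i, x)) * u (σ (j, y)) * (c ^ 2 * v (σ (i, x')) * v (σ (j, y')) * G σ)) = 0 := by
    intro x y x' y' hx hy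
    refine sum_sign_mul_pair_eq_zero (a := (i, x)) (b := (j, y)) (by simp [hij]) u _ fun σ => ?_
    rw [hG, Equiv.Perm.mul_apply, Equiv.Perm.mul_apply,
      Equiv.swap_apply_of_ne_of_ne (by simp [hx.symm]) (by simp [hij]),
      Equiv.swap_apply_of_ne_of_ne (by simp [hij.symm]) (by simp [hy.symm])]
  simp only [hsplit, mul_add, mul_sub, Finset.sum_add_distrib, Finset.sum_sub_distrib]
  rw [hz 0 0 1 1 (by decide) (by decide), hz 0 1 1 0 (by decide) (by decide),
    hz 1 0 0 1 (by decide) (by decide), hz 1 1 0 0 (by decide) (by decide)]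
  ring

/-- A perfect matching cannot have exactly one edge between two blocks of even size. -/
lemma mixedPfaffian_singleton_eq_zero
    (E N : (κ₁ ⊕ κ₂) × Fin 2 → (κ₁ ⊕ κ₂) × Fin 2 → ℝ)
    (hE : ∀ p q, p.1.isLeft = q.1.isLeft → E p q = 0)
    (hN : ∀ p q, p.1.isLeft ≠ q.1.isLeft → N p q = 0) (i₀ : κ₁ ⊕ κ₂) :
    mixedPfaffian E N {i₀} = 0 := by
  unfold mixedPfaffian
  refine Finset.sum_eq_zero fun σ _ => ?_
  suffices h : (∏ i ∈ {i₀}, E (σ (i, 0)) (σ (i, 1))) *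
      ∏ i ∈ Finset.univ \ {i₀}, N (σ (i, 0)) (σ (i, 1)) = 0 by rw [h, mul_zero]
  by_contra hne
  obtain ⟨h1, h2⟩ := mul_ne_zero_iff.1 hne
  rw [Finset.prod_singleton] at h1
  rw [Finset.prod_ne_zero_iff] at h2
  have h1' : (σ (i₀, 0)).1.isLeft ≠ (σ (i₀, 1)).1.isLeft := fun h => h1 (hE _ _ h)
  have h2' : ∀ i, i ≠ i₀ → (σ (i, 0)).1.isLeft = (σ (i, 1)).1.isLeft := fun i hi => by
    by_contra h
    exact h2 i (by simp [hi]) (hN _ _ h)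
  -- Count the points of the left block modulo 2. The total is even, edges inside a block contribute
  -- an even number, but the single crossing edge contributes 1.
  let χ : (κ₁ ⊕ κ₂) × Fin 2 → ZMod 2 := fun p => if p.1.isLeft then 1 else 0
  have e1 : ∑ p, χ (σ p) = ∑ p, χ p := Equiv.sum_comp σ χ
  have two : (1 : ZMod 2) + 1 = 0 := by decide
  have e2 : ∑ p, χ p = 0 := by
    rw [Fintype.sum_prod_type]
    refine Finset.sum_eq_zero fun i _ => ?_
    rw [Fin.sum_univ_two]
    simp only [χ]
    split_ifs <;> simp [two]
  rw [e2, Fintype.sum_prod_type, Finset.sum_eq_single i₀] at e1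
  · rw [Fin.sum_univ_two] at e1
    simp only [χ] at e1
    revert e1 h1'
    cases (σ (i₀, 0)).1.isLeft <;> cases (σ (i₀, 1)).1.isLeft <;> simp
  · intro i _ hi
    rw [Fin.sum_univ_two]
    simp only [χ, h2' i hi]
    split_ifs <;> simp [two]
  · simp

end Pfaffian

/-! ### Factorisation of the Pfaffian of a block matrix. -/

lemma card_le_of_prod_ne_zero {ι : Type*} [Fintype ι] (Q : ι × Fin 2 → Prop) [DecidablePred Q]
    (X : ι × Fin 2 → ι × Fin 2 → ℝ) (hX : ∀ p q, ¬ (Q p ∧ Q q) → X p q = 0)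
    (σ : Equiv.Perm (ι × Fin 2)) (S : Finset ι)
    (h : ∏ i ∈ S, X (σ (i, 0)) (σ (i, 1)) ≠ 0) :
    S.card * 2 ≤ (Finset.univ.filter Q).card := by
  rw [Finset.prod_ne_zero_iff] at h
  have h' : ∀ i ∈ S, Q (σ (i, 0)) ∧ Q (σ (i, 1)) := fun i hi => by
    by_contra hc
    exact h i hi (hX _ _ hc)
  have := Finset.card_le_card_of_injOn (s := S ×ˢ (Finset.univ : Finset (Fin 2)))
    (t := Finset.univ.filter Q) σ (fun p hp => ?_) σ.injective.injOn
  · simpa [Finset.card_product] using this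
  · obtain ⟨i, x⟩ := p
    have hi : i ∈ S := by simpa using hp
    simp only [Finset.coe_filter, Finset.mem_univ, true_and, Set.mem_ofPred_eq]
    fin_cases x
    · exact (h' i hi).1
    · exact (h' i hi).2

lemma card_filter_isLeft {κ₁ κ₂ : Type*} [Fintype κ₁] [Fintype κ₂] :
    (Finset.univ.filter fun p : (κ₁ ⊕ κ₂) × Fin 2 => p.1.isLeft = true).card =
      Fintype.card κ₁ * 2 := by
  rw [Finset.card_filter, Fintype.sum_prod_type, Fintype.sum_sum_type]
  simp

lemma card_filter_not_isLeft {κ₁ κ₂ : Type*} [Fintype κ₁] [Fintype κ₂] :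
    (Finset.univ.filter fun p : (κ₁ ⊕ κ₂) × Fin 2 => ¬ p.1.isLeft = true).card =
      Fintype.card κ₂ * 2 := by
  rw [Finset.card_filter, Fintype.sum_prod_type, Fintype.sum_sum_type]
  simp

section Pfaffian

variable {ι κ₁ κ₂ : Type*} [Fintype ι] [DecidableEq ι] [Fintype κ₁] [DecidableEq κ₁]
  [Fintype κ₂] [DecidableEq κ₂]

/-- By finiteness, a permutation that maps the left block into itself also preserves the right
block, hence is a pair of permutations. -/
lemma sum_perm_sum_type (F : Equiv.Perm (κ₁ ⊕ κ₂) → ℝ)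
    (h : ∀ σ a b, σ (Sum.inl a) = Sum.inr b → F σ = 0) :
    ∑ σ, F σ = ∑ σ₁ : Equiv.Perm κ₁, ∑ σ₂ : Equiv.Perm κ₂, F (Equiv.Perm.sumCongr σ₁ σ₂) := by
  rw [← Fintype.sum_prod_type' (f := fun σ₁ σ₂ => F (Equiv.Perm.sumCongr σ₁ σ₂))]
  symm
  refine Finset.sum_of_injOn (fun σ : Equiv.Perm κ₁ × Equiv.Perm κ₂ =>
    Equiv.Perm.sumCongr σ.1 σ.2) ?_ (by simp) ?_ fun _ _ => rfl
  · exact (Equiv.Perm.sumCongrHom_injective (α := κ₁) (β := κ₂)).injOn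
  · intro σ _ hσ
    by_contra hne
    have hm : σ ∈ (Equiv.Perm.sumCongrHom κ₁ κ₂).range := by
      refine Equiv.Perm.mem_sumCongrHom_range_of_perm_mapsTo_inl ?_
      rintro _ ⟨a, rfl⟩
      rcases hx : σ (Sum.inl a) with a' | b
      · exact ⟨a', rfl⟩
      · exact absurd (h σ a b hx) hne
    obtain ⟨τ, rfl⟩ := hm
    exact hσ ⟨τ, by simp, rfl⟩

/-- A left index i carries the factor X, which forces both σ(i,0) and σ(i,1) into the left block.
Only block-preserving σ contribute, and for these sign and product factorise. -/
lemma polarPfaffian_blocks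
    (X Y : (κ₁ ⊕ κ₂) × Fin 2 → (κ₁ ⊕ κ₂) × Fin 2 → ℝ)
    (hX : ∀ p q, ¬ (p.1.isLeft ∧ q.1.isLeft) → X p q = 0) :
    polarPfaffian (fun i : κ₁ ⊕ κ₂ => if i.isLeft then X else Y) =
      polarPfaffian (fun _ (p q : κ₁ × Fin 2) => X (Sum.inl p.1, p.2) (Sum.inl q.1, q.2)) *
        polarPfaffian (fun _ (p q : κ₂ × Fin 2) => Y (Sum.inr p.1, p.2) (Sum.inr q.1, q.2)) := by
  let e := Equiv.sumProdDistrib κ₁ κ₂ (Fin 2)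
  conv_lhs => unfold polarPfaffian
  rw [← Equiv.sum_comp e.symm.permCongr, sum_perm_sum_type]
  · unfold polarPfaffian
    rw [Finset.sum_mul_sum]
    refine Finset.sum_congr rfl fun σ₁ _ => Finset.sum_congr rfl fun σ₂ _ => ?_
    rw [Equiv.Perm.sign_permCongr, Equiv.Perm.sign_sumCongr, Fintype.prod_sum_type]
    simp only [Equiv.permCongr_apply, Equiv.symm_symm, Equiv.sumProdDistrib_apply_left, e,
      Equiv.sumProdDistrib_apply_right, Equiv.Perm.sumCongr_apply, Sum.map_inl, Sum.map_inr,
      Equiv.sumProdDistrib_symm_apply_left, Equiv.sumProdDistrib_symm_apply_right,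
      Sum.isLeft_inl, Sum.isLeft_inr, ↓reduceIte, Bool.false_eq_true, Units.val_mul,
      Int.cast_mul]
    ring
  · rintro σ ⟨a, x⟩ ⟨b, y⟩ hab
    have h0 : ∀ z : Fin 2, ¬ (((e.symm.permCongr σ) (Sum.inl a, z)).1.isLeft = true) →
        ((Equiv.Perm.sign (e.symm.permCongr σ) : ℤ) : ℝ) *
        ∏ i : κ₁ ⊕ κ₂, (if i.isLeft then X else Y) ((e.symm.permCongr σ) (i, 0))
          ((e.symm.permCongr σ) (i, 1)) = 0 := by
      intro z hz
      rw [Finset.prod_eq_zero (Finset.mem_univ (Sum.inl a)), mul_zero]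
      simp only [Sum.isLeft_inl, ↓reduceIte]
      refine hX _ _ fun h => ?_
      fin_cases z
      · exact hz h.1
      · exact hz h.2
    refine h0 x ?_
    simp [e, Equiv.permCongr_apply, hab]

/-- Each X-factor uses up two left points and each Y-factor two right points, so the number of
X-factors must be the size of the left block. All sets S of that size give the same value, because
pairs may be permuted freely. -/
lemma mixedPfaffian_blocks
    (X Y : (κ₁ ⊕ κ₂) × Fin 2 → (κ₁ ⊕ κ₂) × Fin 2 → ℝ)
    (hX : ∀ p q, ¬ (p.1.isLeft ∧ q.1.isLeft) → X p q = 0)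
    (hY : ∀ p q, ¬ (¬ p.1.isLeft ∧ ¬ q.1.isLeft) → Y p q = 0) (S : Finset (κ₁ ⊕ κ₂)) :
    mixedPfaffian X Y S = if S.card = Fintype.card κ₁ then
      polarPfaffian (fun _ (p q : κ₁ × Fin 2) => X (Sum.inl p.1, p.2) (Sum.inl q.1, q.2)) *
        polarPfaffian (fun _ (p q : κ₂ × Fin 2) => Y (Sum.inr p.1, p.2) (Sum.inr q.1, q.2))
      else 0 := by
  split_ifs with hS
  · rw [← polarPfaffian_blocks X Y hX, mixedPfaffian_eq_polar]
    have hc : Fintype.card {i : κ₁ ⊕ κ₂ // i.isLeft = true} = Fintype.card {i // i ∈ S} := by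
      rw [Fintype.card_coe, hS]
      refine Fintype.card_congr (Equiv.ofBijective
        (fun i : {i : κ₁ ⊕ κ₂ // i.isLeft = true} => i.1.getLeft i.2) ⟨?_, fun i =>
          ⟨⟨Sum.inl i, rfl⟩, rfl⟩⟩)
      rintro ⟨i | i, hi⟩ ⟨j | j, hj⟩ h
      · simpa using h
      · simp at hj
      · simp at hi
      · simp at hi
    let e := Fintype.equivOfCardEq hc
    rw [← polarPfaffian_comp_perm _ e.extendSubtype]
    congr 1
    funext i
    by_cases hi : i.isLeft = true
    · rw [if_pos (e.extendSubtype_mem i hi), if_pos hi]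
    · rw [if_neg (e.extendSubtype_not_mem i hi), if_neg hi]
  · unfold mixedPfaffian
    refine Finset.sum_eq_zero fun σ _ => ?_
    suffices h : (∏ i ∈ S, X (σ (i, 0)) (σ (i, 1))) *
        ∏ i ∈ Finset.univ \ S, Y (σ (i, 0)) (σ (i, 1)) = 0 by rw [h, mul_zero]
    by_contra hne
    obtain ⟨h1, h2⟩ := mul_ne_zero_iff.1 hne
    have h1' := card_le_of_prod_ne_zero (fun p => p.1.isLeft = true) X hX σ S h1
    have h2' := card_le_of_prod_ne_zero (fun p => ¬ p.1.isLeft = true) Y hY σ _ h2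
    rw [card_filter_isLeft] at h1'
    rw [card_filter_not_isLeft, Finset.card_sdiff_of_subset (Finset.subset_univ _), Finset.card_univ,
      Fintype.card_sum] at h2'
    omega

/-- The Pfaffian of a block diagonal matrix, perturbed by an alternating matrix of rank two
between the blocks. -/
theorem polarPfaffian_block_add_wedge
    (N : (κ₁ ⊕ κ₂) × Fin 2 → (κ₁ ⊕ κ₂) × Fin 2 → ℝ)
    (hN : ∀ p q, p.1.isLeft ≠ q.1.isLeft → N p q = 0)
    (u v : (κ₁ ⊕ κ₂) × Fin 2 → ℝ) (hu : ∀ p, ¬ p.1.isLeft → u p = 0)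
    (hv : ∀ p, p.1.isLeft → v p = 0) (c : ℝ) :
    polarPfaffian (fun _ : κ₁ ⊕ κ₂ => (fun p q => c * (u p * v q - v p * u q)) + N) =
      ((Fintype.card κ₁ + Fintype.card κ₂).choose (Fintype.card κ₁) : ℝ) *
      (polarPfaffian (fun _ (p q : κ₁ × Fin 2) => N (Sum.inl p.1, p.2) (Sum.inl q.1, q.2)) *
        polarPfaffian (fun _ (p q : κ₂ × Fin 2) => N (Sum.inr p.1, p.2) (Sum.inr q.1, q.2))) := by
  set E : (κ₁ ⊕ κ₂) × Fin 2 → (κ₁ ⊕ κ₂) × Fin 2 → ℝ :=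
    fun p q => c * (u p * v q - v p * u q) with hEdef
  have hE : ∀ p q, p.1.isLeft = q.1.isLeft → E p q = 0 := by
    intro p q h
    by_cases hp : p.1.isLeft = true
    · simp [hEdef, hv p hp, hv q (h ▸ hp)]
    · simp [hEdef, hu p hp, hu q (h ▸ hp)]
  rw [polarPfaffian_add, Finset.sum_eq_single ∅]
  · have h0 : mixedPfaffian E N ∅ = polarPfaffian fun _ => N := by
      rw [mixedPfaffian_eq_polar]; simp
    rw [h0]
    -- X and Y are the two diagonal blocks of N. In the expansion of X + Y only the sets S with
    -- `card κ₁` elements survive, with equal contributions; their number is the binomial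
    -- coefficient.
    let X : (κ₁ ⊕ κ₂) × Fin 2 → (κ₁ ⊕ κ₂) × Fin 2 → ℝ :=
      fun p q => if p.1.isLeft ∧ q.1.isLeft then N p q else 0
    let Y : (κ₁ ⊕ κ₂) × Fin 2 → (κ₁ ⊕ κ₂) × Fin 2 → ℝ :=
      fun p q => if ¬ p.1.isLeft ∧ ¬ q.1.isLeft then N p q else 0
    have hXY : N = X + Y := by
      funext p q
      simp only [X, Y, Pi.add_apply]
      by_cases hp : p.1.isLeft = true <;> by_cases hq : q.1.isLeft = true <;> simp [hp, hq]
      · exact hN p q (by simp [hp, hq])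
      · exact hN p q (by simp [hp, hq])
    conv_lhs => rw [hXY]
    rw [polarPfaffian_add]
    simp only [mixedPfaffian_blocks X Y (fun p q h => if_neg h) (fun p q h => if_neg h)]
    rw [← Finset.sum_filter, Finset.sum_const, ← Finset.powersetCard_eq_filter,
      Finset.card_powersetCard, Finset.card_univ, Fintype.card_sum, nsmul_eq_mul]
    simp [X, Y]
  · intro S _ hS
    obtain ⟨i, hi⟩ := Finset.nonempty_of_ne_empty hS
    by_cases h : S = {i}
    · rw [h]
      exact mixedPfaffian_singleton_eq_zero E N hE hN i
    · obtain ⟨j, hj, hji⟩ : ∃ j ∈ S, j ≠ i := by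
        by_contra hc
        push Not at hc
        exact h (Finset.eq_singleton_iff_unique_mem.2 ⟨hi, hc⟩)
      exact mixedPfaffian_wedge_eq_zero u v c N S hi hj hji.symm
  · simp

end Pfaffian

/-! ### Products of bounded functions -/

lemma abs_prod_le_pow {ι : Type*} {s : Finset ι} {f : ι → ℝ} {C : ℝ}
    (hf : ∀ i ∈ s, |f i| ≤ C) : |∏ i ∈ s, f i| ≤ C ^ s.card := by
  rw [Finset.abs_prod]
  exact (Finset.prod_le_prod (fun i _ => abs_nonneg _) hf).trans_eq (by simp)

/-- Exchange the factors one at a time; 2^|s| generously covers the number of exchanges. -/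
lemma abs_prod_sub_prod_le {ι : Type*} {s : Finset ι} {f g : ι → ℝ} {C ε : ℝ} (hC : 1 ≤ C)
    (hf : ∀ i ∈ s, |f i| ≤ C) (hg : ∀ i ∈ s, |g i| ≤ C) (hfg : ∀ i ∈ s, |f i - g i| ≤ ε)
    (hε : 0 ≤ ε) :
    |∏ i ∈ s, f i - ∏ i ∈ s, g i| ≤ (2 * C) ^ s.card * ε := by
  classical
  induction s using Finset.induction_on with
  | empty => simpa using hε
  | insert a s ha ih =>
    rw [Finset.prod_insert ha, Finset.prod_insert ha, Finset.card_insert_of_notMem ha]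
    have h1 := ih (fun i hi => hf i (Finset.mem_insert_of_mem hi))
      (fun i hi => hg i (Finset.mem_insert_of_mem hi))
      (fun i hi => hfg i (Finset.mem_insert_of_mem hi))
    have h2 : |∏ i ∈ s, f i| ≤ C ^ s.card :=
      abs_prod_le_pow fun i hi => hf i (Finset.mem_insert_of_mem hi)
    have h3 := hg a (Finset.mem_insert_self _ _)
    have h4 := hfg a (Finset.mem_insert_self _ _)
    have h5 : (1 : ℝ) ≤ 2 ^ s.card := one_le_pow₀ (by norm_num)
    have h6 : (0 : ℝ) ≤ C ^ s.card := by positivity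
    calc |f a * ∏ i ∈ s, f i - g a * ∏ i ∈ s, g i|
        = |(f a - g a) * ∏ i ∈ s, f i + g a * (∏ i ∈ s, f i - ∏ i ∈ s, g i)| := by
          congr 1; ring
      _ ≤ |f a - g a| * |∏ i ∈ s, f i| + |g a| * |∏ i ∈ s, f i - ∏ i ∈ s, g i| := by
          rw [← abs_mul, ← abs_mul]; exact abs_add_le _ _
      _ ≤ ε * C ^ s.card + C * ((2 * C) ^ s.card * ε) := by gcongr
      _ ≤ C * ((2 * C) ^ s.card * ε) + C * ((2 * C) ^ s.card * ε) := by
          have : ε * C ^ s.card ≤ C * ((2 * C) ^ s.card * ε) := by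
            rw [mul_pow]
            calc ε * C ^ s.card = 1 * (1 * C ^ s.card * ε) := by ring
              _ ≤ C * (2 ^ s.card * C ^ s.card * ε) := by gcongr
          linarith
      _ = (2 * C) ^ (s.card + 1) * ε := by ring

/-! ### Integrals of products with decaying factors. -/

/-- A function that is bounded, square-integrably small around `b` on `[p, q]`, and has a bounded
integral there. -/
structure IsSmallOn (C b p q : ℝ) (f : ℝ → ℝ) : Prop where
  measurable : Measurable f
  bound : ∀ t, |f t| ≤ C
  decay : ∀ t ∈ Set.Icc p q, f t ^ 2 * (1 + (t - b) ^ 2) ≤ C ^ 2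
  integral_bound : |∫ t in p..q, f t| ≤ C

lemma integral_inv_one_add_sub_sq_le {p q b : ℝ} (hpq : p ≤ q) :
    ∫ t in p..q, (1 + (t - b) ^ 2)⁻¹ ≤ 4 := by
  have h := intervalIntegral.integral_comp_sub_right (fun t : ℝ => (1 + t ^ 2)⁻¹) b (a := p) (b := q)
  rw [h, intervalIntegral.integral_of_le (by linarith)]
  calc _ ≤ ∫ t : ℝ, (1 + t ^ 2)⁻¹ :=
        setIntegral_le_integral integrable_inv_one_add_sq (.of_forall fun t => by positivity)
    _ = Real.pi := integral_univ_inv_one_add_sq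
    _ ≤ 4 := Real.pi_le_four

lemma intervalIntegrable_of_bounded {f : ℝ → ℝ} {C : ℝ} (hf : Measurable f)
    (hb : ∀ t, |f t| ≤ C) (p q : ℝ) : IntervalIntegrable f volume p q :=
  (intervalIntegrable_const (c := C)).mono_fun hf.aestronglyMeasurable
    (.of_forall fun t => (hb t).trans (le_abs_self C))

/-- A lone factor r_i is handled by its bounded integral, since the g's are constants. If there are
two, their product is at most C²/(1+(t-b)²) by the inequality of arithmetic and geometric means, and
this integrates to at most 4C²; all further factors are merely bounded. No absolute integrability of
a single factor is used. -/
lemma abs_integral_mixed_prod_le {ι : Type*} [DecidableEq ι] {s S : Finset ι} {C b p q : ℝ}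
    (hC : 1 ≤ C) (hpq : p ≤ q) {g : ι → ℝ} {r : ι → ℝ → ℝ} (hg : ∀ i ∈ s, |g i| ≤ C)
    (hr : ∀ i ∈ s, IsSmallOn C b p q (r i)) (hS : S ⊆ s) (hne : S.Nonempty) :
    |∫ t in p..q, (∏ i ∈ S, r i t) * ∏ i ∈ s \ S, g i| ≤ C ^ s.card * 4 := by
  have hgb : |∏ i ∈ s \ S, g i| ≤ C ^ (s \ S).card :=
    abs_prod_le_pow fun i hi => hg i (Finset.sdiff_subset hi)
  obtain ⟨i, hi⟩ := hne
  have hcard : S.card + (s \ S).card = s.card := by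
    rw [Finset.card_sdiff_of_subset hS]
    have := Finset.card_le_card hS
    omega
  by_cases h1 : S = {i}
  · subst h1
    simp only [Finset.prod_singleton]
    rw [intervalIntegral.integral_mul_const, abs_mul]
    calc _ ≤ C * C ^ (s \ {i}).card := by
          gcongr
          exact (hr i (hS hi)).integral_bound
      _ = C ^ s.card := by rw [← hcard, Finset.card_singleton, pow_add, pow_one]
      _ ≤ _ := by
        have : (0 : ℝ) ≤ C ^ s.card := by positivity
        linarith
  · obtain ⟨j, hj, hji⟩ : ∃ j ∈ S, j ≠ i := by
      by_contra hc
      push Not at hc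
      exact h1 (Finset.eq_singleton_iff_unique_mem.2 ⟨hi, hc⟩)
    have hj' : j ∈ S.erase i := Finset.mem_erase.2 ⟨hji, hj⟩
    have hpt : ∀ t ∈ Set.Ioc p q, ‖(∏ i ∈ S, r i t) * ∏ i ∈ s \ S, g i‖ ≤
        C ^ s.card * (1 + (t - b) ^ 2)⁻¹ := by
      intro t ht
      have ht' : t ∈ Set.Icc p q := ⟨ht.1.le, ht.2⟩
      rw [← Finset.mul_prod_erase S _ hi, ← Finset.mul_prod_erase (S.erase i) _ hj', norm_mul,
        ← mul_assoc, norm_mul, Real.norm_eq_abs, Real.norm_eq_abs, Real.norm_eq_abs]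
      have hd1 := (hr i (hS hi)).decay t ht'
      have hd2 := (hr j (hS hj)).decay t ht'
      have hrest : |∏ l ∈ (S.erase i).erase j, r l t| ≤ C ^ ((S.erase i).erase j).card :=
        abs_prod_le_pow fun l hl => (hr l (hS (Finset.mem_of_mem_erase
          (Finset.mem_of_mem_erase hl)))).bound t
      have hpos : (0 : ℝ) < 1 + (t - b) ^ 2 := by positivity
      have hij : |r i t * r j t| ≤ C ^ 2 * (1 + (t - b) ^ 2)⁻¹ := by
        rw [← div_eq_mul_inv, le_div_iff₀ hpos, abs_mul]
        nlinarith [two_mul_le_add_sq |r i t| |r j t|, sq_abs (r i t), sq_abs (r j t)]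
      have hcard2 : 2 + ((S.erase i).erase j).card = S.card := by
        have e1 := Finset.card_erase_add_one hi
        have e2 := Finset.card_erase_add_one hj'
        omega
      calc _ ≤ (C ^ 2 * (1 + (t - b) ^ 2)⁻¹) * C ^ ((S.erase i).erase j).card *
            C ^ (s \ S).card := by gcongr
        _ = _ := by rw [← hcard, ← hcard2]; ring
    have hci : Continuous fun t : ℝ => C ^ s.card * (1 + (t - b) ^ 2)⁻¹ := by
      refine continuous_const.mul (Continuous.inv₀ (by fun_prop) fun t => ?_)
      positivity
    have := intervalIntegral.norm_integral_le_of_norm_le hpq (.of_forall hpt)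
      (hci.intervalIntegrable (μ := volume) p q)
    rw [intervalIntegral.integral_const_mul] at this
    refine this.trans ?_
    gcongr
    exact integral_inv_one_add_sub_sq_le hpq

/-- Subtracting ∏ g removes exactly the term S = ∅ of the expansion; each of the fewer than 2^n
other terms contains a decaying factor. -/
lemma abs_integral_prod_add_sub_le {ι : Type*} [Fintype ι] {C b p q : ℝ}
    (hC : 1 ≤ C) (hpq : p ≤ q) {g : ι → ℝ} {r : ι → ℝ → ℝ} (hg : ∀ i, |g i| ≤ C)
    (hr : ∀ i, IsSmallOn C b p q (r i)) :
    |∫ t in p..q, (∏ i, (g i + r i t) - ∏ i, g i)| ≤ (2 * C) ^ Fintype.card ι * 4 := by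
  classical
  have he : ∀ t, ∏ i, (g i + r i t) - ∏ i, g i =
      ∑ S ∈ (Finset.univ : Finset ι).powerset.erase ∅,
        (∏ i ∈ S, r i t) * ∏ i ∈ Finset.univ \ S, g i := by
    intro t
    have := Finset.prod_add (fun i => r i t) g Finset.univ
    simp only [add_comm (r _ t)] at this
    rw [this, ← Finset.add_sum_erase _ _ (Finset.empty_mem_powerset _)]
    simp
  have hint : ∀ S : Finset ι, IntervalIntegrable
      (fun t => (∏ i ∈ S, r i t) * ∏ i ∈ Finset.univ \ S, g i) volume p q := fun S =>
    (intervalIntegrable_of_bounded (C := C ^ S.card)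
      (Finset.measurable_prod S fun i _ => (hr i).measurable)
      (fun t => abs_prod_le_pow fun i _ => (hr i).bound t) p q).mul_const _
  simp only [he]
  rw [intervalIntegral.integral_finsetSum fun S _ => hint S]
  refine (Finset.abs_sum_le_sum_abs _ _).trans ?_
  have hle : ∀ S ∈ (Finset.univ : Finset ι).powerset.erase ∅,
      |∫ t in p..q, (∏ i ∈ S, r i t) * ∏ i ∈ Finset.univ \ S, g i| ≤ C ^ Fintype.card ι * 4 := by
    intro S hS
    exact abs_integral_mixed_prod_le hC hpq (fun i _ => hg i) (fun i _ => hr i)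
      (Finset.subset_univ S) (Finset.nonempty_of_ne_empty (Finset.ne_of_mem_erase hS))
  refine (Finset.sum_le_card_nsmul _ _ _ hle).trans ?_
  have hcard : (((Finset.univ : Finset ι).powerset.erase ∅).card : ℝ) ≤ 2 ^ Fintype.card ι := by
    have := Finset.card_erase_le (s := (Finset.univ : Finset ι).powerset) (a := ∅)
    rw [Finset.card_powerset, Finset.card_univ] at this
    exact_mod_cast this
  rw [nsmul_eq_mul, mul_pow, mul_assoc]
  gcongr

/-! ### Weighted sums of products of matrix entries -/

section EntrySum

variable {Ω ι W : Type*} [Fintype Ω] [Fintype ι]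

/-- `∑_ω c(ω) ∏_i M(l_ω(i), r_ω(i))`; the determinant and the Pfaffian are of this form. -/
def entrySum (c : Ω → ℝ) (l r : Ω → ι → W) (M : W → W → ℝ) : ℝ :=
  ∑ ω, c ω * ∏ i, M (l ω i) (r ω i)

variable (c : Ω → ℝ) (l r : Ω → ι → W)

lemma abs_entrySum_le {M : W → W → ℝ} {C : ℝ} (hM : ∀ p q, |M p q| ≤ C) :
    |entrySum c l r M| ≤ (∑ ω, |c ω|) * C ^ Fintype.card ι := by
  unfold entrySum
  rw [Finset.sum_mul]
  refine (Finset.abs_sum_le_sum_abs _ _).trans (Finset.sum_le_sum fun ω _ => ?_)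
  rw [abs_mul]
  gcongr
  exact abs_prod_le_pow fun i _ => hM _ _

lemma abs_entrySum_sub_le {M M' : W → W → ℝ} {C ε : ℝ} (hC : 1 ≤ C) (hε : 0 ≤ ε)
    (hM : ∀ p q, |M p q| ≤ C) (hM' : ∀ p q, |M' p q| ≤ C) (h : ∀ p q, |M p q - M' p q| ≤ ε) :
    |entrySum c l r M - entrySum c l r M'| ≤
      (∑ ω, |c ω|) * ((2 * C) ^ Fintype.card ι * ε) := by
  unfold entrySum
  rw [Finset.sum_mul, ← Finset.sum_sub_distrib]
  refine (Finset.abs_sum_le_sum_abs _ _).trans (Finset.sum_le_sum fun ω _ => ?_)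
  rw [← mul_sub, abs_mul]
  gcongr
  exact abs_prod_sub_prod_le hC (fun i _ => hM _ _) (fun i _ => hM' _ _) (fun i _ => h _ _) hε

lemma measurable_entrySum {T : Type*} [MeasurableSpace T] {M : T → W → W → ℝ}
    (hM : ∀ p q, Measurable fun t => M t p q) : Measurable fun t => entrySum c l r (M t) := by
  unfold entrySum
  exact Finset.measurable_sum _ fun ω _ =>
    (Finset.measurable_prod _ fun i _ => hM _ _).const_mul _

lemma abs_integral_entrySum_add_sub_le {G : W → W → ℝ} {R : ℝ → W → W → ℝ} {C b p q : ℝ}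
    (hC : 1 ≤ C) (hpq : p ≤ q) (hG : ∀ x y, |G x y| ≤ C)
    (hR : ∀ x y, IsSmallOn C b p q fun t => R t x y) :
    |∫ t in p..q, (entrySum c l r (G + R t) - entrySum c l r G)| ≤
      (∑ ω, |c ω|) * ((2 * C) ^ Fintype.card ι * 4) := by
  unfold entrySum
  have hint : ∀ ω : Ω, IntervalIntegrable
      (fun t => c ω * (∏ i, (G + R t) (l ω i) (r ω i) - ∏ i, G (l ω i) (r ω i))) volume p q := by
    intro ω
    refine ((intervalIntegrable_of_bounded (C := (C + C) ^ Fintype.card ι) ?_ ?_ p q).sub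
      intervalIntegrable_const).const_mul _
    · exact Finset.measurable_prod _ fun i _ => (hR _ _).measurable.const_add _
    · exact fun t => abs_prod_le_pow fun i _ =>
        (abs_add_le _ _).trans (add_le_add (hG _ _) ((hR _ _).bound t))
  simp only [← Finset.sum_sub_distrib, ← mul_sub]
  rw [intervalIntegral.integral_finsetSum fun ω _ => hint ω, Finset.sum_mul]
  refine (Finset.abs_sum_le_sum_abs _ _).trans (Finset.sum_le_sum fun ω _ => ?_)
  rw [intervalIntegral.integral_const_mul, abs_mul]
  gcongr
  exact abs_integral_prod_add_sub_le hC hpq (fun i => hG _ _) (fun i => hR _ _)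

end EntrySum

/-! ### Translating one cluster of points against another -/

section Shift

variable {Ω ι W : Type*} [Fintype Ω] [Fintype ι]

/-- The positions of two clusters, the one on side `true` being translated by `τ`. -/
def shiftedPos (side : W → Bool) (z : W → ℝ) (τ : ℝ) (p : W) : ℝ :=
  z p + if side p then τ else 0

/-- A matrix that depends only on the differences of the positions: an oscillating function
plus a multiple of the sign. -/
noncomputable def kernelMatrix (osc : W → W → ℝ → ℝ) (cst : W → W → ℝ) (z : W → ℝ) (p q : W) : ℝ :=
  osc p q (z p - z q) + cst p q * Real.sign (z p - z q)

/-- The limit of the kernel matrix when one cluster moves away in the direction `s`. -/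
noncomputable def splitMatrix (osc : W → W → ℝ → ℝ) (cst : W → W → ℝ) (side : W → Bool) (z : W → ℝ)
    (s : ℝ) (p q : W) : ℝ :=
  if side p = side q then kernelMatrix osc cst z p q else cst p q * if side p then s else -s

/-- The decaying part of the entries between the two clusters. -/
noncomputable def crossMatrix (osc : W → W → ℝ → ℝ) (side : W → Bool) (z : W → ℝ) (τ : ℝ)
    (p q : W) : ℝ :=
  if side p = side q then 0 else osc p q (shiftedPos side z τ p - shiftedPos side z τ q)

variable {osc : W → W → ℝ → ℝ} {cst : W → W → ℝ} {side : W → Bool} {z : W → ℝ} {C : ℝ}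

/-- Once the clusters are separated in the direction s, the signs between them are frozen at ±s, so
only the oscillating part still depends on τ. -/
lemma kernelMatrix_shiftedPos {s τ : ℝ} (hs : s = 1 ∨ s = -1)
    (h : ∀ p q, side p = true → side q = false → 0 < s * (z p + τ - z q)) :
    kernelMatrix osc cst (shiftedPos side z τ) =
      splitMatrix osc cst side z s + crossMatrix osc side z τ := by
  have hsign : ∀ d : ℝ, 0 < s * d → Real.sign d = s ∧ Real.sign (-d) = -s := by
    intro d hd
    rw [Real.sign_neg]
    rcases hs with rfl | rfl
    · rw [Real.sign_of_pos (by linarith)]; simp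
    · rw [Real.sign_of_neg (by linarith)]; simp
  funext p q
  simp only [Pi.add_apply, splitMatrix, crossMatrix, kernelMatrix, shiftedPos]
  rcases hp : side p with _ | _ <;> rcases hq : side q with _ | _
  · simp
  · have := (hsign _ (h q p hq hp)).2
    simp only [Bool.false_eq_true, ↓reduceIte, add_zero]
    rw [show z p - (z q + τ) = -(z q + τ - z p) by ring, this]
    ring
  · have := (hsign _ (h p q hp hq)).1
    simp only [Bool.false_eq_true, ↓reduceIte, add_zero, Bool.true_eq_false]
    rw [this]
    ring
  · simp

lemma abs_kernelMatrix_le (hosc : ∀ p q, IsOscillating C (osc p q)) (hcst : ∀ p q, |cst p q| ≤ C)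
    (z : W → ℝ) (p q : W) : |kernelMatrix osc cst z p q| ≤ 2 * C := by
  have hC : 0 ≤ C := (hosc p q).nonneg
  unfold kernelMatrix
  refine (abs_add_le _ _).trans ?_
  rw [abs_mul]
  have h1 := (hosc p q).bound (z p - z q)
  have h2 : |cst p q| * |Real.sign (z p - z q)| ≤ C * 1 :=
    mul_le_mul (hcst p q) (abs_sign_le_one _) (abs_nonneg _) hC
  linarith

lemma abs_splitMatrix_le (hosc : ∀ p q, IsOscillating C (osc p q)) (hcst : ∀ p q, |cst p q| ≤ C)
    {s : ℝ} (hs : s = 1 ∨ s = -1) (p q : W) : |splitMatrix osc cst side z s p q| ≤ 2 * C := by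
  have hC : 0 ≤ C := (hosc p q).nonneg
  unfold splitMatrix
  split_ifs
  · exact abs_kernelMatrix_le hosc hcst z p q
  · rw [abs_mul]
    have := hcst p q
    rcases hs with rfl | rfl <;> simp <;> linarith
  · rw [abs_mul]
    have := hcst p q
    rcases hs with rfl | rfl <;> simp <;> linarith

/-- The cross differences d are ±τ plus a constant, which transports the bound on primitives, and |τ
- b| ≤ |d| turns decay in d into decay in τ - b. The constant 2C comes from f(d)² + d² f(d)² ≤ 2C² ≤
(2C)². -/
lemma isSmallOn_crossMatrix (hosc : ∀ p q, IsOscillating C (osc p q)) {s b t₁ t₂ : ℝ}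
    (hs : s = 1 ∨ s = -1)
    (h : ∀ τ ∈ Set.Icc t₁ t₂, ∀ p q, side p = true → side q = false →
      |τ - b| ≤ s * (z p + τ - z q)) (p q : W) :
    IsSmallOn (2 * C) b t₁ t₂ fun τ => crossMatrix osc side z τ p q := by
  have hC : 0 ≤ C := (hosc p q).nonneg
  have habs : ∀ τ ∈ Set.Icc t₁ t₂, side p ≠ side q →
      |τ - b| ≤ |shiftedPos side z τ p - shiftedPos side z τ q| := by
    intro τ hτ hne
    have hs1 : |s| = 1 := by rcases hs with rfl | rfl <;> simp
    simp only [shiftedPos]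
    rcases hp : side p with _ | _ <;> rcases hq : side q with _ | _
    · simp [hp, hq] at hne
    · have := (h τ hτ q p hq hp).trans (le_abs_self _)
      rw [abs_mul, hs1, one_mul] at this
      simp only [Bool.false_eq_true, ↓reduceIte, add_zero]
      rwa [abs_sub_comm (z p)]
    · have := (h τ hτ p q hp hq).trans (le_abs_self _)
      rw [abs_mul, hs1, one_mul] at this
      simpa using this
    · simp [hp, hq] at hne
  unfold crossMatrix
  by_cases hpq : side p = side q
  · simp only [hpq, if_true]
    exact ⟨measurable_const, fun _ => by simpa using hC, fun _ _ => by simp; positivity,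
      by simpa using hC⟩
  simp only [hpq, if_false]
  have hmeas : Measurable fun τ => shiftedPos side z τ p - shiftedPos side z τ q := by
    unfold shiftedPos
    split_ifs <;> fun_prop
  refine ⟨(hosc p q).measurable.comp hmeas, fun τ => ((hosc p q).bound _).trans (by linarith),
    fun τ hτ => ?_, ?_⟩
  · set d := shiftedPos side z τ p - shiftedPos side z τ q
    have h1 := abs_le.1 ((hosc p q).bound d)
    have h2 := abs_le.1 ((hosc p q).decay d)
    have h3 : (τ - b) ^ 2 ≤ d ^ 2 := sq_le_sq.2 (habs τ hτ hpq)
    have h4 : osc p q d ^ 2 ≤ C ^ 2 := sq_le_sq' h1.1 h1.2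
    have h5 : (d * osc p q d) ^ 2 ≤ C ^ 2 := sq_le_sq' h2.1 h2.2
    nlinarith [mul_le_mul_of_nonneg_left h3 (sq_nonneg (osc p q d))]
  · refine le_trans ?_ (by linarith : C ≤ 2 * C)
    simp only [shiftedPos]
    rcases hp : side p with _ | _ <;> rcases hq : side q with _ | _
    · simp [hp, hq] at hpq
    · simp only [Bool.false_eq_true, ↓reduceIte, add_zero]
      have := intervalIntegral.integral_comp_sub_left (osc p q) (z p - z q) (a := t₁) (b := t₂)
      simp only [sub_sub] at this ⊢
      rw [this]
      exact (hosc p q).integral_bound _ _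
    · simp only [Bool.false_eq_true, ↓reduceIte, add_zero]
      have := intervalIntegral.integral_comp_add_right (osc p q) (z p - z q) (a := t₁) (b := t₂)
      rw [show (fun τ => osc p q (z p + τ - z q)) = fun τ => osc p q (τ + (z p - z q)) by
        funext τ; congr 1; ring, this]
      exact (hosc p q).integral_bound _ _
    · simp [hp, hq] at hpq

variable (c : Ω → ℝ) (l r : Ω → ι → W)

lemma abs_integral_separated_le (hC : 1 ≤ C) (hosc : ∀ p q, IsOscillating C (osc p q))
    (hcst : ∀ p q, |cst p q| ≤ C) {s b t₁ t₂ v : ℝ} (hs : s = 1 ∨ s = -1) (ht : t₁ ≤ t₂)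
    (h : ∀ τ ∈ Set.Icc t₁ t₂, ∀ p q, side p = true → side q = false →
      |τ - b| ≤ s * (z p + τ - z q))
    (hb : b = t₁ ∨ b = t₂ ∨ b ∉ Set.Icc t₁ t₂)
    (hv : entrySum c l r (splitMatrix osc cst side z s) = v) :
    |∫ τ in t₁..t₂, (entrySum c l r (kernelMatrix osc cst (shiftedPos side z τ)) - v)| ≤
      (∑ ω, |c ω|) * ((4 * C) ^ Fintype.card ι * 4) := by
  have key := abs_integral_entrySum_add_sub_le c l r (C := 2 * C) (b := b) (by linarith) ht
    (G := splitMatrix osc cst side z s) (R := fun τ => crossMatrix osc side z τ)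
    (abs_splitMatrix_le hosc hcst hs) (isSmallOn_crossMatrix hosc hs h)
  rw [hv, show 2 * (2 * C) = 4 * C by ring] at key
  convert key using 2
  -- At τ = b the clusters may touch, and then the signs between them are not ±s. The hypothesis
  -- `hb` keeps b out of the open interval, which is all the integral sees.
  refine intervalIntegral.integral_congr_Ioo_of_le ht fun τ hτ => ?_
  rw [kernelMatrix_shiftedPos hs fun p q hp hq => ?_]
  refine lt_of_lt_of_le (abs_pos.2 ?_) (h τ (Set.Ioo_subset_Icc_self hτ) p q hp hq)
  intro h0
  have hbτ : b = τ := by linarith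
  subst hbτ
  rcases hb with hb | hb | hb
  · exact absurd hb hτ.1.ne'
  · exact absurd hb hτ.2.ne
  · exact hb (Set.Ioo_subset_Icc_self hτ)

/-- The truncated correlations of two clusters have bounded integrals over translations. -/
theorem abs_integral_shift_le (hC : 1 ≤ C) (hosc : ∀ p q, IsOscillating C (osc p q))
    (hcst : ∀ p q, |cst p q| ≤ C) {u w α t₁ t₂ v : ℝ} (hα : 0 ≤ α) (ht : t₁ ≤ t₂)
    (hzf : ∀ p, side p = false → z p ∈ Set.Icc u (u + α))
    (hzt : ∀ p, side p = true → z p ∈ Set.Icc w (w + α))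
    (hv : ∀ s, s = 1 ∨ s = -1 → entrySum c l r (splitMatrix osc cst side z s) = v) :
    |∫ τ in t₁..t₂, (entrySum c l r (kernelMatrix osc cst (shiftedPos side z τ)) - v)| ≤
      (∑ ω, |c ω|) * ((4 * C) ^ Fintype.card ι * (12 * max 1 α)) := by
  set D : ℝ → ℝ := fun τ => entrySum c l r (kernelMatrix osc cst (shiftedPos side z τ)) - v with hD
  set m := ∑ ω, |c ω| with hm
  have hm0 : 0 ≤ m := Finset.sum_nonneg fun _ _ => abs_nonneg _
  have hDm : Measurable D := by
    refine (measurable_entrySum c l r fun p q => ?_).sub_const v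
    have hmeas : Measurable fun τ => shiftedPos side z τ p - shiftedPos side z τ q := by
      unfold shiftedPos
      split_ifs <;> fun_prop
    exact ((hosc p q).measurable.comp hmeas).add ((measurable_realSign.comp hmeas).const_mul _)
  have hDb : ∀ τ, |D τ| ≤ 2 * (m * (2 * C) ^ Fintype.card ι) := by
    intro τ
    have h1 := abs_entrySum_le c l r (abs_kernelMatrix_le hosc hcst (shiftedPos side z τ))
    have h2 := abs_entrySum_le c l r
      (abs_splitMatrix_le (side := side) (z := z) hosc hcst (Or.inl rfl))
    rw [hv 1 (Or.inl rfl)] at h2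
    exact (abs_sub _ _).trans (by linarith)
  have hDi : ∀ a b, IntervalIntegrable D volume a b := intervalIntegrable_of_bounded hDm hDb
  -- The moving cluster lies in [w+τ, w+α+τ]: for τ ≤ b₁ it is to the left of [u, u+α], for τ ≥ b₂
  -- to the right. The points q₁, q₂ are b₁, b₂ clipped to [t₁, t₂]. The outer pieces use separation
  -- and the middle one, of length at most 2α, the trivial bound; each contributes 4 · max(1,α) to
  -- the factor 12 · max(1,α).
  set b₁ := u - w - α with hb₁
  set b₂ := u - w + α with hb₂
  set q₁ := max t₁ (min b₁ t₂) with hq₁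
  set q₂ := max t₁ (min b₂ t₂) with hq₂
  have hb : b₁ ≤ b₂ := by linarith
  have h1 : t₁ ≤ q₁ := le_max_left _ _
  have h2 : q₁ ≤ q₂ := max_le_max le_rfl (min_le_min hb le_rfl)
  have h3 : q₂ ≤ t₂ := max_le ht (min_le_right _ _)
  have i1 : |∫ τ in t₁..q₁, D τ| ≤ m * ((4 * C) ^ Fintype.card ι * 4) := by
    rcases h1.eq_or_lt with he | hlt
    · rw [← he]; simp; positivity
    · have hq : q₁ ≤ b₁ := by
        rcases max_choice t₁ (min b₁ t₂) with h | h
        · rw [hq₁, h] at hlt; exact absurd hlt (lt_irrefl _)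
        · rw [hq₁, h]; exact min_le_left _ _
      refine abs_integral_separated_le c l r hC hosc hcst (s := -1) (b := b₁) (Or.inr rfl) h1
        (fun τ hτ p q hp hq' => ?_) ?_ (hv _ (Or.inr rfl))
      · have e1 := hzt p hp
        have e2 := hzf q hq'
        rw [abs_of_nonpos (by linarith [hτ.2])]
        linarith [e1.2, e2.1]
      · rcases hq.eq_or_lt with h | h
        · exact Or.inr (Or.inl h.symm)
        · exact Or.inr (Or.inr fun hc => absurd hc.2 (not_le.2 h))
  have i3 : |∫ τ in q₂..t₂, D τ| ≤ m * ((4 * C) ^ Fintype.card ι * 4) := by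
    rcases h3.eq_or_lt with he | hlt
    · rw [← he]; simp; positivity
    · have hq : b₂ ≤ q₂ := by
        rcases le_total b₂ t₂ with h | h
        · rw [hq₂, min_eq_left h]; exact le_max_right _ _
        · rw [hq₂, min_eq_right h] at hlt
          exact absurd (le_max_right t₁ t₂) (not_le.2 hlt)
      refine abs_integral_separated_le c l r hC hosc hcst (s := 1) (b := b₂) (Or.inl rfl) h3
        (fun τ hτ p q hp hq' => ?_) ?_ (hv _ (Or.inl rfl))
      · have e1 := hzt p hp
        have e2 := hzf q hq'
        rw [abs_of_nonneg (by linarith [hτ.1])]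
        linarith [e1.1, e2.2]
      · rcases hq.eq_or_lt with h | h
        · exact Or.inl h
        · exact Or.inr (Or.inr fun hc => absurd hc.1 (not_le.2 h))
  have i2 : |∫ τ in q₁..q₂, D τ| ≤ 2 * (m * (2 * C) ^ Fintype.card ι) * (2 * α) := by
    have := intervalIntegral.norm_integral_le_of_norm_le_const (a := q₁) (b := q₂) (f := D)
      (fun τ _ => hDb τ)
    refine this.trans ?_
    have hlen : |q₂ - q₁| ≤ 2 * α := by
      rw [abs_of_nonneg (by linarith)]
      have e1 : q₂ ≤ q₁ + 2 * α := by
        refine max_le (by linarith) ?_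
        have e2 : min b₁ t₂ ≤ q₁ := le_max_right _ _
        rcases le_total b₁ t₂ with h | h
        · rw [min_eq_left h] at e2
          exact (min_le_left _ _).trans (by linarith)
        · rw [min_eq_right h] at e2
          exact (min_le_right _ _).trans (by linarith)
      linarith
    gcongr
  have hsplit : ∫ τ in t₁..t₂, D τ =
      (∫ τ in t₁..q₁, D τ) + (∫ τ in q₁..q₂, D τ) + ∫ τ in q₂..t₂, D τ := by
    rw [intervalIntegral.integral_add_adjacent_intervals (hDi _ _) (hDi _ _),
      intervalIntegral.integral_add_adjacent_intervals (hDi _ _) (hDi _ _)]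
  rw [hsplit]
  have hpow : (2 * C) ^ Fintype.card ι ≤ (4 * C) ^ Fintype.card ι := by
    gcongr; norm_num
  have hα1 : α ≤ max 1 α := le_max_right _ _
  have h1α : 1 ≤ max 1 α := le_max_left _ _
  calc _ ≤ m * ((4 * C) ^ Fintype.card ι * 4) + 2 * (m * (2 * C) ^ Fintype.card ι) * (2 * α) +
        m * ((4 * C) ^ Fintype.card ι * 4) :=
      (abs_add_three _ _ _).trans (add_le_add (add_le_add i1 i2) i3)
    _ ≤ m * ((4 * C) ^ Fintype.card ι * (4 * max 1 α)) +
        2 * (m * (4 * C) ^ Fintype.card ι) * (2 * max 1 α) +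
        m * ((4 * C) ^ Fintype.card ι * (4 * max 1 α)) := by
      gcongr <;> linarith
    _ = _ := by ring

end Shift

/-! ### The properties of correlation functions on which the variance estimate rests. -/

/-- Limiting correlation functions: measurable, of factorial growth, and such that the truncated
correlations of two clusters have bounded integrals over the translations of one of them. -/
structure IsLimitCorr (C : ℝ) (ρ : ∀ m : ℕ, (Fin m → ℝ) → ℝ) : Prop where
  measurable : ∀ m, Measurable (ρ m)
  bound : ∀ m t, |ρ m t| ≤ C ^ m * (m ! : ℝ)
  translate : ∀ m t τ, ρ m (fun i => t i + τ) = ρ m t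
  shift : ∀ (k : ℕ) (x y : Fin k → ℝ) (u w α t₁ t₂ : ℝ), 0 ≤ α → t₁ ≤ t₂ →
    (∀ i, x i ∈ Set.Icc u (u + α)) → (∀ i, y i ∈ Set.Icc w (w + α)) →
    |∫ τ in t₁..t₂, (ρ (k + k) (Fin.append x fun i => y i + τ) - ρ k x * ρ k y)| ≤
      C ^ (k + k) * (k + k)! * (12 * max 1 α)

/-- The functions `B_m`, `m ≤ N`, are bounded on `A` and `ε`-close to `ρ_m` there. -/
structure IsApproxCorr (C : ℝ) (B ρ : ∀ m : ℕ, (Fin m → ℝ) → ℝ) (A : Set ℝ) (N : ℕ) (ε : ℝ) :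
    Prop where
  bound : ∀ m ≤ N, ∀ t : Fin m → ℝ, (∀ i, t i ∈ A) → |B m t| ≤ C ^ m * (m ! : ℝ)
  diff : ∀ m ≤ N, ∀ t : Fin m → ℝ, (∀ i, t i ∈ A) → |B m t - ρ m t| ≤ C ^ m * (m ! : ℝ) * ε

lemma IsLimitCorr.mono {C C' : ℝ} (hC : 0 ≤ C) (hCC' : C ≤ C')
    {ρ : ∀ m : ℕ, (Fin m → ℝ) → ℝ} (h : IsLimitCorr C ρ) : IsLimitCorr C' ρ where
  measurable := h.measurable
  bound m t := (h.bound m t).trans (by gcongr)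
  translate := h.translate
  shift k x y u w α t₁ t₂ hα ht hx hy :=
    (h.shift k x y u w α t₁ t₂ hα ht hx hy).trans (by gcongr)

lemma append_add_eq_shiftedPos {k : ℕ} (x y : Fin k → ℝ) (τ : ℝ) (p : Fin (k + k)) :
    Fin.append x (fun i => y i + τ) p =
      shiftedPos (fun p : Fin (k + k) => (finSumFinEquiv.symm p).isRight) (Fin.append x y) τ p := by
  induction p using Fin.addCases <;> simp [shiftedPos, -Fin.natAdd_eq_addNat]

lemma append_mem_left {k : ℕ} {x y : Fin k → ℝ} {S : Set ℝ} (hx : ∀ i, x i ∈ S) (p : Fin (k + k))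
    (hp : (finSumFinEquiv.symm p).isRight = false) : Fin.append x y p ∈ S := by
  induction p using Fin.addCases with
  | left i => simpa using hx i
  | right i => simp [-Fin.natAdd_eq_addNat] at hp

lemma append_mem_right {k : ℕ} {x y : Fin k → ℝ} {S : Set ℝ} (hy : ∀ i, y i ∈ S) (p : Fin (k + k))
    (hp : (finSumFinEquiv.symm p).isRight = true) : Fin.append x y p ∈ S := by
  induction p using Fin.addCases with
  | left i => simp [-Fin.natAdd_eq_addNat] at hp
  | right i => simpa [-Fin.natAdd_eq_addNat] using hy i

/-! ### Determinants -/

/-- The signs in the Leibniz formula. -/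
def detSign (m : ℕ) (σ : Equiv.Perm (Fin m)) : ℝ := ((Equiv.Perm.sign σ : ℤ) : ℝ)

lemma abs_sign_cast {α : Type*} [Fintype α] [DecidableEq α] (σ : Equiv.Perm α) :
    |((Equiv.Perm.sign σ : ℤ) : ℝ)| = 1 := by
  rcases Int.units_eq_one_or (Equiv.Perm.sign σ) with h | h <;> simp [h]

lemma det_eq_entrySum {m : ℕ} (M : Fin m → Fin m → ℝ) :
    (Matrix.of M).det =
      entrySum (detSign m) (fun σ i => σ i) (fun (_ : Equiv.Perm (Fin m)) i => i) M := by
  rw [Matrix.det_apply']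
  rfl

lemma sum_abs_detSign (m : ℕ) : ∑ σ, |detSign m σ| = m ! := by
  simp [detSign, abs_sign_cast, Fintype.card_perm]

lemma sineMatrix_eq {m : ℕ} (t : Fin m → ℝ) :
    (fun i j => sineKernel (t i) (t j)) = kernelMatrix (fun _ _ => sineFun) (fun _ _ => 0) t := by
  funext i j
  simp [kernelMatrix, sineKernel, sineFun]

/-- Without sign terms the limit matrix is block diagonal, whatever the direction s. -/
lemma det_splitMatrix {k : ℕ} (osc : ℝ → ℝ) (x y : Fin k → ℝ) (s : ℝ) :
    (Matrix.of (splitMatrix (fun _ _ => osc) (fun _ _ => 0)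
      (fun p : Fin (k + k) => (finSumFinEquiv.symm p).isRight) (Fin.append x y) s)).det =
    (Matrix.of (kernelMatrix (fun _ _ => osc) (fun _ _ => 0) x)).det *
      (Matrix.of (kernelMatrix (fun _ _ => osc) (fun _ _ => 0) y)).det := by
  rw [← Matrix.det_submatrix_equiv_self finSumFinEquiv, ← Matrix.det_fromBlocks_zero₂₁ _ 0]
  congr 1
  ext i j
  rcases i with i | i <;> rcases j with j | j <;>
    simp [splitMatrix, kernelMatrix, -Fin.natAdd_eq_addNat]

/-- The Leibniz signs have absolute sum m!, so only the bases 2·6 (size of the entries) and 4·6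
(integrals over translations) have to stay below 48. -/
theorem isLimitCorr_det :
    IsLimitCorr 48 fun m t => (Matrix.of fun i j : Fin m => sineKernel (t i) (t j)).det := by
  have hosc : ∀ m, ∀ p q : Fin m, IsOscillating 6 ((fun _ _ => sineFun : Fin m → Fin m → ℝ → ℝ) p q) :=
    fun _ _ _ => isOscillating_sineFun
  have hcst : ∀ m, ∀ p q : Fin m, |(fun _ _ => 0 : Fin m → Fin m → ℝ) p q| ≤ 6 :=
    fun _ _ _ => by norm_num
  refine ⟨fun m => ?_, fun m t => ?_, fun m t τ => by simp [sineKernel], ?_⟩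
  · simp only [det_eq_entrySum]
    refine measurable_entrySum _ _ _ fun p q => ?_
    exact continuous_sineFun.measurable.comp
      ((measurable_pi_apply p).sub (measurable_pi_apply q))
  · rw [det_eq_entrySum, sineMatrix_eq]
    refine (abs_entrySum_le _ _ _ (abs_kernelMatrix_le (hosc m) (hcst m) t)).trans ?_
    rw [sum_abs_detSign, Fintype.card_fin, mul_comm]
    gcongr
    norm_num
  · intro k x y u w α t₁ t₂ hα ht hx hy
    have key := abs_integral_shift_le (detSign (k + k)) (fun σ i => σ i)
      (fun (_ : Equiv.Perm (Fin (k + k))) i => i) (by norm_num : (1 : ℝ) ≤ 6)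
      (hosc (k + k)) (hcst (k + k)) hα ht (append_mem_left (y := y) hx) (append_mem_right (x := x) hy)
      (v := (Matrix.of fun i j : Fin k => sineKernel (x i) (x j)).det *
        (Matrix.of fun i j : Fin k => sineKernel (y i) (y j)).det) (fun s _ => by
        rw [← det_eq_entrySum, det_splitMatrix, sineMatrix_eq, sineMatrix_eq])
    rw [sum_abs_detSign, Fintype.card_fin] at key
    have hpos : ∀ τ, (fun i j => sineKernel (Fin.append x (fun i => y i + τ) i)
        (Fin.append x (fun i => y i + τ) j)) = kernelMatrix (fun _ _ => sineFun) (fun _ _ => 0)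
        (shiftedPos (fun p : Fin (k + k) => (finSumFinEquiv.symm p).isRight) (Fin.append x y) τ) := by
      intro τ
      rw [sineMatrix_eq]
      congr 1
      funext p
      exact append_add_eq_shiftedPos x y τ p
    simp only [det_eq_entrySum, hpos] at key ⊢
    refine key.trans ?_
    rw [mul_comm ((48 : ℝ) ^ (k + k)), mul_assoc]
    gcongr
    norm_num

/-! ### Pfaffians -/

/-- The coefficients of the Pfaffian. -/
noncomputable def pfaffSign (m : ℕ) (σ : Equiv.Perm (Fin m × Fin 2)) : ℝ :=
  (1 / ((2 : ℝ) ^ m * (m ! : ℝ))) * ((Equiv.Perm.sign σ : ℤ) : ℝ)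

lemma pfaffian_eq_entrySum {m : ℕ} (M : Matrix (Fin m × Fin 2) (Fin m × Fin 2) ℝ) :
    pfaffian M = entrySum (pfaffSign m) (fun σ i => σ (i, 0)) (fun σ i => σ (i, 1)) M := by
  unfold pfaffian entrySum pfaffSign
  rw [Finset.mul_sum]
  simp only [mul_assoc]

lemma entrySum_pfaffSign_eq_polar {m : ℕ} (M : Fin m × Fin 2 → Fin m × Fin 2 → ℝ) :
    entrySum (pfaffSign m) (fun σ i => σ (i, 0)) (fun σ i => σ (i, 1)) M =
      (1 / ((2 : ℝ) ^ m * (m ! : ℝ))) * polarPfaffian fun _ => M := by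
  unfold polarPfaffian entrySum pfaffSign
  rw [Finset.mul_sum]
  simp only [mul_assoc]

/-- The sum is (2m)!/(2^m m!), and the central binomial coefficient is at most 4^m. So Pfaffians
grow like determinants, up to a factor 2^m. -/
lemma sum_abs_pfaffSign_le (m : ℕ) : ∑ σ, |pfaffSign m σ| ≤ 2 ^ m * m ! := by
  have h : (m * 2)! ≤ 4 ^ m * (m ! * m !) := by
    have h2 : Nat.centralBinom m ≤ 4 ^ m := by
      have := Nat.choose_le_two_pow (2 * m) m
      rwa [pow_mul] at this
    have h3 := Nat.choose_mul_factorial_mul_factorial (show m ≤ 2 * m by omega)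
    rw [show 2 * m - m = m by omega, ← Nat.centralBinom] at h3
    rw [mul_comm m 2, ← h3, mul_assoc]
    gcongr
  have h' : ((m * 2)! : ℝ) ≤ 4 ^ m * (m ! * m !) := by exact_mod_cast h
  have hpos : (0 : ℝ) < 2 ^ m * m ! := by positivity
  simp only [pfaffSign, abs_mul, abs_sign_cast, mul_one, abs_of_pos (one_div_pos.2 hpos),
    Finset.sum_const, Finset.card_univ, Fintype.card_perm, Fintype.card_prod, Fintype.card_fin,
    nsmul_eq_mul]
  rw [mul_one_div, div_le_iff₀ hpos]
  calc ((m * 2)! : ℝ) ≤ 4 ^ m * (m ! * m !) := h'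
    _ = 2 ^ m * m ! * (2 ^ m * m !) := by
      rw [show (4 : ℝ) = 2 * 2 by norm_num, mul_pow]; ring

/-- The oscillating entries of `K J`. -/
def pfaffOsc (f d e : ℝ → ℝ) (a b : Fin 2) (r : ℝ) : ℝ :=
  !![-d r, f r; -f r, e r] a b

/-- The constant entries of `K J`. -/
def pfaffCst (c : ℝ) (a b : Fin 2) : ℝ := !![0, 0; 0, c] a b

lemma blockMatrix_mul_symplecticJ_apply (K : ℝ → ℝ → Matrix (Fin 2) (Fin 2) ℝ) {m : ℕ}
    (t : Fin m → ℝ) (p q : Fin m × Fin 2) :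
    (blockMatrix K t * symplecticJ m) p q =
      (K (t p.1) (t q.1) * (!![0, 1; -1, 0] : Matrix (Fin 2) (Fin 2) ℝ)) p.2 q.2 := by
  rw [Matrix.mul_apply, Fintype.sum_prod_type, Finset.sum_eq_single q.1]
  · simp [blockMatrix, symplecticJ, Matrix.mul_apply]
  · intro i _ hi
    simp [symplecticJ, Matrix.one_apply_ne hi]
  · simp

lemma blockMatrix_mul_symplecticJ_eq {L : ℝ → ℝ → Matrix (Fin 2) (Fin 2) ℝ} {f d e : ℝ → ℝ}
    {c : ℝ} (hL : ∀ x y, L x y = !![f (x - y), d (x - y);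
      e (x - y) + c * Real.sign (x - y), f (x - y)]) {m : ℕ} (t : Fin m → ℝ) :
    (blockMatrix L t * symplecticJ m : Matrix _ _ ℝ) =
      kernelMatrix (fun p q => pfaffOsc f d e p.2 q.2) (fun p q => pfaffCst c p.2 q.2)
        fun p => t p.1 := by
  ext ⟨i, a⟩ ⟨j, b⟩
  rw [blockMatrix_mul_symplecticJ_apply, hL]
  fin_cases a <;> fin_cases b <;> simp [kernelMatrix, pfaffOsc, pfaffCst, Matrix.mul_apply]

/-- Multiplication by J puts the sign term into the position (1,1) of each 2 × 2 block. Between the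
clusters only the constants ∓sc remain there: a multiple of u ∧ v, with u and v the indicators of
the second components of the left and of the right cluster. This has rank two and drops out. The
normalisations match because binom(2k,k) · (k!)² = (2k)!. -/
lemma pfaffian_splitMatrix {k : ℕ} (osc : Fin 2 → Fin 2 → ℝ → ℝ) (c : ℝ) (x y : Fin k → ℝ) (s : ℝ) :
    entrySum (pfaffSign (k + k)) (fun σ i => σ (i, 0)) (fun σ i => σ (i, 1))
      (splitMatrix (fun p q => osc p.2 q.2) (fun p q => pfaffCst c p.2 q.2)
        (fun p : Fin (k + k) × Fin 2 => (finSumFinEquiv.symm p.1).isRight)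
        (fun p => Fin.append x y p.1) s) =
    entrySum (pfaffSign k) (fun σ i => σ (i, 0)) (fun σ i => σ (i, 1))
      (kernelMatrix (fun p q => osc p.2 q.2) (fun p q => pfaffCst c p.2 q.2) fun p => x p.1) *
    entrySum (pfaffSign k) (fun σ i => σ (i, 0)) (fun σ i => σ (i, 1))
      (kernelMatrix (fun p q => osc p.2 q.2) (fun p q => pfaffCst c p.2 q.2) fun p => y p.1) := by
  simp only [entrySum_pfaffSign_eq_polar]
  rw [polarPfaffian_reindex finSumFinEquiv]
  let N : (Fin k ⊕ Fin k) × Fin 2 → (Fin k ⊕ Fin k) × Fin 2 → ℝ := fun p q =>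
    if p.1.isLeft = q.1.isLeft then
      kernelMatrix (fun p q => osc p.2 q.2) (fun p q => pfaffCst c p.2 q.2)
        (fun p => Sum.elim x y p.1) p q else 0
  let u : (Fin k ⊕ Fin k) × Fin 2 → ℝ := fun p => if p.1.isLeft ∧ p.2 = 1 then 1 else 0
  let v : (Fin k ⊕ Fin k) × Fin 2 → ℝ := fun p => if ¬ p.1.isLeft ∧ p.2 = 1 then 1 else 0
  have h : (fun (_ : Fin k ⊕ Fin k) (p q : (Fin k ⊕ Fin k) × Fin 2) =>
      splitMatrix (fun p q => osc p.2 q.2) (fun p q => pfaffCst c p.2 q.2)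
        (fun p : Fin (k + k) × Fin 2 => (finSumFinEquiv.symm p.1).isRight)
        (fun p => Fin.append x y p.1) s (finSumFinEquiv p.1, p.2) (finSumFinEquiv q.1, q.2)) =
      fun _ => (fun p q => (-(s * c)) * (u p * v q - v p * u q)) + N := by
    funext _ p q
    obtain ⟨i | i, a⟩ := p <;> obtain ⟨j | j, b⟩ := q <;> fin_cases a <;> fin_cases b <;>
      simp [splitMatrix, kernelMatrix, N, u, v, pfaffCst, mul_comm, -Fin.natAdd_eq_addNat]
  have hk := polarPfaffian_block_add_wedge N (fun p q h => if_neg h) u v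
    (fun p hp => by simp [u, hp]) (fun p hp => by simp [v, hp]) (-(s * c))
  rw [h, hk, Fintype.card_fin]
  have hch : ((k + k).choose k : ℝ) * (k ! * k !) = (k + k)! := by
    have := Nat.choose_mul_factorial_mul_factorial (show k ≤ k + k by omega)
    rw [show k + k - k = k by omega, mul_assoc] at this
    exact_mod_cast this
  have hN₁ : (fun (_ : Fin k) (p q : Fin k × Fin 2) => N (Sum.inl p.1, p.2) (Sum.inl q.1, q.2)) =
      fun _ => kernelMatrix (fun p q => osc p.2 q.2) (fun p q => pfaffCst c p.2 q.2)
        fun p => x p.1 := rfl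
  have hN₂ : (fun (_ : Fin k) (p q : Fin k × Fin 2) => N (Sum.inr p.1, p.2) (Sum.inr q.1, q.2)) =
      fun _ => kernelMatrix (fun p q => osc p.2 q.2) (fun p q => pfaffCst c p.2 q.2)
        fun p => y p.1 := rfl
  rw [hN₁, hN₂]
  have h1 : (k ! : ℝ) ≠ 0 := by positivity
  have h2 : ((k + k)! : ℝ) ≠ 0 := by positivity
  rw [pow_add]
  field_simp
  rw [← hch]
  ring

/-- Here 96 = 2 · (4 · 12): the 2 from the sum of the Pfaffian coefficients, the 4 · 12 from the
integrals over translations. -/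
theorem isLimitCorr_pfaffian {L : ℝ → ℝ → Matrix (Fin 2) (Fin 2) ℝ} {f d e : ℝ → ℝ} {c : ℝ}
    (hf : IsOscillating 12 f) (hd : IsOscillating 12 d) (he : IsOscillating 12 e) (hc : |c| ≤ 12)
    (hL : ∀ x y, L x y = !![f (x - y), d (x - y);
      e (x - y) + c * Real.sign (x - y), f (x - y)]) :
    IsLimitCorr 96 fun m t => pfaffian (blockMatrix L t * symplecticJ m) := by
  have hneg : ∀ {g : ℝ → ℝ}, IsOscillating 12 g → IsOscillating 12 fun r => -g r := fun hg => by
    simpa using hg.const_mul (-1)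
  have hosc : ∀ m, ∀ p q : Fin m × Fin 2, IsOscillating 12 (pfaffOsc f d e p.2 q.2) := by
    rintro m ⟨i, a⟩ ⟨j, b⟩
    fin_cases a <;> fin_cases b
    · exact hneg hd
    · exact hf
    · exact hneg hf
    · exact he
  have hcst : ∀ m, ∀ p q : Fin m × Fin 2, |pfaffCst c p.2 q.2| ≤ 12 := by
    rintro m ⟨i, a⟩ ⟨j, b⟩
    fin_cases a <;> fin_cases b <;> simp [pfaffCst, hc]
  have hform : ∀ m (t : Fin m → ℝ), pfaffian (blockMatrix L t * symplecticJ m) =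
      entrySum (pfaffSign m) (fun σ i => σ (i, 0)) (fun σ i => σ (i, 1))
        (kernelMatrix (fun p q => pfaffOsc f d e p.2 q.2) (fun p q => pfaffCst c p.2 q.2)
          fun p => t p.1) := fun m t => by
    rw [pfaffian_eq_entrySum, blockMatrix_mul_symplecticJ_eq hL]
  simp only [hform]
  refine ⟨fun m => ?_, fun m t => ?_, fun m t τ => ?_, ?_⟩
  · refine measurable_entrySum _ _ _ fun p q => ?_
    have hm : Measurable fun t : Fin m → ℝ => t p.1 - t q.1 :=
      (measurable_pi_apply p.1).sub (measurable_pi_apply q.1)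
    exact ((hosc m p q).measurable.comp hm).add ((measurable_realSign.comp hm).const_mul _)
  · refine (abs_entrySum_le _ _ _ (abs_kernelMatrix_le (hosc m) (hcst m) _)).trans ?_
    rw [Fintype.card_fin]
    calc _ ≤ 2 ^ m * m ! * (2 * 12 : ℝ) ^ m := by gcongr; exact sum_abs_pfaffSign_le m
      _ = 48 ^ m * m ! := by rw [mul_right_comm, ← mul_pow]; norm_num
      _ ≤ _ := by gcongr; norm_num
  · congr 1
    funext p q
    simp [kernelMatrix]
  · intro k x y u w α t₁ t₂ hα ht hx hy
    have key := abs_integral_shift_le (pfaffSign (k + k)) (fun σ i => σ (i, 0))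
      (fun σ i => σ (i, 1)) (by norm_num : (1 : ℝ) ≤ 12)
      (hosc (k + k)) (hcst (k + k)) hα ht
      (fun p => append_mem_left (y := y) hx p.1) (fun p => append_mem_right (x := x) hy p.1)
      (fun s _ => pfaffian_splitMatrix (pfaffOsc f d e) c x y s)
    rw [Fintype.card_fin] at key
    have hpos : ∀ τ, (fun p : Fin (k + k) × Fin 2 => Fin.append x (fun i => y i + τ) p.1) =
        shiftedPos (fun p : Fin (k + k) × Fin 2 => (finSumFinEquiv.symm p.1).isRight)
          (fun p => Fin.append x y p.1) τ := by
      intro τ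
      funext p
      exact append_add_eq_shiftedPos x y τ p.1
    simp only [hpos]
    refine key.trans ?_
    calc _ ≤ 2 ^ (k + k) * (k + k)! * ((4 * 12 : ℝ) ^ (k + k) * (12 * max 1 α)) := by
          gcongr; exact sum_abs_pfaffSign_le _
      _ = (2 * (4 * 12)) ^ (k + k) * (k + k)! * (12 * max 1 α) := by rw [mul_pow 2 (4 * 12 : ℝ)]; ring
      _ = _ := by norm_num

/-! ### The limiting kernels and the correlation functions of the ensembles -/

lemma sineKernel_eq (x y : ℝ) : sineKernel x y = sineFun (x - y) := rfl

lemma limitKernelOne_eq (x y : ℝ) : limitKernelOne x y =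
    !![sineFun (x - y), deriv sineFun (x - y);
      sineTail (x - y) + 0 * Real.sign (x - y), sineFun (x - y)] := by
  simp only [limitKernelOne, sineKernel_eq, sub_zero, deriv_comp_sub_const, zero_mul, add_zero]
  rfl

/-- The primitive of K_2(2t, 0) tends to ±1/4 at ±∞. Splitting off this limit leaves an oscillating
function; for β = 1 no such term is left. -/
lemma limitKernelFour_eq (x y : ℝ) : limitKernelFour x y =
    !![sineFun (2 * (x - y)), 2 * deriv sineFun (2 * (x - y));
      1 / 2 * sineTail (2 * (x - y)) + 1 / 4 * Real.sign (x - y), sineFun (2 * (x - y))] := by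
  have h1 : deriv (fun u => sineFun (2 * u - 2 * y)) x = 2 * deriv sineFun (2 * (x - y)) := by
    have := deriv_comp_mul_left (2 : ℝ) (fun v => sineFun (v - 2 * y)) x
    rw [this, deriv_comp_sub_const, smul_eq_mul, mul_sub]
  have h2 : ∫ t in (0 : ℝ)..(x - y), sineFun (2 * t) =
      1 / 2 * sineTail (2 * (x - y)) + 1 / 4 * Real.sign (x - y) := by
    rw [intervalIntegral.integral_comp_mul_left sineFun two_ne_zero, sineTail]
    have : Real.sign (2 * (x - y)) = Real.sign (x - y) := by
      rcases lt_trichotomy (x - y) 0 with h | h | h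
      · rw [Real.sign_of_neg h, Real.sign_of_neg (by linarith)]
      · simp [h]
      · rw [Real.sign_of_pos h, Real.sign_of_pos (by linarith)]
    rw [this]
    simp only [mul_zero, smul_eq_mul]
    ring
  simp only [limitKernelFour, sineKernel_eq, sub_zero, h1, h2]
  simp only [mul_sub]

theorem isLimitCorr_one :
    IsLimitCorr 96 fun m t => pfaffian (blockMatrix limitKernelOne t * symplecticJ m) :=
  isLimitCorr_pfaffian (isOscillating_sineFun.mono (by norm_num))
    (isOscillating_deriv_sineFun.mono (by norm_num)) (isOscillating_sineTail.mono (by norm_num))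
    (by norm_num) limitKernelOne_eq

theorem isLimitCorr_four :
    IsLimitCorr 96 fun m t => pfaffian (blockMatrix limitKernelFour t * symplecticJ m) :=
  isLimitCorr_pfaffian (f := fun r => sineFun (2 * r)) (d := fun r => 2 * deriv sineFun (2 * r))
    (e := fun r => 1 / 2 * sineTail (2 * r))
    (isOscillating_sineFun.comp_two_mul.mono (by norm_num))
    ((isOscillating_deriv_sineFun.comp_two_mul.const_mul 2).mono (by norm_num))
    ((isOscillating_sineTail.comp_two_mul.const_mul (1 / 2)).mono (by
      rw [abs_of_pos] <;> norm_num))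
    (c := 1 / 4) (by rw [abs_of_pos] <;> norm_num) limitKernelFour_eq

lemma abs_entry_le {f d e : ℝ → ℝ} (hf : IsOscillating 12 f) (hd : IsOscillating 12 d)
    (he : IsOscillating 12 e) {c : ℝ} (hc : |c| ≤ 12) (r : ℝ) (i j : Fin 2) :
    |!![f r, d r; e r + c * Real.sign r, f r] i j| ≤ 24 := by
  have h : |e r + c * Real.sign r| ≤ 24 := by
    refine (abs_add_le _ _).trans ?_
    rw [abs_mul]
    have := mul_le_mul hc (abs_sign_le_one r) (abs_nonneg _) (by norm_num)
    linarith [he.bound r]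
  fin_cases i <;> fin_cases j
  · exact (hf.bound r).trans (by norm_num)
  · exact (hd.bound r).trans (by norm_num)
  · exact h
  · exact (hf.bound r).trans (by norm_num)

lemma abs_limitKernelOne_le (x y : ℝ) (i j : Fin 2) : |limitKernelOne x y i j| ≤ 24 := by
  rw [limitKernelOne_eq]
  exact abs_entry_le (isOscillating_sineFun.mono (by norm_num))
    (isOscillating_deriv_sineFun.mono (by norm_num)) (isOscillating_sineTail.mono (by norm_num))
    (by norm_num) _ i j

lemma abs_limitKernelFour_le (x y : ℝ) (i j : Fin 2) : |limitKernelFour x y i j| ≤ 24 := by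
  rw [limitKernelFour_eq]
  exact abs_entry_le (f := fun r => sineFun (2 * r)) (d := fun r => 2 * deriv sineFun (2 * r))
    (e := fun r => 1 / 2 * sineTail (2 * r))
    (isOscillating_sineFun.comp_two_mul.mono (by norm_num))
    ((isOscillating_deriv_sineFun.comp_two_mul.const_mul 2).mono (by norm_num))
    ((isOscillating_sineTail.comp_two_mul.const_mul (1 / 2)).mono (by
      rw [abs_of_pos] <;> norm_num))
    (c := 1 / 4) (by rw [abs_of_pos] <;> norm_num) _ i j

/-! ### Passing from kernels to correlation functions at finite N. -/

section Approx

variable {V ψ : ℝ → ℝ} {a : ℝ} {δ κ : ℕ → ℝ}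

lemma abs_entry_mul_symplectic_le {M : Matrix (Fin 2) (Fin 2) ℝ} {ε : ℝ}
    (h : ∀ i j, |M i j| ≤ ε) (i j : Fin 2) :
    |(M * (!![0, 1; -1, 0] : Matrix (Fin 2) (Fin 2) ℝ)) i j| ≤ ε := by
  fin_cases j
  · simpa [Matrix.mul_apply] using h i 1
  · simpa [Matrix.mul_apply] using h i 0

/-- C bounds the entries of both kernels on A. One factor 2 in 4C is due to the Pfaffian
coefficients, the other to exchanging the factors of a product one by one. -/
lemma isApproxCorr_pfaffian {β : DysonIndex} {N : ℕ} {K L : ℝ → ℝ → Matrix (Fin 2) (Fin 2) ℝ}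
    {A : Set ℝ} {C ε : ℝ} (hK : IsPfaffKernel β V ψ a N K) (hL : ∀ x y i j, |L x y i j| ≤ 24)
    (hC : 24 ≤ C) (hε : 0 ≤ ε) (hεC : 24 + ε ≤ C)
    (h : ∀ x ∈ A, ∀ y ∈ A, ∀ i j, |K (unscale ψ a N x) (unscale ψ a N y) i j - L x y i j| ≤ ε) :
    IsApproxCorr (4 * C) (fun m => rescaledCorr β V ψ a N m)
      (fun m t => pfaffian (blockMatrix L t * symplecticJ m)) A N ε := by
  have hKb : ∀ x ∈ A, ∀ y ∈ A, ∀ i j, |K (unscale ψ a N x) (unscale ψ a N y) i j| ≤ C := by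
    intro x hx y hy i j
    have h1 := h x hx y hy i j
    have h2 := hL x y i j
    have h3 := abs_add_le (K (unscale ψ a N x) (unscale ψ a N y) i j - L x y i j) (L x y i j)
    rw [sub_add_cancel] at h3
    linarith
  constructor
  · intro m hm t ht
    rw [(hK m hm t).2, pfaffian_eq_entrySum]
    refine (abs_entrySum_le (C := C) _ _ _ fun p q => ?_).trans ?_
    · rw [blockMatrix_mul_symplecticJ_apply]
      exact abs_entry_mul_symplectic_le (hKb _ (ht _) _ (ht _)) _ _
    · rw [Fintype.card_fin]
      calc _ ≤ 2 ^ m * m ! * C ^ m := by gcongr; exact sum_abs_pfaffSign_le m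
        _ = (2 * C) ^ m * m ! := by rw [mul_pow]; ring
        _ ≤ _ := by gcongr; norm_num
  · intro m hm t ht
    rw [(hK m hm t).2, pfaffian_eq_entrySum, pfaffian_eq_entrySum]
    refine (abs_entrySum_sub_le (C := C) (ε := ε) _ _ _ (by linarith) hε (fun p q => ?_)
      (fun p q => ?_) fun p q => ?_).trans ?_
    · rw [blockMatrix_mul_symplecticJ_apply]
      exact abs_entry_mul_symplectic_le (hKb _ (ht _) _ (ht _)) _ _
    · rw [blockMatrix_mul_symplecticJ_apply]
      exact abs_entry_mul_symplectic_le (fun i j => (hL _ _ i j).trans hC) _ _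
    · rw [blockMatrix_mul_symplecticJ_apply, blockMatrix_mul_symplecticJ_apply, ← Matrix.sub_apply,
        ← Matrix.sub_mul]
      exact abs_entry_mul_symplectic_le (fun i j => h _ (ht _) _ (ht _) i j) _ _
    · rw [Fintype.card_fin]
      calc _ ≤ 2 ^ m * m ! * ((2 * C) ^ m * ε) := by gcongr; exact sum_abs_pfaffSign_le m
        _ = _ := by
          rw [show (4 : ℝ) * C = 2 * (2 * C) by ring, mul_pow 2 (2 * C)]; ring

lemma isApproxCorr_det {β : DysonIndex} {N : ℕ} {K L : ℝ → ℝ → ℝ}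
    {A : Set ℝ} {C ε : ℝ} (hK : IsDetKernel β V ψ a N K) (hL : ∀ x y, |L x y| ≤ 24)
    (hC : 24 ≤ C) (hε : 0 ≤ ε) (hεC : 24 + ε ≤ C)
    (h : ∀ x ∈ A, ∀ y ∈ A, |K (unscale ψ a N x) (unscale ψ a N y) - L x y| ≤ ε) :
    IsApproxCorr (4 * C) (fun m => rescaledCorr β V ψ a N m)
      (fun m t => (Matrix.of fun i j : Fin m => L (t i) (t j)).det) A N ε := by
  have hKb : ∀ x ∈ A, ∀ y ∈ A, |K (unscale ψ a N x) (unscale ψ a N y)| ≤ C := by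
    intro x hx y hy
    have h1 := h x hx y hy
    have h2 := hL x y
    have h3 := abs_add_le (K (unscale ψ a N x) (unscale ψ a N y) - L x y) (L x y)
    rw [sub_add_cancel] at h3
    linarith
  constructor
  · intro m hm t ht
    rw [hK m hm t, det_eq_entrySum]
    refine (abs_entrySum_le (C := C) _ _ _ fun p q => hKb _ (ht _) _ (ht _)).trans ?_
    rw [Fintype.card_fin, sum_abs_detSign, mul_comm]
    gcongr
    linarith
  · intro m hm t ht
    rw [hK m hm t, det_eq_entrySum, det_eq_entrySum]
    refine (abs_entrySum_sub_le (C := C) (ε := ε) _ _ _ (by linarith) hε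
      (fun p q => hKb _ (ht _) _ (ht _)) (fun p q => (hL _ _).trans hC)
      fun p q => h _ (ht _) _ (ht _)).trans ?_
    rw [Fintype.card_fin, sum_abs_detSign, ← mul_assoc, mul_comm (m ! : ℝ)]
    gcongr
    linarith

/-- Kernel universality yields limiting correlation functions and the convergence to them. -/
theorem exists_limitCorr (β : DysonIndex) (hκ : Tendsto κ atTop (𝓝 0))
    (h : KernelUniversality β V ψ a δ κ) :
    ∃ (C c : ℝ) (ρ : ∀ m : ℕ, (Fin m → ℝ) → ℝ), 1 ≤ C ∧ 0 ≤ c ∧ IsLimitCorr C ρ ∧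
      ∀ N, 1 ≤ N → IsApproxCorr C (fun m => rescaledCorr β V ψ a N m) ρ
        (rescaledInterval ψ a δ N) N (c * |κ N|) := by
  -- A convergent sequence is bounded, so 24 + |c| b bounds the finite-N kernels uniformly in N. The
  -- implicit constant c has no prescribed sign and is replaced by |c|.
  obtain ⟨b, hb⟩ := hκ.abs.bddAbove_range
  have hb' : ∀ N, |κ N| ≤ b := fun N => hb ⟨N, rfl⟩
  have hb0 : 0 ≤ b := (abs_nonneg _).trans (hb' 0)
  have hstep : ∀ c N, c * |κ N| ≤ |c| * |κ N| := fun c N =>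
    mul_le_mul_of_nonneg_right (le_abs_self c) (abs_nonneg _)
  have hεC : ∀ c N, 24 + |c| * |κ N| ≤ 24 + |c| * b := fun c N => by
    gcongr; exact hb' N
  have hlarge : ∀ c : ℝ, 24 ≤ 24 + |c| * b := fun c => by
    have : 0 ≤ |c| * b := by positivity
    linarith
  have h96 : ∀ c : ℝ, 96 ≤ 4 * (24 + |c| * b) := fun c => by linarith [hlarge c]
  match β with
  | .one =>
    obtain ⟨K, hK, c, hc⟩ := h
    exact ⟨4 * (24 + |c| * b), |c|, _, by linarith [h96 c], abs_nonneg c,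
      isLimitCorr_one.mono (by norm_num) (h96 c), fun N hN =>
      isApproxCorr_pfaffian (hK N hN) abs_limitKernelOne_le (hlarge c) (by positivity) (hεC c N)
        fun x hx y hy i j => (hc N hN x hx y hy i j).trans (hstep c N)⟩
  | .two =>
    obtain ⟨K, hK, c, hc⟩ := h
    exact ⟨4 * (24 + |c| * b), |c|, _, by linarith [h96 c], abs_nonneg c,
      isLimitCorr_det.mono (by norm_num) (by linarith [h96 c]), fun N hN =>
      isApproxCorr_det (hK N hN) (fun x y => (abs_sineFun_le_one (x - y)).trans (by norm_num))
        (hlarge c) (by positivity) (hεC c N)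
        fun x hx y hy => (hc N hN x hx y hy).trans (hstep c N)⟩
  | .four =>
    obtain ⟨K, hK, c, hc⟩ := h
    exact ⟨4 * (24 + |c| * b), |c|, _, by linarith [h96 c], abs_nonneg c,
      isLimitCorr_four.mono (by norm_num) (h96 c), fun N hN =>
      isApproxCorr_pfaffian (hK N hN) abs_limitKernelFour_le (hlarge c) (by positivity) (hεC c N)
        fun x hx y hy i j => (hc N hN x hx y hy i j).trans (hstep c N)⟩

end Approx

/-! ### Relabelling coordinates -/

lemma coe_piCongrLeft_const {ι κ : Type*} (e : ι ≃ κ) :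
    ⇑(MeasurableEquiv.piCongrLeft (fun _ : κ => ℝ) e) = fun l i => l (e.symm i) := by
  funext l i
  obtain ⟨j, rfl⟩ := e.surjective i
  rw [e.symm_apply_apply]
  exact Equiv.piCongrLeft_apply_apply (fun _ : κ => ℝ) e l j

lemma measurePreserving_relabel {ι κ : Type*} [Fintype ι] [Fintype κ] (e : ι ≃ κ) :
    MeasurePreserving (fun (l : ι → ℝ) i => l (e.symm i)) volume volume := by
  have := volume_measurePreserving_piCongrLeft (fun _ : κ => ℝ) e
  rwa [coe_piCongrLeft_const] at this

lemma measurableEmbedding_relabel {ι κ : Type*} [Fintype ι] [Fintype κ] (e : ι ≃ κ) :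
    MeasurableEmbedding (fun (l : ι → ℝ) i => l (e.symm i)) := by
  have := (MeasurableEquiv.piCongrLeft (fun _ : κ => ℝ) e).measurableEmbedding
  rwa [coe_piCongrLeft_const] at this

/-- Splitting the coordinates into two groups. -/
def joinEquiv {ι κ η : Type*} [Fintype ι] [Fintype κ] [Fintype η] (e : ι ⊕ κ ≃ η) :
    (ι → ℝ) × (κ → ℝ) ≃ᵐ (η → ℝ) :=
  (MeasurableEquiv.sumPiEquivProdPi fun _ : ι ⊕ κ => ℝ).symm.trans
    (MeasurableEquiv.piCongrLeft (fun _ : η => ℝ) e)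

lemma joinEquiv_apply {ι κ η : Type*} [Fintype ι] [Fintype κ] [Fintype η] (e : ι ⊕ κ ≃ η)
    (p : (ι → ℝ) × (κ → ℝ)) (i : η) : joinEquiv e p i = Sum.elim p.1 p.2 (e.symm i) := by
  rw [joinEquiv, MeasurableEquiv.trans_apply, coe_piCongrLeft_const]
  simp only
  rcases e.symm i with j | j <;> rfl

lemma measurePreserving_joinEquiv {ι κ η : Type*} [Fintype ι] [Fintype κ] [Fintype η]
    (e : ι ⊕ κ ≃ η) : MeasurePreserving (joinEquiv e) (volume.prod volume) volume :=
  (volume_measurePreserving_piCongrLeft (fun _ : η => ℝ) e).comp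
    (volume_measurePreserving_sumPiEquivProdPi_symm fun _ : ι ⊕ κ => ℝ)

/-- The equivalence behind `joinVec`. -/
def joinIndex {N k : ℕ} (hk : k ≤ N) : Fin k ⊕ Fin (N - k) ≃ Fin N :=
  finSumFinEquiv.trans (finCongr (by omega))

lemma joinEquiv_joinIndex {N k : ℕ} (hk : k ≤ N) (p : (Fin k → ℝ) × (Fin (N - k) → ℝ)) :
    joinEquiv (joinIndex hk) p = joinVec p.1 p.2 := by
  funext i
  obtain ⟨j, rfl⟩ := (joinIndex hk).surjective i
  rw [joinEquiv_apply, Equiv.symm_apply_apply]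
  rcases j with j | j
  · simp [joinVec, joinIndex]
  · simp [joinVec, joinIndex, -Fin.natAdd_eq_addNat]

lemma joinVec_castLE {N k : ℕ} (hk : k ≤ N) (t : Fin k → ℝ) (u : Fin (N - k) → ℝ) :
    (fun i => joinVec t u (Fin.castLE hk i)) = t := by
  funext i
  simp [joinVec]

lemma append_eq_joinEquiv {k m : ℕ} (p : (Fin k → ℝ) × (Fin m → ℝ)) :
    joinEquiv finSumFinEquiv p = Fin.append p.1 p.2 := by
  funext i
  rw [joinEquiv_apply]
  induction i using Fin.addCases <;> simp [-Fin.natAdd_eq_addNat]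

/-! ### Symmetrisation -/

lemma ae_injective (N : ℕ) : ∀ᵐ l : Fin N → ℝ, Function.Injective l := by
  have h : ∀ i j : Fin N, ∀ᵐ l : Fin N → ℝ, l i = l j → i = j := by
    intro i j
    rcases eq_or_ne i j with hij | hij
    · exact .of_forall fun _ _ => hij
    · let P : Submodule ℝ (Fin N → ℝ) :=
        LinearMap.ker ((LinearMap.proj i : (Fin N → ℝ) →ₗ[ℝ] ℝ) - LinearMap.proj j)
      have hP : P ≠ ⊤ := by
        intro h
        have : (Pi.single i 1 : Fin N → ℝ) ∈ P := h ▸ Submodule.mem_top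
        simp [P, hij.symm] at this
      have h0 := Measure.addHaar_submodule volume P hP
      refine (measure_eq_zero_iff_ae_notMem.1 h0).mono fun l hl heq => (hl ?_).elim
      simp [P, heq]
  filter_upwards [ae_all_iff.2 fun i => ae_all_iff.2 (h i)] with l hl i j hij
  exact hl i j hij

lemma existsUnique_monotone_comp {N : ℕ} {l : Fin N → ℝ} (hl : Function.Injective l) :
    ∃! σ : Equiv.Perm (Fin N), Monotone fun i => l (σ i) := by
  refine ⟨Tuple.sort l, Tuple.monotone_sort l, fun σ hσ => ?_⟩
  have h1 : StrictMono fun i => l (σ i) := hσ.strictMono_of_injective (hl.comp σ.injective)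
  have h2 : StrictMono fun i => l (Tuple.sort l i) :=
    (Tuple.monotone_sort l).strictMono_of_injective (hl.comp (Tuple.sort l).injective)
  have h3 : (fun i => l (σ i)) = fun i => l (Tuple.sort l i) := by
    refine (StrictMono.range_inj h1 h2).1 ?_
    rw [show (fun i => l (σ i)) = l ∘ σ from rfl, show (fun i => l (Tuple.sort l i)) =
      l ∘ Tuple.sort l from rfl, σ.surjective.range_comp, (Tuple.sort l).surjective.range_comp]
  ext i
  exact congrArg Fin.val (hl (congrFun h3 i))

lemma measurableSet_weylChamber (N : ℕ) : MeasurableSet (weylChamber N) :=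
  isClosed_monotone.measurableSet

/-- The integral over `ℝ^N` is the integral of the symmetrisation over the Weyl chamber. -/
theorem integral_eq_weylChamber {N : ℕ} {F : (Fin N → ℝ) → ℝ} (hF : Integrable F) :
    ∫ l, F l = ∫ l in weylChamber N, ∑ σ : Equiv.Perm (Fin N), F fun i => l (σ i) := by
  have hmp : ∀ σ : Equiv.Perm (Fin N),
      MeasurePreserving (fun (l : Fin N → ℝ) i => l (σ i)) volume volume :=
    fun σ => measurePreserving_relabel σ.symm
  have hme : ∀ σ : Equiv.Perm (Fin N), MeasurableEmbedding fun (l : Fin N → ℝ) i => l (σ i) :=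
    fun σ => measurableEmbedding_relabel σ.symm
  have hint : ∀ σ : Equiv.Perm (Fin N), Integrable fun l : Fin N → ℝ => F fun i => l (σ i) :=
    fun σ => ((hmp σ).integrable_comp_emb (hme σ)).2 hF
  have hS : ∀ σ : Equiv.Perm (Fin N),
      MeasurableSet {l : Fin N → ℝ | (fun i => l (σ⁻¹ i)) ∈ weylChamber N} := fun σ =>
    (hme σ⁻¹).measurable (measurableSet_weylChamber N)
  -- Permuting the variables of F amounts to integrating F over a permuted chamber. Off the null set
  -- of coinciding coordinates, these chambers partition ℝ^N.
  have hterm : ∀ σ : Equiv.Perm (Fin N), ∫ l in weylChamber N, F (fun i => l (σ i)) =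
      ∫ l, {l : Fin N → ℝ | (fun i => l (σ⁻¹ i)) ∈ weylChamber N}.indicator F l := by
    intro σ
    rw [integral_indicator (hS σ), ← (hmp σ).setIntegral_preimage_emb (hme σ) F]
    simp
    rfl
  rw [integral_finsetSum _ fun σ _ => (hint σ).integrableOn]
  simp only [hterm]
  rw [← integral_finsetSum _ fun σ _ => hF.indicator (hS σ)]
  refine integral_congr_ae ?_
  filter_upwards [ae_injective N] with l hl
  obtain ⟨σ, hσ, huniq⟩ := existsUnique_monotone_comp hl
  rw [Finset.sum_eq_single σ⁻¹]
  · rw [Set.indicator_of_mem]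
    simpa [weylChamber] using hσ
  · intro τ _ hτ
    refine Set.indicator_of_notMem (fun hm => hτ ?_) _
    rw [← huniq τ⁻¹ hm, inv_inv]
  · simp

/-- Summing over the permutations that extend an embedding. -/
lemma sum_perm_eq_sum_embedding {N k : ℕ} (hk : k ≤ N) (f : Fin k ↪ Fin N)
    (g : (Fin k ↪ Fin N) → ℝ) :
    ∑ σ : Equiv.Perm (Fin N), g (f.trans σ.toEmbedding) = ((N - k)! : ℝ) * ∑ i, g i := by
  classical
  -- The number of permutations inducing i is independent of i, because the symmetric group acts
  -- transitively on embeddings. Comparing the total N! with the number of embeddings then gives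
  -- (N-k)!.
  let c : (Fin k ↪ Fin N) → ℕ := fun i =>
    (Finset.univ.filter fun σ : Equiv.Perm (Fin N) => f.trans σ.toEmbedding = i).card
  have hc : ∀ i, c i = c f := by
    intro i
    have := Equiv.Perm.isMultiplyPretransitive (Fin N) k
    obtain ⟨τ, hτ⟩ := MulAction.exists_smul_eq (Equiv.Perm (Fin N)) f i
    symm
    refine Finset.card_bij (fun σ _ => τ * σ) (fun σ hσ => ?_) (fun _ _ _ _ h => mul_left_cancel h)
      fun σ hσ => ⟨τ⁻¹ * σ, ?_, by simp⟩
    · simp only [Finset.mem_filter, Finset.mem_univ, true_and] at hσ ⊢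
      rw [← hτ]
      ext j
      have := DFunLike.congr_fun hσ j
      simp only [Function.Embedding.trans_apply, Equiv.coe_toEmbedding] at this
      simp [this]
    · simp only [Finset.mem_filter, Finset.mem_univ, true_and] at hσ ⊢
      ext j
      have := DFunLike.congr_fun hσ j
      simp only [Function.Embedding.trans_apply, Equiv.coe_toEmbedding] at this
      simp [this, ← hτ]
  have hsum : ∀ h : (Fin k ↪ Fin N) → ℝ,
      ∑ σ : Equiv.Perm (Fin N), h (f.trans σ.toEmbedding) = (c f : ℝ) * ∑ i, h i := by
    intro h
    rw [← Finset.sum_fiberwise Finset.univ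
      (fun σ : Equiv.Perm (Fin N) => f.trans σ.toEmbedding), Finset.mul_sum]
    refine Finset.sum_congr rfl fun i _ => ?_
    rw [Finset.sum_congr rfl fun σ hσ => congrArg h (Finset.mem_filter.1 hσ).2, Finset.sum_const,
      nsmul_eq_mul, ← hc i]
  have h1 := hsum fun _ => 1
  simp only [Finset.sum_const, Finset.card_univ, Fintype.card_perm, Fintype.card_fin,
    Fintype.card_embedding_eq, nsmul_eq_mul, mul_one] at h1
  have h2 : ((N - k)! : ℝ) * N.descFactorial k = N ! := by
    exact_mod_cast Nat.factorial_mul_descFactorial hk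
  have h3 : (N.descFactorial k : ℝ) ≠ 0 := by
    have := (Nat.descFactorial_eq_zero_iff_lt (n := N) (k := k)).not.2 (not_lt.2 hk)
    exact_mod_cast this
  rw [hsum, mul_right_cancel₀ h3 (h1.symm.trans h2.symm)]

/-! ### Integrability of the eigenvalue density -/

lemma integrable_pow_mul_weight {V : ℝ → ℝ} (hV : FiniteMoments V) (β : DysonIndex) {N : ℕ}
    (hN : 1 ≤ N) (m : ℕ) : Integrable fun x => x ^ m * weight β V N x := by
  cases β with
  | one => exact hV N hN m
  | two => exact hV N hN m
  | four =>
    have := hV (2 * N) (by omega) m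
    simpa [weight] using this

lemma weight_pos (β : DysonIndex) (V : ℝ → ℝ) (N : ℕ) (x : ℝ) : 0 < weight β V N x := by
  cases β <;> exact Real.exp_pos _

lemma integrable_one_add_abs_pow_mul_weight {V : ℝ → ℝ} (hV : FiniteMoments V) (β : DysonIndex)
    {N : ℕ} (hN : 1 ≤ N) (m : ℕ) : Integrable fun x => (1 + |x|) ^ m * weight β V N x := by
  have h : (fun x => (1 + |x|) ^ m * weight β V N x) = fun x =>
      ∑ j ∈ Finset.range (m + 1), (m.choose j : ℝ) * |x ^ (m - j) * weight β V N x| := by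
    funext x
    rw [add_pow, Finset.sum_mul]
    refine Finset.sum_congr rfl fun j _ => ?_
    rw [abs_mul, abs_pow, abs_of_pos (weight_pos β V N x)]
    ring
  rw [h]
  exact integrable_finsetSum _ fun j _ =>
    ((integrable_pow_mul_weight hV β hN (m - j)).abs).const_mul _

lemma one_add_abs_le_prod {N : ℕ} (l : Fin N → ℝ) (j : Fin N) :
    1 + |l j| ≤ ∏ i, (1 + |l i|) := by
  rw [← Finset.mul_prod_erase _ _ (Finset.mem_univ j)]
  refine le_mul_of_one_le_right (by positivity) ?_
  have : ∏ i ∈ Finset.univ.erase j, (1 : ℝ) ≤ ∏ i ∈ Finset.univ.erase j, (1 + |l i|) :=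
    Finset.prod_le_prod (fun _ _ => zero_le_one) fun i _ => by linarith [abs_nonneg (l i)]
  simpa using this

lemma eigenWeight_nonneg (β : DysonIndex) (V : ℝ → ℝ) (N : ℕ) (l : Fin N → ℝ) :
    0 ≤ eigenWeight β V N l := by
  unfold eigenWeight
  refine mul_nonneg (Finset.prod_nonneg fun j _ => Finset.prod_nonneg fun k _ => by positivity)
    (Finset.prod_nonneg fun j _ => (weight_pos β V N _).le)

/-- With P = ∏ (1+|l_i|), each difference |l_k - l_j| is at most P². So the Vandermonde factor is at
most P^M, and the dominating function is a product of one-variable functions with finite integrals.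
-/
lemma integrable_eigenWeight {V : ℝ → ℝ} (hV : FiniteMoments V) (β : DysonIndex) {N : ℕ}
    (hN : 1 ≤ N) : Integrable (eigenWeight β V N) := by
  set M := ∑ j : Fin N, (Finset.Ioi j).card * (2 * β.val) with hM
  have hint : Integrable fun l : Fin N → ℝ => ∏ j, ((1 + |l j|) ^ M * weight β V N (l j)) :=
    Integrable.fintype_prod fun _ => integrable_one_add_abs_pow_mul_weight hV β hN M
  have hw : Integrable fun l : Fin N → ℝ => ∏ j, weight β V N (l j) :=
    Integrable.fintype_prod fun _ => by
      simpa using integrable_pow_mul_weight hV β hN 0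
  refine hint.mono' ?_ (.of_forall fun l => ?_)
  · unfold eigenWeight
    refine AEStronglyMeasurable.mul (Continuous.aestronglyMeasurable ?_) hw.aestronglyMeasurable
    fun_prop
  · rw [Real.norm_eq_abs, abs_of_nonneg (eigenWeight_nonneg β V N l)]
    unfold eigenWeight
    rw [Finset.prod_mul_distrib, Finset.prod_pow]
    have hw0 : 0 ≤ ∏ j, weight β V N (l j) :=
      Finset.prod_nonneg fun j _ => (weight_pos β V N _).le
    refine mul_le_mul_of_nonneg_right ?_ hw0
    set P := ∏ i, (1 + |l i|) with hP
    calc ∏ j, ∏ k ∈ Finset.Ioi j, |l k - l j| ^ β.val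
        ≤ ∏ j : Fin N, ∏ k ∈ Finset.Ioi j, P ^ (2 * β.val) := by
          refine Finset.prod_le_prod (fun j _ => Finset.prod_nonneg fun k _ => by positivity)
            fun j _ => Finset.prod_le_prod (fun k _ => by positivity) fun k _ => ?_
          rw [pow_mul]
          gcongr
          have h1 := one_add_abs_le_prod l j
          have h2 := one_add_abs_le_prod l k
          have h3 := abs_sub (l k) (l j)
          nlinarith [abs_nonneg (l k), abs_nonneg (l j)]
      _ = P ^ M := by
          simp only [Finset.prod_const, ← pow_mul, mul_comm _ (Finset.card _)]
          rw [Finset.prod_pow_eq_pow_sum]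

/-! ### The law of the ordered eigenvalues -/

lemma partitionFunction_nonneg (β : DysonIndex) (V : ℝ → ℝ) (N : ℕ) :
    0 ≤ partitionFunction β V N :=
  integral_nonneg fun l => eigenWeight_nonneg β V N l

lemma jointDensity_nonneg (β : DysonIndex) (V : ℝ → ℝ) (N : ℕ) (l : Fin N → ℝ) :
    0 ≤ jointDensity β V N l :=
  mul_nonneg (inv_nonneg.2 (partitionFunction_nonneg β V N))
    (eigenWeight_nonneg β V N l)

lemma integrable_jointDensity {V : ℝ → ℝ} (hV : FiniteMoments V) (β : DysonIndex) {N : ℕ}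
    (hN : 1 ≤ N) : Integrable (jointDensity β V N) :=
  (integrable_eigenWeight hV β hN).const_mul _

lemma eigenLaw_eq_zero {β : DysonIndex} {V : ℝ → ℝ} {N : ℕ} (h : partitionFunction β V N = 0) :
    eigenLaw β V N = 0 := by
  unfold eigenLaw jointDensity
  simp [h]

lemma isProbabilityMeasure_eigenLaw {V : ℝ → ℝ} (hV : FiniteMoments V) (β : DysonIndex) {N : ℕ}
    (hN : 1 ≤ N) (h : partitionFunction β V N ≠ 0) : IsProbabilityMeasure (eigenLaw β V N) := by
  refine ⟨?_⟩
  rw [eigenLaw, withDensity_apply _ MeasurableSet.univ, Measure.restrict_univ,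
    ← ofReal_integral_eq_lintegral_ofReal (integrable_jointDensity hV β hN).integrableOn
      (.of_forall fun l => jointDensity_nonneg β V N l)]
  unfold jointDensity
  rw [integral_const_mul]
  change ENNReal.ofReal ((partitionFunction β V N)⁻¹ * partitionFunction β V N) = 1
  rw [inv_mul_cancel₀ h, ENNReal.ofReal_one]

lemma integral_eigenLaw {V : ℝ → ℝ} (hV : FiniteMoments V) (β : DysonIndex) {N : ℕ}
    (hN : 1 ≤ N) (g : (Fin N → ℝ) → ℝ) :
    ∫ l, g l ∂eigenLaw β V N = ∫ l in weylChamber N, jointDensity β V N l * g l := by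
  rw [eigenLaw, integral_withDensity_eq_integral_toReal_smul₀
    (integrable_jointDensity hV β hN).integrableOn.aestronglyMeasurable.aemeasurable.ennreal_ofReal
    (.of_forall fun _ => ENNReal.ofReal_lt_top)]
  simp only [ENNReal.toReal_ofReal (jointDensity_nonneg β V N _), smul_eq_mul]

lemma ae_mem_weylChamber (β : DysonIndex) (V : ℝ → ℝ) (N : ℕ) :
    ∀ᵐ l ∂eigenLaw β V N, l ∈ weylChamber N :=
  (withDensity_absolutelyContinuous _ _).ae_le (ae_restrict_mem (measurableSet_weylChamber N))

lemma vandermonde_eq {N : ℕ} (b : ℕ) (l : Fin N → ℝ) :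
    ∏ j : Fin N, ∏ k ∈ Finset.Ioi j, |l k - l j| ^ b = |(Matrix.vandermonde l).det| ^ b := by
  rw [Matrix.det_vandermonde, Finset.abs_prod, ← Finset.prod_pow]
  refine Finset.prod_congr rfl fun j _ => ?_
  rw [Finset.abs_prod, ← Finset.prod_pow]

/-- The interaction is a power of the absolute value of a Vandermonde determinant, and permuting its
rows changes only the sign. -/
lemma jointDensity_comp_perm (β : DysonIndex) (V : ℝ → ℝ) {N : ℕ} (σ : Equiv.Perm (Fin N))
    (l : Fin N → ℝ) : jointDensity β V N (fun i => l (σ i)) = jointDensity β V N l := by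
  unfold jointDensity eigenWeight
  rw [vandermonde_eq, vandermonde_eq, Equiv.prod_comp σ fun j => weight β V N (l j)]
  have : Matrix.vandermonde (fun i => l (σ i)) = (Matrix.vandermonde l).submatrix σ id := by
    ext i j; simp [Matrix.vandermonde_apply]
  rw [this, Matrix.det_permute, abs_mul]
  rcases Int.units_eq_one_or (Equiv.Perm.sign σ) with h | h <;> simp [h]

/-! ### Expectations of sums over tuples -/

section Expectation

variable {V : ℝ → ℝ} {β : DysonIndex} {N k : ℕ} {h : (Fin k → ℝ) → ℝ} {b : ℝ}

lemma integrable_mul_jointDensity (hV : FiniteMoments V) (hN : 1 ≤ N) (hk : k ≤ N)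
    (hm : Measurable h) (hb : ∀ t, |h t| ≤ b) :
    Integrable fun l : Fin N → ℝ => h (fun i => l (Fin.castLE hk i)) * jointDensity β V N l := by
  refine (integrable_jointDensity hV β hN).bdd_mul (c := b) ?_ (.of_forall fun l => hb _)
  exact (hm.comp (measurable_pi_lambda _ fun i => measurable_pi_apply _)).aestronglyMeasurable

lemma integrable_mul_jointDensity_join (hV : FiniteMoments V) (hN : 1 ≤ N) (hk : k ≤ N)
    (hm : Measurable h) (hb : ∀ t, |h t| ≤ b) :
    Integrable (fun p : (Fin k → ℝ) × (Fin (N - k) → ℝ) =>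
      h p.1 * jointDensity β V N (joinVec p.1 p.2)) (volume.prod volume) := by
  have := ((measurePreserving_joinEquiv (joinIndex hk)).integrable_comp_emb
    (joinEquiv (joinIndex hk)).measurableEmbedding).2
    (integrable_mul_jointDensity (β := β) hV hN hk hm hb)
  refine this.congr (.of_forall fun p => ?_)
  simp only [Function.comp, joinEquiv_joinIndex, joinVec_castLE]

lemma integrable_mul_corr (hV : FiniteMoments V) (hN : 1 ≤ N) (hk : k ≤ N)
    (hm : Measurable h) (hb : ∀ t, |h t| ≤ b) :
    Integrable fun t => h t * corr β V N k t := by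
  have := (integrable_mul_jointDensity_join (β := β) hV hN hk hm hb).integral_prod_left
  refine (this.const_mul (1 / ((N - k)! : ℝ))).congr (.of_forall fun t => ?_)
  simp only [corr, integral_const_mul]
  ring

lemma integral_mul_corr (hV : FiniteMoments V) (hN : 1 ≤ N) (hk : k ≤ N)
    (hm : Measurable h) (hb : ∀ t, |h t| ≤ b) :
    ∫ t, h t * corr β V N k t = (1 / ((N - k)! : ℝ)) *
      ∫ l : Fin N → ℝ, h (fun i => l (Fin.castLE hk i)) * jointDensity β V N l := by
  rw [← (measurePreserving_joinEquiv (joinIndex hk)).integral_comp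
    (joinEquiv (joinIndex hk)).measurableEmbedding]
  simp only [joinEquiv_joinIndex, joinVec_castLE]
  rw [integral_prod _ (integrable_mul_jointDensity_join (β := β) hV hN hk hm hb),
    ← integral_const_mul]
  refine integral_congr_ae (.of_forall fun t => ?_)
  simp only [corr, integral_const_mul]
  ring

/-- The correlation functions express expectations of sums over tuples of distinct indices. -/
theorem integral_sum_embedding (hV : FiniteMoments V) (hN : 1 ≤ N) (hk : k ≤ N)
    (hm : Measurable h) (hb : ∀ t, |h t| ≤ b) :
    ∫ l, ∑ i : Fin k ↪ Fin N, h (fun j => l (i j)) ∂eigenLaw β V N =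
      ∫ t, h t * corr β V N k t := by
  rw [integral_eigenLaw hV β hN, integral_mul_corr hV hN hk hm hb,
    integral_eq_weylChamber (integrable_mul_jointDensity hV hN hk hm hb), ← integral_const_mul]
  refine integral_congr_ae (.of_forall fun l => ?_)
  simp only [jointDensity_comp_perm]
  have := sum_perm_eq_sum_embedding hk (Fin.castLEEmb hk) fun i => h fun j => l (i j)
  simp only [Function.Embedding.trans_apply, Equiv.coe_toEmbedding, Fin.castLEEmb_apply] at this
  rw [← Finset.sum_mul, this]
  have h0 : ((N - k)! : ℝ) ≠ 0 := by positivity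
  field_simp

lemma integral_comp_rescale {c a : ℝ} (hc : 0 < c) (f : (Fin k → ℝ) → ℝ) :
    ∫ t : Fin k → ℝ, f (fun i => a + t i / c) = c ^ k * ∫ t, f t := by
  have h1 := Measure.integral_comp_inv_smul (volume : Measure (Fin k → ℝ))
    (fun s => f (fun i => a + s i)) c
  have h2 : ∫ x : Fin k → ℝ, f (fun i => a + x i) = ∫ x, f x :=
    integral_add_left_eq_self (μ := volume) f (fun _ => a)
  rw [h2, Module.finrank_fintype_fun_eq_card,
    Fintype.card_fin, abs_of_pos (by positivity), smul_eq_mul] at h1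
  rw [← h1]
  simp only [Pi.smul_apply, smul_eq_mul, div_eq_inv_mul]

variable {ψ : ℝ → ℝ} {a : ℝ}

lemma rescale_unscale (hc : 0 < N * ψ a) (s : ℝ) : rescale ψ a N (unscale ψ a N s) = s := by
  unfold rescale unscale
  rw [add_sub_cancel_left, mul_assoc, div_mul_cancel₀ _ hc.ne']

lemma measurable_rescale : Measurable (rescale ψ a N) := by
  unfold rescale
  fun_prop

/-- The Jacobian of the rescaling is the factor (Nψ(a))^k by which `rescaledCorr` is normalised. -/
theorem integral_sum_embedding_rescale (hV : FiniteMoments V) (hN : 1 ≤ N) (hk : k ≤ N)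
    (hψ : 0 < ψ a) (hm : Measurable h) (hb : ∀ t, |h t| ≤ b) :
    ∫ l, ∑ i : Fin k ↪ Fin N, h (fun j => rescale ψ a N (l (i j))) ∂eigenLaw β V N =
      ∫ t, h t * rescaledCorr β V ψ a N k t := by
  have hc : 0 < N * ψ a := by
    have : (0 : ℝ) < N := by exact_mod_cast hN
    positivity
  have h1 := integral_sum_embedding (β := β) hV hN hk
    (h := fun t => h fun j => rescale ψ a N (t j))
    (hm.comp (measurable_pi_lambda _ fun i => measurable_rescale.comp (measurable_pi_apply _)))
    (fun t => hb _)
  rw [h1]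
  have h2 := integral_comp_rescale (k := k) (a := a) hc fun t =>
    h (fun j => rescale ψ a N (t j)) * corr β V N k t
  have h3 : ∀ t : Fin k → ℝ, (fun j => rescale ψ a N (a + t j / (N * ψ a))) = t := fun t => by
    funext j; exact rescale_unscale hc (t j)
  simp only [h3] at h2
  have hp : ((N : ℝ) * ψ a) ^ k ≠ 0 := by positivity
  rw [eq_comm, ← mul_right_inj' hp, ← h2, ← integral_const_mul]
  refine integral_congr_ae (.of_forall fun t => ?_)
  simp only [rescaledCorr, unscale]
  field_simp

/-- The kernels are not assumed measurable. Integrability is inherited from the joint density by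
Fubini instead. -/
lemma integrable_mul_rescaledCorr (hV : FiniteMoments V) (hN : 1 ≤ N) (hk : k ≤ N)
    (hψ : 0 < ψ a) (hm : Measurable h) (hb : ∀ t, |h t| ≤ b) :
    Integrable fun t => h t * rescaledCorr β V ψ a N k t := by
  have hc : 0 < N * ψ a := by
    have : (0 : ℝ) < N := by exact_mod_cast hN
    positivity
  have h1 := integrable_mul_corr (β := β) hV hN hk
    (h := fun t => h fun j => rescale ψ a N (t j))
    (hm.comp (measurable_pi_lambda _ fun i => measurable_rescale.comp (measurable_pi_apply _)))
    (fun t => hb _)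
  have h2 := ((integrable_comp_smul_iff volume (fun s : Fin k → ℝ =>
    h (fun j => rescale ψ a N (a + s j)) * corr β V N k (fun j => a + s j))
    (R := (N * ψ a)⁻¹) (inv_ne_zero hc.ne')).2 ?_).const_mul (((N : ℝ) * ψ a) ^ k)⁻¹
  · refine h2.congr (.of_forall fun t => ?_)
    have h3 : ∀ j, a + ((N * ψ a)⁻¹ • t) j = unscale ψ a N (t j) := fun j => by
      simp [unscale, div_eq_inv_mul]
    simp only [h3, rescale_unscale hc, rescaledCorr]
    ring
  · exact h1.comp_add_left (fun _ => a)

end Expectation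

/-! ### Clusters of points -/

/-- The `m`-tuples of points of `A` with mutual distances at most `α`. -/
def clusterSet (A : Set ℝ) (α : ℝ) (m : ℕ) : Set (Fin m → ℝ) :=
  {t | (∀ i, t i ∈ A) ∧ ∀ i j, |t i - t j| ≤ α}

/-- The indicator function of `clusterSet`. -/
noncomputable def clusterInd (A : Set ℝ) (α : ℝ) (m : ℕ) : (Fin m → ℝ) → ℝ :=
  (clusterSet A α m).indicator fun _ => 1

open Classical in
/-- The indicator of the event that the points with labels in `T` form a cluster. -/
noncomputable def clusterWeight {N : ℕ} (A : Set ℝ) (α : ℝ) (x : Fin N → ℝ) (T : Finset (Fin N)) :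
    ℝ :=
  if (∀ i ∈ T, x i ∈ A) ∧ ∀ i ∈ T, ∀ j ∈ T, |x i - x j| ≤ α then 1 else 0

section Counting

variable {N k : ℕ} {A : Set ℝ} {α : ℝ} {x : Fin N → ℝ}

lemma clusterInd_nonneg {m : ℕ} (t : Fin m → ℝ) : 0 ≤ clusterInd A α m t :=
  Set.indicator_nonneg (fun _ _ => zero_le_one) t

lemma clusterInd_le_one {m : ℕ} (t : Fin m → ℝ) : clusterInd A α m t ≤ 1 :=
  Set.indicator_le_self' (fun _ _ => zero_le_one) t

lemma abs_clusterInd_le_one {m : ℕ} (t : Fin m → ℝ) : |clusterInd A α m t| ≤ 1 := by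
  rw [abs_of_nonneg (clusterInd_nonneg t)]
  exact clusterInd_le_one t

lemma clusterWeight_nonneg (T : Finset (Fin N)) : 0 ≤ clusterWeight A α x T := by
  unfold clusterWeight
  split_ifs <;> norm_num

open Classical in
lemma clusterInd_comp_eq (f : Fin k → Fin N) :
    clusterInd A α k (fun j => x (f j)) = clusterWeight A α x (Finset.univ.image f) := by
  simp [clusterInd, clusterWeight, clusterSet, Set.indicator_apply]

open Classical in
lemma sum_strictMono_eq (g : Finset (Fin N) → ℝ) :
    ∑ i : Fin k → Fin N with StrictMono i, g (Finset.univ.image i) =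
      ∑ T ∈ Finset.powersetCard k Finset.univ, g T := by
  refine Finset.sum_bij (fun i _ => Finset.univ.image i) (fun i hi => ?_) (fun i hi j hj h => ?_)
    (fun T hT => ?_) fun _ _ => rfl
  · have hi : StrictMono i := by simpa using hi
    rw [Finset.mem_powersetCard_univ, Finset.card_image_of_injective _ hi.injective]
    simp
  · have hi : StrictMono i := by simpa using hi
    have hj : StrictMono j := by simpa using hj
    refine (StrictMono.range_inj hi hj).1 ?_
    simpa using congrArg (fun s : Finset (Fin N) => (s : Set (Fin N))) h
  · have hc : T.card = k := by simpa [Finset.mem_powersetCard] using hT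
    refine ⟨T.orderEmbOfFin hc, by simpa using (T.orderEmbOfFin hc).strictMono, ?_⟩
    simp

-- Every k-element set is the image of exactly k! embeddings.
open Classical in
lemma sum_embedding_eq (g : Finset (Fin N) → ℝ) :
    ∑ i : Fin k ↪ Fin N, g (Finset.univ.image i) =
      (k ! : ℝ) * ∑ T ∈ Finset.powersetCard k Finset.univ, g T := by
  have hmaps : ∀ i ∈ (Finset.univ : Finset (Fin k ↪ Fin N)),
      Finset.univ.image i ∈ Finset.powersetCard k (Finset.univ : Finset (Fin N)) := fun i _ => by
    rw [Finset.mem_powersetCard_univ, Finset.card_image_of_injective _ i.injective]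
    simp
  rw [← Finset.sum_fiberwise_of_maps_to hmaps, Finset.mul_sum]
  refine Finset.sum_congr rfl fun T hT => ?_
  have hc : T.card = k := by simpa [Finset.mem_powersetCard] using hT
  rw [Finset.sum_congr rfl fun i hi => congrArg g (Finset.mem_filter.1 hi).2, Finset.sum_const,
    nsmul_eq_mul]
  congr 2
  have hperm : (Finset.univ : Finset (Equiv.Perm (Fin k))).card = k ! := by
    rw [Finset.card_univ, Fintype.card_perm, Fintype.card_fin]
  rw [← hperm]
  symm
  refine Finset.card_bij
    (fun σ _ => σ.toEmbedding.trans (T.orderEmbOfFin hc).toEmbedding) (fun σ _ => ?_)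
    (fun σ _ τ _ h => ?_) fun i hi => ?_
  · simp only [Finset.mem_filter, Finset.mem_univ, true_and]
    apply Finset.coe_injective
    rw [Finset.coe_image, Finset.coe_univ, Set.image_univ]
    have : (⇑(σ.toEmbedding.trans (T.orderEmbOfFin hc).toEmbedding) : Fin k → Fin N) =
      (T.orderEmbOfFin hc) ∘ σ := rfl
    rw [this, σ.surjective.range_comp, Finset.range_orderEmbOfFin]
  · ext j
    have := DFunLike.congr_fun h j
    have := (T.orderEmbOfFin hc).injective this
    exact congrArg Fin.val this
  · have hi : Finset.univ.image i = T := by simpa using hi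
    have hmem : ∀ j, i j ∈ T := fun j => by rw [← hi]; simp
    let f : Fin k → Fin k := fun j => (T.orderIsoOfFin hc).symm ⟨i j, hmem j⟩
    have hf : Function.Injective f := fun j j' h => by
      have := (T.orderIsoOfFin hc).symm.injective h
      exact i.injective (congrArg Subtype.val this)
    refine ⟨Equiv.ofBijective f (Finite.injective_iff_bijective.1 hf), Finset.mem_univ _, ?_⟩
    ext j
    change ((T.orderEmbOfFin hc (f j) : Fin N) : ℕ) = (i j : ℕ)
    rw [← Finset.coe_orderIsoOfFin_apply]
    simp [f]

lemma sum_embedding_clusterInd :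
    ∑ i : Fin k ↪ Fin N, clusterInd A α k (fun j => x (i j)) =
      (k ! : ℝ) * ∑ T ∈ Finset.powersetCard k Finset.univ, clusterWeight A α x T := by
  classical
  rw [← sum_embedding_eq]
  refine Finset.sum_congr rfl fun i _ => ?_
  rw [clusterInd_comp_eq]

open Classical in
/-- Pairs of disjoint clusters. -/
lemma sum_embedding_disjoint :
    ∑ e : Fin (k + k) ↪ Fin N, clusterInd A α k (fun j => x (e (Fin.castAdd k j))) *
        clusterInd A α k (fun j => x (e (Fin.natAdd k j))) =
      (k ! : ℝ) ^ 2 * ∑ T ∈ Finset.powersetCard k Finset.univ,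
        ∑ U ∈ Finset.powersetCard k Finset.univ,
          if Disjoint T U then clusterWeight A α x T * clusterWeight A α x U else 0 := by
  have h1 : (k ! : ℝ) ^ 2 * ∑ T ∈ Finset.powersetCard k Finset.univ,
        ∑ U ∈ Finset.powersetCard k Finset.univ,
          (if Disjoint T U then clusterWeight A α x T * clusterWeight A α x U else 0) =
      ∑ i : Fin k ↪ Fin N, ∑ j : Fin k ↪ Fin N,
        if Disjoint (Finset.univ.image i) (Finset.univ.image j) then
          clusterInd A α k (fun l => x (i l)) * clusterInd A α k (fun l => x (j l)) else 0 := by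
    simp only [clusterInd_comp_eq]
    rw [sum_embedding_eq (fun T => ∑ j : Fin k ↪ Fin N,
      if Disjoint T (Finset.univ.image j) then
          clusterWeight A α x T * clusterWeight A α x (Finset.univ.image j) else 0), pow_two,
      mul_assoc, Finset.mul_sum]
    congr 1
    refine Finset.sum_congr rfl fun T _ => ?_
    rw [sum_embedding_eq (fun U => if Disjoint T U then
          clusterWeight A α x T * clusterWeight A α x U else 0)]
  rw [h1, ← Fintype.sum_prod_type' (f := fun i j : Fin k ↪ Fin N =>
      if Disjoint (Finset.univ.image i) (Finset.univ.image j) then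
          clusterInd A α k (fun l => x (i l)) * clusterInd A α k (fun l => x (j l)) else 0),
    ← Finset.sum_filter]
  let E : (Fin (k + k) ↪ Fin N) ≃ {f : (Fin k ↪ Fin N) × (Fin k ↪ Fin N) //
      Disjoint (Set.range f.1) (Set.range f.2)} :=
    (Equiv.embeddingCongr finSumFinEquiv.symm (Equiv.refl _)).trans
      Equiv.sumEmbeddingEquivProdEmbeddingDisjoint
  refine Finset.sum_bij (fun e _ => (E e).1) (fun e _ => ?_)
    (fun e _ e' _ h => E.injective (Subtype.ext h)) (fun f hf => ?_) fun e _ => ?_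
  · have := (E e).2
    simp only [Finset.mem_filter, Finset.mem_univ, true_and]
    rw [← Finset.disjoint_coe]
    simpa using this
  · have hf : Disjoint (Finset.univ.image f.1) (Finset.univ.image f.2) := by simpa using hf
    rw [← Finset.disjoint_coe] at hf
    exact ⟨E.symm ⟨f, by simpa using hf⟩, Finset.mem_univ _, by simp⟩
  · rfl

open Classical in
/-- Pairs of overlapping clusters are dominated by larger clusters. -/
lemma sum_overlap_le :
    ∑ T ∈ Finset.powersetCard k (Finset.univ : Finset (Fin N)),
      ∑ U ∈ Finset.powersetCard k Finset.univ,
        (if Disjoint T U then 0 else clusterWeight A α x T * clusterWeight A α x U) ≤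
    ∑ m ∈ Finset.Ico 1 (k + k), (4 : ℝ) ^ m *
      ∑ S ∈ Finset.powersetCard m Finset.univ, clusterWeight A (2 * α) x S := by
  let P := Finset.powersetCard k (Finset.univ : Finset (Fin N))
  let Q := (P ×ˢ P).filter fun p => ¬ Disjoint p.1 p.2
  -- All points of both clusters are within α of the point with the common label c, hence within 2α
  -- of each other.
  have hpt : ∀ p ∈ Q, clusterWeight A α x p.1 * clusterWeight A α x p.2 ≤
      clusterWeight A (2 * α) x (p.1 ∪ p.2) := by
    intro p hp
    obtain ⟨c, hc1, hc2⟩ := Finset.not_disjoint_iff.1 (Finset.mem_filter.1 hp).2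
    by_cases h1 : (∀ i ∈ p.1, x i ∈ A) ∧ ∀ i ∈ p.1, ∀ j ∈ p.1, |x i - x j| ≤ α
    · by_cases h2 : (∀ i ∈ p.2, x i ∈ A) ∧ ∀ i ∈ p.2, ∀ j ∈ p.2, |x i - x j| ≤ α
      · have hc : ∀ i ∈ p.1 ∪ p.2, |x i - x c| ≤ α := by
          intro i hi
          rcases Finset.mem_union.1 hi with hi | hi
          · exact h1.2 i hi c hc1
          · exact h2.2 i hi c hc2
        have h3 : (∀ i ∈ p.1 ∪ p.2, x i ∈ A) ∧
            ∀ i ∈ p.1 ∪ p.2, ∀ j ∈ p.1 ∪ p.2, |x i - x j| ≤ 2 * α := by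
          refine ⟨fun i hi => ?_, fun i hi j hj => ?_⟩
          · rcases Finset.mem_union.1 hi with hi | hi
            · exact h1.1 i hi
            · exact h2.1 i hi
          · have e1 := hc i hi
            have e2 := hc j hj
            rw [abs_sub_comm] at e2
            have e3 := abs_add_le (x i - x c) (x c - x j)
            rw [sub_add_sub_cancel] at e3
            linarith
        simp only [clusterWeight]
        rw [if_pos h1, if_pos h2, if_pos h3]
        norm_num
      · have : clusterWeight A α x p.2 = 0 := if_neg h2
        rw [this, mul_zero]
        exact clusterWeight_nonneg _
    · have : clusterWeight A α x p.1 = 0 := if_neg h1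
      rw [this, zero_mul]
      exact clusterWeight_nonneg _
  have hmaps : ∀ p ∈ Q, p.1 ∪ p.2 ∈
      (Finset.Ico 1 (k + k)).biUnion fun m => Finset.powersetCard m Finset.univ := by
    intro p hp
    obtain ⟨hp1, hp2⟩ := Finset.mem_filter.1 hp
    obtain ⟨h1, h2⟩ := Finset.mem_product.1 hp1
    have h1 : p.1.card = k := (Finset.mem_powersetCard.1 h1).2
    have h2 : p.2.card = k := (Finset.mem_powersetCard.1 h2).2
    obtain ⟨c, hc1, hc2⟩ := Finset.not_disjoint_iff.1 hp2
    have hint : 0 < (p.1 ∩ p.2).card := Finset.card_pos.2 ⟨c, Finset.mem_inter.2 ⟨hc1, hc2⟩⟩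
    have hun := Finset.card_union_add_card_inter p.1 p.2
    have hpos : 0 < (p.1 ∪ p.2).card := Finset.card_pos.2 ⟨c, Finset.mem_union_left _ hc1⟩
    simp only [Finset.mem_biUnion, Finset.mem_Ico, Finset.mem_powersetCard_univ]
    exact ⟨_, ⟨hpos, by omega⟩, rfl⟩
  calc ∑ T ∈ P, ∑ U ∈ P,
        (if Disjoint T U then 0 else clusterWeight A α x T * clusterWeight A α x U)
      = ∑ p ∈ Q, clusterWeight A α x p.1 * clusterWeight A α x p.2 := by
        rw [Finset.sum_filter, Finset.sum_product]
        simp only [ite_not]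
    _ ≤ ∑ p ∈ Q, clusterWeight A (2 * α) x (p.1 ∪ p.2) := Finset.sum_le_sum hpt
    _ = ∑ S ∈ (Finset.Ico 1 (k + k)).biUnion fun m => Finset.powersetCard m Finset.univ,
          ∑ p ∈ Q with p.1 ∪ p.2 = S, clusterWeight A (2 * α) x (p.1 ∪ p.2) :=
        (Finset.sum_fiberwise_of_maps_to hmaps _).symm
    _ ≤ ∑ S ∈ (Finset.Ico 1 (k + k)).biUnion fun m => Finset.powersetCard m Finset.univ,
          (4 : ℝ) ^ S.card * clusterWeight A (2 * α) x S := by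
        refine Finset.sum_le_sum fun S _ => ?_
        rw [Finset.sum_congr rfl fun p hp => congrArg (clusterWeight A (2 * α) x)
          (Finset.mem_filter.1 hp).2, Finset.sum_const, nsmul_eq_mul]
        refine mul_le_mul_of_nonneg_right ?_ (clusterWeight_nonneg _)
        -- A pair with union S consists of two subsets of S, so there are at most 4^|S| of them.
        have hsub : Q.filter (fun p => p.1 ∪ p.2 = S) ⊆ S.powerset ×ˢ S.powerset := by
          intro p hp
          have hp := (Finset.mem_filter.1 hp).2
          rw [Finset.mem_product, Finset.mem_powerset, Finset.mem_powerset, ← hp]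
          exact ⟨Finset.subset_union_left, Finset.subset_union_right⟩
        have hcard := Finset.card_le_card hsub
        rw [Finset.card_product, Finset.card_powerset, ← mul_pow] at hcard
        exact_mod_cast hcard
    _ = _ := by
        rw [Finset.sum_biUnion]
        · refine Finset.sum_congr rfl fun m _ => ?_
          rw [Finset.mul_sum]
          refine Finset.sum_congr rfl fun S hS => ?_
          rw [(Finset.mem_powersetCard.1 hS).2]
        · intro m _ m' _ hne
          exact Finset.pairwise_disjoint_powersetCard _ hne

open Classical in
/-- The square of the number of clusters. -/
lemma sq_sum_clusterWeight :
    (∑ T ∈ Finset.powersetCard k (Finset.univ : Finset (Fin N)), clusterWeight A α x T) ^ 2 =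
    (∑ T ∈ Finset.powersetCard k (Finset.univ : Finset (Fin N)),
      ∑ U ∈ Finset.powersetCard k Finset.univ,
        if Disjoint T U then clusterWeight A α x T * clusterWeight A α x U else 0) +
    ∑ T ∈ Finset.powersetCard k (Finset.univ : Finset (Fin N)),
      ∑ U ∈ Finset.powersetCard k Finset.univ,
        if Disjoint T U then 0 else clusterWeight A α x T * clusterWeight A α x U := by
  rw [pow_two, Finset.sum_mul_sum, ← Finset.sum_add_distrib]
  refine Finset.sum_congr rfl fun T _ => ?_
  rw [← Finset.sum_add_distrib]
  refine Finset.sum_congr rfl fun U _ => ?_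
  split_ifs <;> simp

end Counting

/-! ### The counting measure on the Weyl chamber -/

section Gamma

variable {ψ : ℝ → ℝ} {a : ℝ} {δ : ℕ → ℝ} {N k : ℕ}

lemma rescaledInterval_eq (hc : 0 < N * ψ a) :
    rescaledInterval ψ a δ N = Set.Icc (-(N * ψ a * δ N)) (N * ψ a * δ N) := by
  unfold rescaledInterval bulkInterval
  ext s
  constructor
  · rintro ⟨t, ⟨h1, h2⟩, rfl⟩
    have e1 : -(δ N) ≤ t - a := by linarith
    have e2 : t - a ≤ δ N := by linarith
    constructor
    · have := mul_le_mul_of_nonneg_left e1 hc.le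
      linarith
    · exact mul_le_mul_of_nonneg_left e2 hc.le
  · rintro ⟨h1, h2⟩
    refine ⟨a + s / (N * ψ a), ⟨?_, ?_⟩, ?_⟩
    · have : -δ N ≤ s / (N * ψ a) := by rw [le_div_iff₀ hc]; linarith
      linarith
    · have : s / (N * ψ a) ≤ δ N := by rw [div_le_iff₀ hc]; linarith
      linarith
    · simp only [add_sub_cancel_left]
      exact mul_div_cancel₀ s hc.ne'

lemma rescaledLength_eq (hc : 0 < N * ψ a) (hδ : 0 ≤ δ N) :
    rescaledLength ψ a δ N = 2 * (N * ψ a * δ N) := by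
  rw [rescaledLength, rescaledInterval_eq hc, Real.volume_real_Icc_of_le]
  · ring
  · have := mul_nonneg hc.le hδ
    linarith

open Classical in
lemma gammaCount_eq_sum (hk : 2 ≤ k) (α : ℝ) (l : Fin N → ℝ) :
    gammaCount ψ a δ N k hk α l = (1 / rescaledLength ψ a δ N) *
      ∑ i : Fin k → Fin N with StrictMono i ∧
        rescale ψ a N (l (i ⟨0, by omega⟩)) ∈ rescaledInterval ψ a δ N ∧
        rescale ψ a N (l (i ⟨k - 1, by omega⟩)) ∈ rescaledInterval ψ a δ N,
      if rescale ψ a N (l (i ⟨k - 1, by omega⟩)) - rescale ψ a N (l (i ⟨0, by omega⟩)) ∈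
        Set.Icc 0 α then (1 : ℝ) else 0 := by
  have hpos : 0 ≤ 1 / rescaledLength ψ a δ N := one_div_nonneg.2 measureReal_nonneg
  rw [gammaCount, gammaMeasure, Measure.real, Measure.smul_apply, smul_eq_mul, ENNReal.toReal_mul,
    ENNReal.toReal_ofReal hpos, Measure.finsetSum_apply, ENNReal.toReal_sum]
  · congr 1
    refine Finset.sum_congr rfl fun i _ => ?_
    rw [Measure.dirac_apply' _ measurableSet_Icc, Set.indicator_apply]
    split_ifs <;> simp
  · intro i _
    exact measure_ne_top _ _

/-- On the Weyl chamber the counting variable is a sum over the `k`-element sets of labels. -/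
lemma gammaCount_eq (hc : 0 < N * ψ a) (hk : 2 ≤ k) (α : ℝ) {l : Fin N → ℝ}
    (hl : l ∈ weylChamber N) :
    gammaCount ψ a δ N k hk α l = (1 / rescaledLength ψ a δ N) *
      ∑ T ∈ Finset.powersetCard k (Finset.univ : Finset (Fin N)),
        clusterWeight (rescaledInterval ψ a δ N) α (fun i => rescale ψ a N (l i)) T := by
  classical
  rw [gammaCount_eq_sum, ← sum_strictMono_eq, ← Finset.filter_filter, Finset.sum_filter]
  congr 1
  refine Finset.sum_congr rfl fun i hi => ?_
  have hi : StrictMono i := by simpa using hi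
  -- On the chamber points are ordered like their labels. As A_N is an interval, the conditions on
  -- the first and the last point are therefore conditions on all of them.
  have hmono : Monotone fun j => rescale ψ a N (l (i j)) := by
    intro j j' hjj'
    have h1 : l (i j) ≤ l (i j') := hl (hi.monotone hjj')
    simp only [rescale, mul_assoc]
    have := mul_le_mul_of_nonneg_right (sub_le_sub_right h1 a) hc.le
    linarith
  have hfirst : ∀ j : Fin k, rescale ψ a N (l (i ⟨0, by omega⟩)) ≤ rescale ψ a N (l (i j)) :=
    fun j => hmono (Fin.mk_le_of_le_val (Nat.zero_le _))
  have hlast : ∀ j : Fin k, rescale ψ a N (l (i j)) ≤ rescale ψ a N (l (i ⟨k - 1, by omega⟩)) :=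
    fun j => hmono (Fin.le_def.2 (by have := j.2; simp only; omega))
  rw [← ite_and]
  simp only [clusterWeight, Finset.mem_image, Finset.mem_univ, true_and, forall_exists_index,
    forall_apply_eq_imp_iff]
  refine if_congr ⟨fun h => ⟨fun j => ?_, fun j j' => ?_⟩, fun h => ⟨⟨h.1 _, h.1 _⟩, ?_⟩⟩ rfl rfl
  · rw [rescaledInterval_eq hc] at h ⊢
    exact ⟨h.1.1.1.trans (hfirst j), (hlast j).trans h.1.2.2⟩
  · rw [abs_le]
    have := h.2.2
    constructor <;> linarith [hfirst j, hfirst j', hlast j, hlast j']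
  · refine ⟨sub_nonneg.2 (hfirst _), ?_⟩
    exact (le_abs_self _).trans (h.2 _ _)

end Gamma

/-! ### Translation averages -/

section Average

variable {m : ℕ}

/-- Averaging an integral over the translations in the diagonal direction. -/
lemma integral_eq_integral_translate {F : (Fin (m + 1) → ℝ) → ℝ} (hF : Integrable F) {c : ℝ}
    (hc : 0 ≤ c) :
    c * ∫ y, F y = ∫ y : Fin (m + 1) → ℝ, (Set.Icc 0 c).indicator (fun _ => (1 : ℝ)) (y 0) *
      ∫ τ : ℝ, F fun i => y i + τ := by
  set χ : ℝ → ℝ := (Set.Icc 0 c).indicator fun _ => (1 : ℝ) with hχ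
  have hχm : Measurable χ := measurable_const.indicator measurableSet_Icc
  have hχi : ∫ τ, χ τ = c := by
    rw [hχ, integral_indicator measurableSet_Icc]
    simp [hc]
  have hχint : Integrable χ := by
    rw [hχ, integrable_indicator_iff measurableSet_Icc]
    simp
  -- G is integrated in two ways. Integrating over τ first gives c ∫ F; the volume-preserving shear
  -- (τ, y) ↦ (τ, y + τ) first turns χ(y₀ - τ) into χ(y₀).
  let G : ℝ × (Fin (m + 1) → ℝ) → ℝ := fun p => χ (p.2 0 - p.1) * F p.2
  have hGm : AEStronglyMeasurable G (volume.prod volume) := by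
    refine AEStronglyMeasurable.mul ?_ hF.aestronglyMeasurable.comp_snd
    exact (hχm.comp (by fun_prop)).aestronglyMeasurable
  have hG : Integrable G (volume.prod volume) := by
    rw [integrable_prod_iff' hGm]
    refine ⟨.of_forall fun y => ?_, ?_⟩
    · exact (hχint.comp_sub_left (y 0)).mul_const (F y)
    · have : (fun y : Fin (m + 1) → ℝ => ∫ τ, ‖G (τ, y)‖) = fun y => c * ‖F y‖ := by
        funext y
        simp only [G, norm_mul]
        rw [integral_mul_const]
        congr 1
        have h0 : ∀ τ, ‖χ (y 0 - τ)‖ = χ (y 0 - τ) := fun τ => by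
          rw [Real.norm_eq_abs, abs_of_nonneg]
          exact Set.indicator_nonneg (fun _ _ => zero_le_one) _
        simp only [h0]
        rw [integral_sub_left_eq_self χ volume (y 0), hχi]
      rw [this]
      exact hF.norm.const_mul c
  let S : ℝ × (Fin (m + 1) → ℝ) → ℝ × (Fin (m + 1) → ℝ) := fun p => (p.1, fun i => p.2 i + p.1)
  have hS : MeasurePreserving S (volume.prod volume) (volume.prod volume) := by
    refine (MeasurePreserving.id volume).skew_product
      (g := fun (τ : ℝ) (y : Fin (m + 1) → ℝ) i => y i + τ) ?_ (.of_forall fun τ => ?_)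
    · simp only [Function.uncurry_def]
      fun_prop
    · exact (measurePreserving_add_right volume (fun _ : Fin (m + 1) => τ)).map_eq
  have h1 : ∫ p, G p ∂(volume.prod volume) = c * ∫ y, F y := by
    rw [integral_prod_symm _ hG, ← integral_const_mul]
    refine integral_congr_ae (.of_forall fun y => ?_)
    simp only [G]
    rw [integral_mul_const, integral_sub_left_eq_self χ volume (y 0), hχi]
  have h2 : ∫ p, G p ∂(volume.prod volume) = ∫ p, G (S p) ∂(volume.prod volume) := by
    conv_lhs => rw [← hS.map_eq]
    exact integral_map hS.measurable.aemeasurable (by rw [hS.map_eq]; exact hGm)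
  have hGS : Integrable (fun p => G (S p)) (volume.prod volume) :=
    hS.integrable_comp_of_integrable hG
  rw [← h1, h2, integral_prod_symm _ hGS]
  refine integral_congr_ae (.of_forall fun y => ?_)
  simp only [G, S, add_sub_cancel_right]
  rw [integral_const_mul]

/-- A uniform bound over translations yields a bound on the whole integral, because a cluster
normalised by y₀ ∈ [0, c] has bounded volume. The factor max(1,α) stays on the left so that it can
cancel one contained in B. -/
lemma abs_integral_le_of_translate {F : (Fin (m + 1) → ℝ) → ℝ} (hF : Integrable F) {α B : ℝ}
    (hB : 0 ≤ B)
    (hbound : ∀ y : Fin (m + 1) → ℝ, (∀ i j, |y i - y j| ≤ α) → |∫ τ : ℝ, F fun i => y i + τ| ≤ B)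
    (hzero : ∀ y : Fin (m + 1) → ℝ, ¬ (∀ i j, |y i - y j| ≤ α) → F y = 0) :
    max 1 α * |∫ y, F y| ≤ (3 * max 1 α) ^ (m + 1) * B := by
  set c := max 1 α with hc
  have hc0 : 0 < c := lt_of_lt_of_le one_pos (le_max_left _ _)
  have hαc : α ≤ c := le_max_right _ _
  have h := integral_eq_integral_translate hF hc0.le
  have habs : c * |∫ y, F y| = |c * ∫ y, F y| := by rw [abs_mul, abs_of_pos hc0]
  rw [habs, h]
  -- If y₀ ∈ [0, c] and all distances are at most α ≤ c, then every coordinate is in [-c, 2c].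
  let box : Set (Fin (m + 1) → ℝ) := Set.Icc (fun _ => -c) (fun _ => 2 * c)
  have hbox : volume.real box = (3 * c) ^ (m + 1) := by
    rw [Measure.real, Real.volume_Icc_pi_toReal (by intro i; simp only; linarith)]
    simp
    ring
  have hint : Integrable (box.indicator fun _ => B) volume := by
    rw [integrable_indicator_iff measurableSet_Icc]
    exact integrableOn_const (measure_Icc_lt_top.ne)
  rw [← Real.norm_eq_abs]
  refine (norm_integral_le_of_norm_le hint (.of_forall fun y => ?_)).trans_eq ?_
  · by_cases hy : ∀ i j, |y i - y j| ≤ α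
    · by_cases h0 : y 0 ∈ Set.Icc 0 c
      · rw [Set.indicator_of_mem h0, one_mul, Set.indicator_of_mem]
        · exact hbound y hy
        · constructor
          · intro i
            have := (abs_le.1 (hy i 0)).1
            simp only
            linarith [h0.1]
          · intro i
            have := (abs_le.1 (hy i 0)).2
            simp only
            linarith [h0.2]
      · rw [Set.indicator_of_notMem h0, zero_mul, norm_zero]
        exact Set.indicator_nonneg (fun _ _ => hB) _
    · have : ∀ τ : ℝ, F (fun i => y i + τ) = 0 := fun τ => hzero _ (by simpa using hy)
      simp only [this, integral_zero, mul_zero, norm_zero]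
      exact Set.indicator_nonneg (fun _ _ => hB) _
  · rw [integral_indicator measurableSet_Icc, setIntegral_const, hbox, smul_eq_mul]

variable {L α : ℝ}

lemma measurableSet_clusterSet (A : Set ℝ) (hA : MeasurableSet A) (α : ℝ) (k : ℕ) :
    MeasurableSet (clusterSet A α k) := by
  have : clusterSet A α k = (⋂ i, {t | t i ∈ A}) ∩ ⋂ i, ⋂ j, {t | |t i - t j| ≤ α} := by
    ext t; simp [clusterSet]
  rw [this]
  refine (MeasurableSet.iInter fun i => measurable_pi_apply i hA).inter
    (MeasurableSet.iInter fun i => MeasurableSet.iInter fun j => ?_)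
  exact measurableSet_le (by fun_prop) measurable_const

lemma measurable_clusterInd (L α : ℝ) (k : ℕ) : Measurable (clusterInd (Set.Icc (-L) L) α k) :=
  measurable_const.indicator (measurableSet_clusterSet _ measurableSet_Icc α k)

lemma integrable_clusterInd (L α : ℝ) (k : ℕ) : Integrable (clusterInd (Set.Icc (-L) L) α k) := by
  unfold clusterInd
  rw [integrable_indicator_iff (measurableSet_clusterSet _ measurableSet_Icc α k)]
  refine integrableOn_const (ne_top_of_le_ne_top
    (measure_Icc_lt_top (a := fun _ : Fin k => -L) (b := fun _ => L)).ne (measure_mono ?_))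
  exact fun t ht => ⟨fun i => (ht.1 i).1, fun i => (ht.1 i).2⟩

/-- The translations that keep a cluster inside the interval form an interval. -/
lemma exists_translate_interval (y : Fin (m + 1) → ℝ) (hy : ∀ i j, |y i - y j| ≤ α) :
    ∃ u q₁ q₂, (∀ i, y i ∈ Set.Icc u (u + α)) ∧ q₂ - q₁ ≤ 2 * L ∧ ∀ τ,
      (fun i => y i + τ) ∈ clusterSet (Set.Icc (-L) L) α (m + 1) ↔ τ ∈ Set.Icc q₁ q₂ := by
  obtain ⟨i₀, -, h₀⟩ := Finset.exists_min_image Finset.univ y Finset.univ_nonempty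
  obtain ⟨i₁, -, h₁⟩ := Finset.exists_max_image Finset.univ y Finset.univ_nonempty
  -- A translate lies in [-L, L] exactly when its smallest and its largest point do.
  refine ⟨y i₀, -L - y i₀, L - y i₁, fun i => ⟨h₀ i (Finset.mem_univ _), ?_⟩, ?_, fun τ => ?_⟩
  · linarith [(abs_le.1 (hy i i₀)).2]
  · linarith [h₀ i₁ (Finset.mem_univ _)]
  · simp only [clusterSet, Set.mem_ofPred_eq, add_sub_add_right_eq_sub, hy, implies_true, and_true]
    constructor
    · intro h
      exact ⟨by linarith [(h i₀).1], by linarith [(h i₁).2]⟩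
    · intro h i
      exact ⟨by linarith [h.1, h₀ i (Finset.mem_univ _)], by linarith [h.2, h₁ i (Finset.mem_univ _)]⟩

lemma integral_clusterInd_translate_mul (y : Fin (m + 1) → ℝ) {q₁ q₂ : ℝ} (D : ℝ → ℝ)
    (h : ∀ τ, (fun i => y i + τ) ∈ clusterSet (Set.Icc (-L) L) α (m + 1) ↔ τ ∈ Set.Icc q₁ q₂) :
    ∫ τ : ℝ, clusterInd (Set.Icc (-L) L) α (m + 1) (fun i => y i + τ) * D τ =
      if q₁ ≤ q₂ then ∫ τ in q₁..q₂, D τ else 0 := by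
  have he : (fun τ : ℝ => clusterInd (Set.Icc (-L) L) α (m + 1) (fun i => y i + τ) * D τ) =
      (Set.Icc q₁ q₂).indicator D := by
    funext τ
    by_cases hτ : τ ∈ Set.Icc q₁ q₂
    · rw [Set.indicator_of_mem hτ, clusterInd, Set.indicator_of_mem ((h τ).2 hτ), one_mul]
    · rw [Set.indicator_of_notMem hτ, clusterInd,
        Set.indicator_of_notMem fun hc => hτ ((h τ).1 hc), zero_mul]
  rw [he, integral_indicator measurableSet_Icc]
  split_ifs with hq
  · rw [intervalIntegral.integral_of_le hq, integral_Icc_eq_integral_Ioc]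
  · rw [Set.Icc_eq_empty hq]; simp

/-- The volume of the set of clusters. -/
lemma integral_clusterInd_le (hL : 0 ≤ L) :
    ∫ t, clusterInd (Set.Icc (-L) L) α (m + 1) t ≤ (3 * max 1 α) ^ (m + 1) * (2 * L) := by
  have h := abs_integral_le_of_translate (integrable_clusterInd L α (m + 1))
    (by linarith : 0 ≤ 2 * L) (fun y hy => ?_) fun y hy =>
      Set.indicator_of_notMem (fun hc => hy hc.2) _
  · have h1 : (1 : ℝ) ≤ max 1 α := le_max_left _ _
    refine le_trans (le_abs_self _) (le_trans ?_ h)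
    exact le_mul_of_one_le_left (abs_nonneg _) h1
  · obtain ⟨u, q₁, q₂, -, hlen, hiff⟩ := exists_translate_interval (L := L) y hy
    have := integral_clusterInd_translate_mul y (fun _ => 1) hiff
    simp only [mul_one] at this
    rw [this]
    split_ifs with hq
    · simp only [intervalIntegral.integral_const, smul_eq_mul, mul_one]
      rw [abs_of_nonneg (by linarith)]
      exact hlen
    · simpa using hL

/-- The truncated limiting correlations of two clusters. -/
theorem abs_integral_truncated_le {C : ℝ} {ρ : ∀ m : ℕ, (Fin m → ℝ) → ℝ} (hρ : IsLimitCorr C ρ)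
    (hC : 0 ≤ C) (hL : 0 ≤ L) (hα : 0 ≤ α) :
    |∫ x : Fin (m + 1) → ℝ, ∫ y : Fin (m + 1) → ℝ,
      clusterInd (Set.Icc (-L) L) α (m + 1) x * clusterInd (Set.Icc (-L) L) α (m + 1) y *
        (ρ (m + 1 + (m + 1)) (Fin.append x y) - ρ (m + 1) x * ρ (m + 1) y)| ≤
      (3 * max 1 α) ^ (m + 1) * (2 * L) * ((3 * max 1 α) ^ (m + 1) *
        (C ^ (m + 1 + (m + 1)) * (m + 1 + (m + 1))! * 12)) := by
  set k := m + 1 with hk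
  set I := clusterInd (Set.Icc (-L) L) α k with hI
  set B := C ^ (k + k) * ((k + k)! : ℝ) * 12 with hB
  have hB0 : 0 ≤ B := by positivity
  have h1 : (0 : ℝ) < max 1 α := lt_of_lt_of_le one_pos (le_max_left _ _)
  have hinner : ∀ x : Fin k → ℝ, (∀ i j, |x i - x j| ≤ α) →
      |∫ y : Fin k → ℝ, I y * (ρ (k + k) (Fin.append x y) - ρ k x * ρ k y)| ≤
        (3 * max 1 α) ^ k * B := by
    intro x hx
    have happ : Measurable fun y : Fin k → ℝ => Fin.append x y := by
      refine measurable_pi_lambda _ fun i => ?_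
      induction i using Fin.addCases with
      | left i => simp only [Fin.append_left]; exact measurable_const
      | right i => simp only [Fin.append_right]; exact measurable_pi_apply i
    have hint : Integrable fun y => I y * (ρ (k + k) (Fin.append x y) - ρ k x * ρ k y) := by
      refine (integrable_clusterInd L α k).mul_bdd
        (c := C ^ (k + k) * (k + k)! + C ^ k * k ! * (C ^ k * k !)) ?_ (.of_forall fun y => ?_)
      · exact (((hρ.measurable (k + k)).comp happ).sub
          ((hρ.measurable k).const_mul _)).aestronglyMeasurable
      · refine (norm_sub_le _ _).trans (add_le_add (hρ.bound _ _) ?_)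
        rw [norm_mul]
        exact mul_le_mul (hρ.bound _ _) (hρ.bound _ _) (norm_nonneg _) (by positivity)
    have h := abs_integral_le_of_translate (m := m) hint (B := B * max 1 α) (by positivity)
      (fun y hy => ?_) fun y hy => by
        rw [hI, clusterInd, Set.indicator_of_notMem fun hc => hy hc.2, zero_mul]
    -- The max(1,α) of the translation bound cancels here; this keeps the final exponent of max(1,α)
    -- at 2k.
    · refine le_of_mul_le_mul_left (h.trans_eq ?_) h1
      rw [hk]; ring
    · obtain ⟨u, -, -, hu, -, -⟩ := exists_translate_interval (L := L) x hx
      obtain ⟨w, q₁, q₂, hw, hlen, hiff⟩ := exists_translate_interval (L := L) y hy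
      rw [integral_clusterInd_translate_mul y (fun τ => ρ (k + k) (Fin.append x fun i => y i + τ) -
        ρ k x * ρ k fun i => y i + τ) hiff]
      split_ifs with hq
      · simp only [hρ.translate]
        refine (hρ.shift k x y u w α q₁ q₂ hα hq hu hw).trans_eq ?_
        rw [hB]; ring
      · rw [abs_zero]; positivity
  have hI0 : ∀ x, 0 ≤ I x := fun x => clusterInd_nonneg x
  have hbd : Integrable fun x => I x * ((3 * max 1 α) ^ k * B) :=
    (integrable_clusterInd L α k).mul_const _
  rw [← Real.norm_eq_abs]
  refine (norm_integral_le_of_norm_le hbd (.of_forall fun x => ?_)).trans ?_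
  · simp only [mul_assoc (I x)]
    rw [integral_const_mul, norm_mul, Real.norm_of_nonneg (hI0 x)]
    by_cases hx : ∀ i j, |x i - x j| ≤ α
    · exact mul_le_mul_of_nonneg_left (hinner x hx) (hI0 x)
    · have : I x = 0 := Set.indicator_of_notMem (fun hc => hx hc.2) _
      rw [this, zero_mul, zero_mul]
  · rw [integral_mul_const]
    refine mul_le_mul_of_nonneg_right ?_ (by positivity)
    exact integral_clusterInd_le hL

end Average

/-! ### The two-cluster correlations -/

section Pairs

variable {m N : ℕ} {L α C ε : ℝ} {B ρ : ∀ m : ℕ, (Fin m → ℝ) → ℝ}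

/-- The indicator that the first `k` and the last `k` points are both clusters. -/
noncomputable def pairInd (A : Set ℝ) (α : ℝ) (k : ℕ) (t : Fin (k + k) → ℝ) : ℝ :=
  clusterInd A α k (fun j => t (Fin.castAdd k j)) * clusterInd A α k (fun j => t (Fin.natAdd k j))

lemma pairInd_append (A : Set ℝ) (α : ℝ) (k : ℕ) (x y : Fin k → ℝ) :
    pairInd A α k (Fin.append x y) = clusterInd A α k x * clusterInd A α k y := by
  simp [pairInd, -Fin.natAdd_eq_addNat]

lemma measurable_pairInd (L α : ℝ) (k : ℕ) : Measurable (pairInd (Set.Icc (-L) L) α k) :=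
  ((measurable_clusterInd L α k).comp (by fun_prop)).mul
    ((measurable_clusterInd L α k).comp (by fun_prop))

lemma abs_pairInd_le_one (A : Set ℝ) (α : ℝ) (k : ℕ) (t : Fin (k + k) → ℝ) :
    |pairInd A α k t| ≤ 1 := by
  rw [pairInd, abs_mul]
  exact mul_le_one₀ (abs_clusterInd_le_one _) (abs_nonneg _) (abs_clusterInd_le_one _)

lemma measurePreserving_append (k : ℕ) :
    MeasurePreserving (fun p : (Fin k → ℝ) × (Fin k → ℝ) => Fin.append p.1 p.2)
      (volume.prod volume) volume := by
  have h := measurePreserving_joinEquiv (finSumFinEquiv (m := k) (n := k))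
  rwa [show ⇑(joinEquiv (finSumFinEquiv (m := k) (n := k))) = fun p => Fin.append p.1 p.2 from
    funext append_eq_joinEquiv] at h

lemma clusterInd_mul_abs_le {k : ℕ} {A : Set ℝ} {a b : ℝ} (t : Fin k → ℝ)
    (h : (∀ i, t i ∈ A) → a ≤ b) : clusterInd A α k t * a ≤ clusterInd A α k t * b := by
  by_cases ht : t ∈ clusterSet A α k
  · exact mul_le_mul_of_nonneg_left (h ht.1) (clusterInd_nonneg t)
  · rw [clusterInd, Set.indicator_of_notMem ht, zero_mul, zero_mul]

/-- The integrated correlations of two clusters factorise approximately. -/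
theorem abs_integral_pairInd_sub_sq_le (hρ : IsLimitCorr C ρ) (hC : 0 ≤ C) (hε : 0 ≤ ε)
    (hB : IsApproxCorr C B ρ (Set.Icc (-L) L) N ε) (hN : m + 1 + (m + 1) ≤ N) (hL : 0 ≤ L)
    (hα : 0 ≤ α)
    (h2 : Integrable fun t => pairInd (Set.Icc (-L) L) α (m + 1) t * B (m + 1 + (m + 1)) t)
    (h1 : Integrable fun t => clusterInd (Set.Icc (-L) L) α (m + 1) t * B (m + 1) t) :
    |(∫ t, pairInd (Set.Icc (-L) L) α (m + 1) t * B (m + 1 + (m + 1)) t) -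
        (∫ t, clusterInd (Set.Icc (-L) L) α (m + 1) t * B (m + 1) t) ^ 2| ≤
      (3 * max 1 α) ^ (m + 1) * (2 * L) * ((3 * max 1 α) ^ (m + 1) *
        (C ^ (m + 1 + (m + 1)) * (m + 1 + (m + 1))! * 12)) +
      ((3 * max 1 α) ^ (m + 1) * (2 * L)) ^ 2 * (C ^ (m + 1 + (m + 1)) *
        ((m + 1 + (m + 1))! + 2 * ((m + 1)! : ℝ) ^ 2) * ε) := by
  set k := m + 1 with hk
  set A := Set.Icc (-L) L with hA
  set I := clusterInd A α k with hI
  have hI0 : ∀ x, 0 ≤ I x := fun x => clusterInd_nonneg x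
  have hIint : Integrable I := integrable_clusterInd L α k
  have hIle : ∫ t, I t ≤ (3 * max 1 α) ^ k * (2 * L) := integral_clusterInd_le hL
  have hmp := measurePreserving_append k
  have hme : MeasurableEmbedding fun p : (Fin k → ℝ) × (Fin k → ℝ) => Fin.append p.1 p.2 := by
    have h := (joinEquiv (finSumFinEquiv (m := k) (n := k))).measurableEmbedding
    rwa [show ⇑(joinEquiv (finSumFinEquiv (m := k) (n := k))) = fun p => Fin.append p.1 p.2 from
      funext append_eq_joinEquiv] at h
  have hII : Integrable (fun p : (Fin k → ℝ) × (Fin k → ℝ) => I p.1 * I p.2)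
      (volume.prod volume) := hIint.mul_prod hIint
  have hb2 : Integrable (fun p : (Fin k → ℝ) × (Fin k → ℝ) =>
      I p.1 * I p.2 * B (k + k) (Fin.append p.1 p.2)) (volume.prod volume) := by
    have h := hmp.integrable_comp_of_integrable h2
    refine h.congr (.of_forall fun p => ?_)
    simp only [Function.comp_apply, pairInd_append]
    rfl
  have e2 : ∫ t, pairInd A α k t * B (k + k) t = ∫ p : (Fin k → ℝ) × (Fin k → ℝ),
      I p.1 * I p.2 * B (k + k) (Fin.append p.1 p.2) ∂(volume.prod volume) := by
    rw [← hmp.integral_comp hme]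
    simp only [pairInd_append]
    rfl
  have hb1 : Integrable (fun p : (Fin k → ℝ) × (Fin k → ℝ) =>
      I p.1 * I p.2 * (B k p.1 * B k p.2)) (volume.prod volume) := by
    refine (h1.mul_prod h1).congr (.of_forall fun p => ?_)
    simp only
    ring
  have e1 : (∫ t, I t * B k t) ^ 2 = ∫ p : (Fin k → ℝ) × (Fin k → ℝ),
      I p.1 * I p.2 * (B k p.1 * B k p.2) ∂(volume.prod volume) := by
    rw [pow_two, ← integral_prod_mul]
    refine integral_congr_ae (.of_forall fun p => ?_)
    simp only
    ring
  have hr : Integrable (fun p : (Fin k → ℝ) × (Fin k → ℝ) =>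
      I p.1 * I p.2 * (ρ (k + k) (Fin.append p.1 p.2) - ρ k p.1 * ρ k p.2))
      (volume.prod volume) := by
    refine hII.mul_bdd (c := C ^ (k + k) * (k + k)! + C ^ k * k ! * (C ^ k * k !)) ?_
      (.of_forall fun p => ?_)
    · exact (((hρ.measurable (k + k)).comp hmp.measurable).sub
        (((hρ.measurable k).comp measurable_fst).mul
          ((hρ.measurable k).comp measurable_snd))).aestronglyMeasurable
    · refine (norm_sub_le _ _).trans (add_le_add (hρ.bound _ _) ?_)
      rw [norm_mul]
      exact mul_le_mul (hρ.bound _ _) (hρ.bound _ _) (norm_nonneg _) (by positivity)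
  have er := abs_integral_truncated_le (m := m) hρ hC hL hα
  rw [← integral_prod (fun p : (Fin (m + 1) → ℝ) × (Fin (m + 1) → ℝ) =>
    clusterInd (Set.Icc (-L) L) α (m + 1) p.1 * clusterInd (Set.Icc (-L) L) α (m + 1) p.2 *
      (ρ (m + 1 + (m + 1)) (Fin.append p.1 p.2) - ρ (m + 1) p.1 * ρ (m + 1) p.2)) hr] at er
  have hrest : |∫ p : (Fin k → ℝ) × (Fin k → ℝ),
      (I p.1 * I p.2 * B (k + k) (Fin.append p.1 p.2) - I p.1 * I p.2 * (B k p.1 * B k p.2) -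
        I p.1 * I p.2 * (ρ (k + k) (Fin.append p.1 p.2) - ρ k p.1 * ρ k p.2))
        ∂(volume.prod volume)| ≤
      ((3 * max 1 α) ^ k * (2 * L)) ^ 2 * (C ^ (k + k) * ((k + k)! + 2 * (k ! : ℝ) ^ 2) * ε) := by
    set M := C ^ (k + k) * ((k + k)! + 2 * (k ! : ℝ) ^ 2) * ε with hM
    rw [← Real.norm_eq_abs]
    refine (norm_integral_le_of_norm_le (hII.mul_const M) (.of_forall fun p => ?_)).trans ?_
    · have hs : I p.1 * I p.2 * B (k + k) (Fin.append p.1 p.2) -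
          I p.1 * I p.2 * (B k p.1 * B k p.2) -
          I p.1 * I p.2 * (ρ (k + k) (Fin.append p.1 p.2) - ρ k p.1 * ρ k p.2) =
          I p.1 * (I p.2 * (B (k + k) (Fin.append p.1 p.2) - ρ (k + k) (Fin.append p.1 p.2) -
            (B k p.1 - ρ k p.1) * B k p.2 - ρ k p.1 * (B k p.2 - ρ k p.2))) := by ring
      rw [hs, norm_mul, norm_mul, Real.norm_of_nonneg (hI0 _), Real.norm_of_nonneg (hI0 _),
        mul_assoc]
      refine clusterInd_mul_abs_le _ fun hx => clusterInd_mul_abs_le _ fun hy => ?_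
      have hxy : ∀ i, Fin.append p.1 p.2 i ∈ A := fun i => by
        induction i using Fin.addCases with
        | left i => simpa using hx i
        | right i => simpa only [Fin.append_right] using hy i
      have d2 := hB.diff (k + k) hN _ hxy
      have d1x := hB.diff k (by omega) _ hx
      have d1y := hB.diff k (by omega) _ hy
      have b1y := hB.bound k (by omega) _ hy
      have r1x := hρ.bound k p.1
      rw [Real.norm_eq_abs]
      refine (abs_sub _ _).trans ((add_le_add_left ((abs_sub _ _)) _).trans ?_)
      rw [abs_mul, abs_mul]
      have p1 := mul_le_mul d1x b1y (abs_nonneg _) (by positivity)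
      have p2 := mul_le_mul r1x d1y (abs_nonneg _) (by positivity)
      refine (add_le_add (add_le_add d2 p1) p2).trans_eq ?_
      rw [hM, pow_add]
      ring
    · rw [integral_mul_const, integral_prod_mul]
      have : 0 ≤ M := by positivity
      have h0 : 0 ≤ ∫ t, I t := integral_nonneg hI0
      rw [pow_two]
      gcongr
  rw [e2, e1]
  have hsub := integral_sub (hb2.sub hb1) hr
  simp only [Pi.sub_apply] at hsub
  rw [hsub, integral_sub hb2 hb1] at hrest
  have := abs_add_le (∫ p : (Fin k → ℝ) × (Fin k → ℝ),
    I p.1 * I p.2 * (ρ (k + k) (Fin.append p.1 p.2) - ρ k p.1 * ρ k p.2) ∂(volume.prod volume)) _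
    |>.trans (add_le_add er hrest)
  refine le_trans (le_of_eq ?_) this
  congr 1
  ring

end Pairs

/-! ### The variance of the number of clusters -/

section Variance

variable {β : DysonIndex} {V ψ : ℝ → ℝ} {a L α C ε : ℝ} {N k : ℕ}
  {ρ : ∀ m : ℕ, (Fin m → ℝ) → ℝ}

/-- The number of `k`-clusters among the rescaled points `l`. -/
noncomputable def clusterCount (ψ : ℝ → ℝ) (a : ℝ) (A : Set ℝ) (α : ℝ) (N k : ℕ)
    (l : Fin N → ℝ) : ℝ :=
  ∑ T ∈ Finset.powersetCard k (Finset.univ : Finset (Fin N)),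
    clusterWeight A α (fun i => rescale ψ a N (l i)) T

open Classical in
/-- The number of pairs of disjoint `k`-clusters. -/
noncomputable def disjointCount (ψ : ℝ → ℝ) (a : ℝ) (A : Set ℝ) (α : ℝ) (N k : ℕ)
    (l : Fin N → ℝ) : ℝ :=
  ∑ T ∈ Finset.powersetCard k (Finset.univ : Finset (Fin N)),
    ∑ U ∈ Finset.powersetCard k Finset.univ,
      if Disjoint T U then clusterWeight A α (fun i => rescale ψ a N (l i)) T *
        clusterWeight A α (fun i => rescale ψ a N (l i)) U else 0

lemma clusterCount_eq (A : Set ℝ) (α : ℝ) (l : Fin N → ℝ) : clusterCount ψ a A α N k l =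
    (1 / (k ! : ℝ)) * ∑ i : Fin k ↪ Fin N,
      clusterInd A α k (fun j => rescale ψ a N (l (i j))) := by
  have h := sum_embedding_clusterInd (k := k) (A := A) (α := α)
    (x := fun i => rescale ψ a N (l i))
  rw [h, clusterCount, one_div, inv_mul_cancel_left₀]
  positivity

lemma disjointCount_eq (A : Set ℝ) (α : ℝ) (l : Fin N → ℝ) : disjointCount ψ a A α N k l =
    (1 / (k ! : ℝ) ^ 2) * ∑ e : Fin (k + k) ↪ Fin N,
      pairInd A α k (fun j => rescale ψ a N (l (e j))) := by
  have h := sum_embedding_disjoint (k := k) (A := A) (α := α)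
    (x := fun i => rescale ψ a N (l i))
  simp only [pairInd]
  rw [h, disjointCount, one_div, inv_mul_cancel_left₀]
  positivity

lemma sq_clusterCount_le (A : Set ℝ) (α : ℝ) (l : Fin N → ℝ) :
    clusterCount ψ a A α N k l ^ 2 ≤ disjointCount ψ a A α N k l +
      ∑ m ∈ Finset.Ico 1 (k + k), (4 : ℝ) ^ m * clusterCount ψ a A (2 * α) N m l := by
  rw [clusterCount, sq_sum_clusterWeight]
  exact add_le_add le_rfl sum_overlap_le

lemma measurable_clusterCount (L α : ℝ) :
    Measurable (clusterCount ψ a (Set.Icc (-L) L) α N k) := by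
  rw [funext fun l => clusterCount_eq (ψ := ψ) (a := a) (k := k) (Set.Icc (-L) L) α l]
  refine (Finset.measurable_sum _ fun i _ => ?_).const_mul _
  exact (measurable_clusterInd L α k).comp (measurable_pi_lambda _ fun j =>
    measurable_rescale.comp (measurable_pi_apply _))

lemma measurable_disjointCount (L α : ℝ) :
    Measurable (disjointCount ψ a (Set.Icc (-L) L) α N k) := by
  rw [funext fun l => disjointCount_eq (ψ := ψ) (a := a) (k := k) (Set.Icc (-L) L) α l]
  refine (Finset.measurable_sum _ fun i _ => ?_).const_mul _
  exact (measurable_pairInd L α k).comp (measurable_pi_lambda _ fun j =>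
    measurable_rescale.comp (measurable_pi_apply _))

lemma abs_clusterCount_le (A : Set ℝ) (α : ℝ) (l : Fin N → ℝ) :
    |clusterCount ψ a A α N k l| ≤
      (1 / (k ! : ℝ)) * ∑ _i : Fin k ↪ Fin N, (1 : ℝ) := by
  rw [clusterCount_eq, abs_mul, abs_of_nonneg (by positivity : (0 : ℝ) ≤ 1 / (k ! : ℝ))]
  refine mul_le_mul_of_nonneg_left ?_ (by positivity)
  exact (Finset.abs_sum_le_sum_abs _ _).trans
    (Finset.sum_le_sum fun i _ => abs_clusterInd_le_one _)

lemma abs_disjointCount_le (A : Set ℝ) (α : ℝ) (l : Fin N → ℝ) :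
    |disjointCount ψ a A α N k l| ≤
      (1 / (k ! : ℝ) ^ 2) * ∑ _i : Fin (k + k) ↪ Fin N, (1 : ℝ) := by
  rw [disjointCount_eq, abs_mul, abs_of_nonneg (by positivity : (0 : ℝ) ≤ 1 / (k ! : ℝ) ^ 2)]
  refine mul_le_mul_of_nonneg_left ?_ (by positivity)
  exact (Finset.abs_sum_le_sum_abs _ _).trans
    (Finset.sum_le_sum fun i _ => abs_pairInd_le_one _ _ _ _)

lemma memLp_clusterCount [IsProbabilityMeasure (eigenLaw β V N)] (L α : ℝ) (p : ENNReal) :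
    MemLp (clusterCount ψ a (Set.Icc (-L) L) α N k) p (eigenLaw β V N) :=
  MemLp.of_bound (measurable_clusterCount L α).aestronglyMeasurable _
    (.of_forall fun l => abs_clusterCount_le _ _ l)

lemma integrable_clusterCount [IsProbabilityMeasure (eigenLaw β V N)] (L α : ℝ) :
    Integrable (clusterCount ψ a (Set.Icc (-L) L) α N k) (eigenLaw β V N) :=
  memLp_one_iff_integrable.1 (memLp_clusterCount L α 1)

lemma integrable_disjointCount [IsProbabilityMeasure (eigenLaw β V N)] (L α : ℝ) :
    Integrable (disjointCount ψ a (Set.Icc (-L) L) α N k) (eigenLaw β V N) :=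
  memLp_one_iff_integrable.1 (MemLp.of_bound (measurable_disjointCount L α).aestronglyMeasurable _
    (.of_forall fun l => abs_disjointCount_le _ _ l))

lemma integral_clusterCount (hV : FiniteMoments V) (hN : 1 ≤ N) (hk : k ≤ N) (hψ : 0 < ψ a)
    (L α : ℝ) : ∫ l, clusterCount ψ a (Set.Icc (-L) L) α N k l ∂eigenLaw β V N =
      (1 / (k ! : ℝ)) * ∫ t, clusterInd (Set.Icc (-L) L) α k t * rescaledCorr β V ψ a N k t := by
  simp only [clusterCount_eq]
  rw [integral_const_mul, integral_sum_embedding_rescale hV hN hk hψ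
    (measurable_clusterInd L α k) abs_clusterInd_le_one]

lemma integral_disjointCount (hV : FiniteMoments V) (hN : 1 ≤ N) (hk : k + k ≤ N) (hψ : 0 < ψ a)
    (L α : ℝ) : ∫ l, disjointCount ψ a (Set.Icc (-L) L) α N k l ∂eigenLaw β V N =
      (1 / (k ! : ℝ) ^ 2) *
        ∫ t, pairInd (Set.Icc (-L) L) α k t * rescaledCorr β V ψ a N (k + k) t := by
  simp only [disjointCount_eq]
  rw [integral_const_mul, integral_sum_embedding_rescale hV hN hk hψ
    (measurable_pairInd L α k) (abs_pairInd_le_one _ _ _)]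

lemma clusterCount_eq_zero (hk : N < k) (A : Set ℝ) (α : ℝ) (l : Fin N → ℝ) :
    clusterCount ψ a A α N k l = 0 := by
  rw [clusterCount, Finset.powersetCard_eq_empty.2 (by simpa using hk), Finset.sum_empty]

lemma disjointCount_eq_zero (hk : N < k + k) (A : Set ℝ) (α : ℝ) (l : Fin N → ℝ) :
    disjointCount ψ a A α N k l = 0 := by
  have : IsEmpty (Fin (k + k) ↪ Fin N) := ⟨fun e => by
    have := Fintype.card_le_of_embedding e
    simp only [Fintype.card_fin] at this
    omega⟩
  rw [disjointCount_eq, Finset.univ_eq_empty, Finset.sum_empty, mul_zero]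

/-- The expected number of clusters. -/
lemma integral_clusterCount_le (hV : FiniteMoments V) (hN : 1 ≤ N) (hψ : 0 < ψ a) (hC : 0 ≤ C)
    (hL : 0 ≤ L)
    (hB : IsApproxCorr C (fun m => rescaledCorr β V ψ a N m) ρ (Set.Icc (-L) L) N ε)
    (hk : 1 ≤ k) : ∫ l, clusterCount ψ a (Set.Icc (-L) L) α N k l ∂eigenLaw β V N ≤
      (3 * C * max 1 α) ^ k * (2 * L) := by
  have h1 : (0 : ℝ) < max 1 α := lt_of_lt_of_le one_pos (le_max_left _ _)
  rcases lt_or_ge N k with hkN | hkN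
  · simp only [clusterCount_eq_zero hkN, integral_zero]
    positivity
  obtain ⟨m, rfl⟩ : ∃ m, k = m + 1 := ⟨k - 1, by omega⟩
  rw [integral_clusterCount hV hN hkN hψ]
  have hle : ∫ t, clusterInd (Set.Icc (-L) L) α (m + 1) t * rescaledCorr β V ψ a N (m + 1) t ≤
      ∫ t, clusterInd (Set.Icc (-L) L) α (m + 1) t * (C ^ (m + 1) * ((m + 1)! : ℝ)) :=
    integral_mono (integrable_mul_rescaledCorr hV hN hkN hψ (measurable_clusterInd L α _)
      abs_clusterInd_le_one) ((integrable_clusterInd L α (m + 1)).mul_const _) fun t =>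
      clusterInd_mul_abs_le t fun ht => (le_abs_self _).trans (hB.bound _ hkN t ht)
  rw [integral_mul_const] at hle
  have h2 := integral_clusterInd_le (m := m) (α := α) hL
  calc _ ≤ (1 / ((m + 1)! : ℝ)) * ((3 * max 1 α) ^ (m + 1) * (2 * L) *
        (C ^ (m + 1) * ((m + 1)! : ℝ))) := by
        refine mul_le_mul_of_nonneg_left (hle.trans ?_) (by positivity)
        exact mul_le_mul_of_nonneg_right h2 (by positivity)
    _ = _ := by
        rw [mul_pow, mul_pow, mul_pow]
        field_simp

/-- The contribution of overlapping clusters. -/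
lemma integral_overlap_le [IsProbabilityMeasure (eigenLaw β V N)] (hV : FiniteMoments V)
    (hN : 1 ≤ N) (hψ : 0 < ψ a) (hC : 1 ≤ C) (hL : 0 ≤ L)
    (hB : IsApproxCorr C (fun m => rescaledCorr β V ψ a N m) ρ (Set.Icc (-L) L) N ε) :
    ∫ l, ∑ m ∈ Finset.Ico 1 (k + k), (4 : ℝ) ^ m *
        clusterCount ψ a (Set.Icc (-L) L) (2 * α) N m l ∂eigenLaw β V N ≤
      max 1 α ^ (2 * k) * (2304 * C ^ 2) ^ k * (2 * L) := by
  rw [integral_finsetSum _ fun m _ => (integrable_clusterCount L (2 * α)).const_mul _]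
  simp only [integral_const_mul]
  have h1 : (1 : ℝ) ≤ max 1 α := le_max_left _ _
  have h2 : max 1 (2 * α) ≤ 2 * max 1 α :=
    max_le (by linarith) (by linarith [le_max_right 1 α])
  have h3 : (0 : ℝ) ≤ max 1 (2 * α) := zero_le_one.trans (le_max_left _ _)
  have hterm : ∀ m ∈ Finset.Ico 1 (k + k), (4 : ℝ) ^ m *
      ∫ l, clusterCount ψ a (Set.Icc (-L) L) (2 * α) N m l ∂eigenLaw β V N ≤
      (24 * C * max 1 α) ^ (2 * k) * (2 * L) := by
    intro m hm
    rw [Finset.mem_Ico] at hm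
    calc _ ≤ (4 : ℝ) ^ m * ((3 * C * max 1 (2 * α)) ^ m * (2 * L)) :=
          mul_le_mul_of_nonneg_left
            (integral_clusterCount_le hV hN hψ (by linarith) hL hB hm.1) (by positivity)
      _ ≤ (4 : ℝ) ^ m * ((3 * C * (2 * max 1 α)) ^ m * (2 * L)) := by gcongr
      _ = (24 * C * max 1 α) ^ m * (2 * L) := by
          rw [← mul_assoc, ← mul_pow]; ring_nf
      _ ≤ _ := by
          refine mul_le_mul_of_nonneg_right (pow_le_pow_right₀ ?_ (by omega)) (by linarith)
          nlinarith
  refine (Finset.sum_le_card_nsmul _ _ _ hterm).trans ?_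
  rw [Nat.card_Ico, nsmul_eq_mul]
  -- There are 2k - 1 values of m. Together with (4 · 3 · 2)² = 24² per unit of k this makes 4 · 24²
  -- = 2304.
  have hcard : ((k + k - 1 : ℕ) : ℝ) ≤ 4 ^ k := by
    have : k + k - 1 ≤ 4 ^ k := by
      have h := Nat.lt_two_pow_self (n := 2 * k)
      rw [pow_mul] at h
      norm_num at h
      omega
    exact_mod_cast this
  calc _ ≤ (4 : ℝ) ^ k * ((24 * C * max 1 α) ^ (2 * k) * (2 * L)) :=
        mul_le_mul_of_nonneg_right hcard (by positivity)
    _ = _ := by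
        rw [← mul_assoc, pow_mul, pow_mul, ← mul_pow, ← mul_pow]
        ring

lemma factorial_add_self_le (k : ℕ) : ((k + k)! : ℝ) ≤ 4 ^ k * (k ! : ℝ) ^ 2 := by
  have h := Nat.add_choose_mul_factorial_mul_factorial k k
  have h2 : (k + k).choose k ≤ 4 ^ k := by
    have := Nat.choose_le_two_pow (k + k) k
    exact this.trans_eq (by rw [← two_mul, pow_mul]; norm_num)
  rw [← h]
  push_cast
  rw [mul_assoc, ← pow_two]
  exact mul_le_mul_of_nonneg_right (by exact_mod_cast h2) (by positivity)

/-- The contribution of disjoint clusters. -/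
lemma integral_disjointCount_sub_le (hV : FiniteMoments V)
    (hN : 1 ≤ N) (hψ : 0 < ψ a) (hC : 1 ≤ C) (hL : 0 ≤ L) (hα : 0 ≤ α) (hε : 0 ≤ ε)
    (hρ : IsLimitCorr C ρ)
    (hB : IsApproxCorr C (fun m => rescaledCorr β V ψ a N m) ρ (Set.Icc (-L) L) N ε)
    (hk : 1 ≤ k) :
    (∫ l, disjointCount ψ a (Set.Icc (-L) L) α N k l ∂eigenLaw β V N) -
      (∫ l, clusterCount ψ a (Set.Icc (-L) L) α N k l ∂eigenLaw β V N) ^ 2 ≤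
      max 1 α ^ (2 * k) * (36 * C ^ 2) ^ k * (12 * (2 * L) + 3 * (2 * L) ^ 2 * ε) := by
  have h1 : (0 : ℝ) < max 1 α := lt_of_lt_of_le one_pos (le_max_left _ _)
  rcases lt_or_ge N (k + k) with hkN | hkN
  -- Correlation functions of 2k points are available only for 2k ≤ N. Otherwise there are no
  -- disjoint pairs and the left side is minus a square.
  · simp only [disjointCount_eq_zero hkN, integral_zero]
    have : 0 ≤ max 1 α ^ (2 * k) * (36 * C ^ 2) ^ k * (12 * (2 * L) + 3 * (2 * L) ^ 2 * ε) := by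
      positivity
    linarith [sq_nonneg (∫ l, clusterCount ψ a (Set.Icc (-L) L) α N k l ∂eigenLaw β V N)]
  obtain ⟨m, rfl⟩ : ∃ m, k = m + 1 := ⟨k - 1, by omega⟩
  have h := abs_integral_pairInd_sub_sq_le hρ (by linarith) hε hB hkN hL hα
    (integrable_mul_rescaledCorr hV hN hkN hψ (measurable_pairInd L α _) (abs_pairInd_le_one _ _ _))
    (integrable_mul_rescaledCorr hV hN (by omega) hψ (measurable_clusterInd L α _)
      abs_clusterInd_le_one)
  rw [integral_clusterCount hV hN (by omega) hψ, integral_disjointCount hV hN hkN hψ]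
  have hfac := factorial_add_self_le (m + 1)
  set k := m + 1
  set P := ∫ t, pairInd (Set.Icc (-L) L) α k t * rescaledCorr β V ψ a N (k + k) t
  set Q := ∫ t, clusterInd (Set.Icc (-L) L) α k t * rescaledCorr β V ψ a N k t
  have hf : (0 : ℝ) < (k ! : ℝ) ^ 2 := by positivity
  have h4 : (1 : ℝ) ≤ 4 ^ k := one_le_pow₀ (by norm_num)
  have e : 1 / (k ! : ℝ) ^ 2 * P - (1 / (k ! : ℝ) * Q) ^ 2 = (P - Q ^ 2) / (k ! : ℝ) ^ 2 := by
    field_simp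
  rw [e, div_le_iff₀ hf]
  refine ((le_abs_self _).trans h).trans ?_
  have hC0 : (0 : ℝ) ≤ C := by linarith
  calc _ ≤ (3 * max 1 α) ^ k * (2 * L) * ((3 * max 1 α) ^ k *
        (C ^ (k + k) * (4 ^ k * (k ! : ℝ) ^ 2) * 12)) +
      ((3 * max 1 α) ^ k * (2 * L)) ^ 2 * (C ^ (k + k) *
        (4 ^ k * (k ! : ℝ) ^ 2 + 2 * (4 ^ k * (k ! : ℝ) ^ 2)) * ε) := by
        gcongr
        exact le_mul_of_one_le_left hf.le h4
    _ = ((3 * max 1 α) ^ k * (3 * max 1 α) ^ k * C ^ (k + k) * 4 ^ k) *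
        (12 * (2 * L) + 3 * (2 * L) ^ 2 * ε) * (k ! : ℝ) ^ 2 := by ring
    _ = _ := by
        congr 2
        rw [← two_mul, pow_mul, pow_mul]
        simp only [← mul_pow]
        ring

/-- Disjoint pairs, after subtracting the squared mean, contribute 12 · |A_N| and the κ-term;
overlapping pairs contribute one more |A_N|. Here |A_N| = 2L. -/
theorem variance_clusterCount_le [IsProbabilityMeasure (eigenLaw β V N)] (hV : FiniteMoments V)
    (hN : 1 ≤ N) (hψ : 0 < ψ a) (hC : 1 ≤ C) (hL : 0 ≤ L) (hα : 0 ≤ α) (hε : 0 ≤ ε)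
    (hρ : IsLimitCorr C ρ)
    (hB : IsApproxCorr C (fun m => rescaledCorr β V ψ a N m) ρ (Set.Icc (-L) L) N ε)
    (hk : 1 ≤ k) :
    variance (clusterCount ψ a (Set.Icc (-L) L) α N k) (eigenLaw β V N) ≤
      max 1 α ^ (2 * k) * (2304 * C ^ 2) ^ k * (13 * (2 * L) + 3 * (2 * L) ^ 2 * ε) := by
  have h1 : (0 : ℝ) < max 1 α := lt_of_lt_of_le one_pos (le_max_left _ _)
  have hO : Integrable (fun l => ∑ m ∈ Finset.Ico 1 (k + k), (4 : ℝ) ^ m *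
      clusterCount ψ a (Set.Icc (-L) L) (2 * α) N m l) (eigenLaw β V N) :=
    integrable_finsetSum _ fun m _ => (integrable_clusterCount L (2 * α)).const_mul _
  have hD : Integrable (disjointCount ψ a (Set.Icc (-L) L) α N k) (eigenLaw β V N) :=
    integrable_disjointCount L α
  have hsq : ∫ l, (clusterCount ψ a (Set.Icc (-L) L) α N k ^ 2) l ∂eigenLaw β V N ≤
      (∫ l, disjointCount ψ a (Set.Icc (-L) L) α N k l ∂eigenLaw β V N) +
      ∫ l, ∑ m ∈ Finset.Ico 1 (k + k), (4 : ℝ) ^ m *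
        clusterCount ψ a (Set.Icc (-L) L) (2 * α) N m l ∂eigenLaw β V N := by
    rw [← integral_add hD hO]
    exact integral_mono (memLp_clusterCount L α 2).integrable_sq (hD.add hO)
      fun l => sq_clusterCount_le _ _ l
  rw [variance_eq_sub (memLp_clusterCount L α 2)]
  have ho := integral_overlap_le (k := k) (α := α) hV hN hψ hC hL hB
  have hd := integral_disjointCount_sub_le hV hN hψ hC hL hα hε hρ hB hk
  have hpow : (36 * C ^ 2) ^ k ≤ (2304 * C ^ 2) ^ k := by gcongr; norm_num
  have hd' : max 1 α ^ (2 * k) * (36 * C ^ 2) ^ k * (12 * (2 * L) + 3 * (2 * L) ^ 2 * ε) ≤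
      max 1 α ^ (2 * k) * (2304 * C ^ 2) ^ k * (12 * (2 * L) + 3 * (2 * L) ^ 2 * ε) := by
    gcongr
  linarith

end Variance

/-! ### Assembling the variance bound. -/

/-- The variance bound for a single symmetry class. -/
theorem exists_variance_gammaCount_le (β : DysonIndex) {V ψ : ℝ → ℝ} {a : ℝ} {δ κ : ℕ → ℝ}
    (hκ : Tendsto κ atTop (𝓝 0)) (hs : BulkSetting β V ψ a δ)
    (hu : KernelUniversality β V ψ a δ κ) :
    ∃ D c : ℝ, 0 ≤ D ∧ 0 ≤ c ∧ ∀ (N k : ℕ) (hk : 2 ≤ k), k ≤ N → ∀ α : ℝ, 0 < α →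
      variance (gammaCount ψ a δ N k hk α) (eigenLaw β V N) ≤
        max 1 α ^ (2 * k) * D ^ k *
          ((k : ℝ) ^ k * (13 * (1 / rescaledLength ψ a δ N)) + c * |κ N|) := by
  obtain ⟨C, c, ρ, hC, hc, hρ, hB⟩ := exists_limitCorr β hκ hu
  refine ⟨2304 * C ^ 2, 3 * c, by positivity, by positivity, fun N k hk hkN α hα => ?_⟩
  have hN : 1 ≤ N := by omega
  have h1 : (0 : ℝ) < max 1 α := lt_of_lt_of_le one_pos (le_max_left _ _)
  have hlen : 0 ≤ 1 / rescaledLength ψ a δ N := one_div_nonneg.2 measureReal_nonneg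
  -- If Z = 0, the convention 0⁻¹ = 0 makes the density vanish and the law is the zero measure.
  -- Otherwise it is a probability measure.
  by_cases hZ : partitionFunction β V N = 0
  · rw [eigenLaw_eq_zero hZ, variance_zero_measure]
    positivity
  have := isProbabilityMeasure_eigenLaw hs.moments β hN hZ
  have hcN : 0 < N * ψ a := mul_pos (by exact_mod_cast hN) hs.pos
  have hδ := hs.radius_pos N hN
  set L := N * ψ a * δ N with hL
  have hL0 : 0 < L := mul_pos hcN hδ
  have hA : rescaledInterval ψ a δ N = Set.Icc (-L) L := rescaledInterval_eq hcN
  have hA' : rescaledLength ψ a δ N = 2 * L := rescaledLength_eq hcN hδ.le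
  have hBN := hB N hN
  rw [hA] at hBN
  have hae : gammaCount ψ a δ N k hk α =ᵐ[eigenLaw β V N]
      fun l => (1 / (2 * L)) * clusterCount ψ a (Set.Icc (-L) L) α N k l := by
    filter_upwards [ae_mem_weylChamber β V N] with l hl
    rw [gammaCount_eq hcN hk α hl, hA, hA']
    rfl
  rw [variance_congr hae, variance_const_mul, hA']
  have hv := variance_clusterCount_le hs.moments hN hs.pos hC hL0.le hα.le
    (by positivity) hρ hBN (by omega : 1 ≤ k)
  -- The factor k^k enters only through k^k ≥ 1: the estimate for `clusterCount` is already purely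
  -- exponential in k.
  have hkk : (1 : ℝ) ≤ (k : ℝ) ^ k := one_le_pow₀ (by exact_mod_cast (by omega : 1 ≤ k))
  calc _ ≤ (1 / (2 * L)) ^ 2 * (max 1 α ^ (2 * k) * (2304 * C ^ 2) ^ k *
        (13 * (2 * L) + 3 * (2 * L) ^ 2 * (c * |κ N|))) :=
        mul_le_mul_of_nonneg_left hv (by positivity)
    _ = max 1 α ^ (2 * k) * (2304 * C ^ 2) ^ k * (13 * (1 / (2 * L)) + 3 * c * |κ N|) := by
        field_simp
    _ ≤ _ := by
        have hlen' : 0 ≤ 13 * (1 / (2 * L)) := by positivity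
        exact mul_le_mul_of_nonneg_left
          (add_le_add_left (le_mul_of_one_le_left hlen' hkk) _) (by positivity)

end SpacingEnsemble

theorem theorem5p1 (V : ℝ → ℝ) (ψ : DysonIndex → ℝ → ℝ) (a : ℝ) (δ κ : ℕ → ℝ)
    (hκ : Tendsto κ atTop (𝓝 0)) :
    ∃ C c₁ c₂ : ℝ, 0 < C ∧ 0 < c₁ ∧ 0 < c₂ ∧
      ∀ β : DysonIndex,
        BulkSetting β V (ψ β) a δ → KernelUniversality β V (ψ β) a δ κ →
          ∀ (N k : ℕ) (hk : 2 ≤ k), k ≤ N → ∀ α : ℝ, 0 < α →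
            variance (gammaCount (ψ β) a δ N k hk α) (eigenLaw β V N) ≤
              max 1 α ^ (2 * k) * C ^ k *
                ((k : ℝ) ^ k * (c₁ * (1 / rescaledLength (ψ β) a δ N)) + c₂ * |κ N|) := by
  have h : ∀ β : DysonIndex, ∃ D c : ℝ, 0 ≤ D ∧ 0 ≤ c ∧
      (BulkSetting β V (ψ β) a δ → KernelUniversality β V (ψ β) a δ κ →
        ∀ (N k : ℕ) (hk : 2 ≤ k), k ≤ N → ∀ α : ℝ, 0 < α →
          variance (gammaCount (ψ β) a δ N k hk α) (eigenLaw β V N) ≤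
            max 1 α ^ (2 * k) * D ^ k *
              ((k : ℝ) ^ k * (13 * (1 / rescaledLength (ψ β) a δ N)) + c * |κ N|)) := by
    intro β
    -- The constants must be fixed before β and its hypotheses are given. For a class that violates
    -- them the claim is vacuous and zeros will do; sums over the three classes then serve all β at
    -- once.
    by_cases hb : BulkSetting β V (ψ β) a δ ∧ KernelUniversality β V (ψ β) a δ κ
    · obtain ⟨D, c, hD, hc, hbound⟩ := exists_variance_gammaCount_le β hκ hb.1 hb.2
      exact ⟨D, c, hD, hc, fun _ _ => hbound⟩
    · exact ⟨0, 0, le_rfl, le_rfl, fun h1 h2 => absurd ⟨h1, h2⟩ hb⟩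
  choose D c hD hc hbound using h
  refine ⟨1 + (D .one + D .two + D .four), 13, 1 + (c .one + c .two + c .four), ?_, by norm_num,
    ?_, fun β hs hu N k hk hkN α hα => (hbound β hs hu N k hk hkN α hα).trans ?_⟩
  · linarith [hD .one, hD .two, hD .four]
  · linarith [hc .one, hc .two, hc .four]
  · have hlen : 0 ≤ 1 / rescaledLength (ψ β) a δ N := one_div_nonneg.2 measureReal_nonneg
    have h1 : (0 : ℝ) < max 1 α := lt_of_lt_of_le one_pos (le_max_left _ _)
    have hDle : D β ≤ 1 + (D .one + D .two + D .four) := by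
      cases β <;> linarith [hD .one, hD .two, hD .four]
    have hcle : c β ≤ 1 + (c .one + c .two + c .four) := by
      cases β <;> linarith [hc .one, hc .two, hc .four]
    have hD' := hD β
    have hc' := hc β
    have hpow : 0 ≤ (1 + (D .one + D .two + D .four)) ^ k := pow_nonneg (hD'.trans hDle) k
    gcongr
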